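/- **Notation.** Let $\vartheta(t)=-\frac t2\ln\pi+\mathrm{Im}\ln\Gamma(\frac14+\frac{it}{2})$, $Z(t)=e^{i\vartheta(t)}\zeta(\frac12+it)$ (a real number with $Z^2(t)=|\zeta(\frac12+it)|^2$), and let $c$ be Euler's constant. For $y_0>1$ let $\{\mu\}$ be the class of all functions $\mu\in C^\infty([y_0,\infty))$ that increase (in the wide sense) to $+\infty$ and satisfy $\mu(y)\ge 7y\ln y$ for $y\ge y_0$. A *Jacob's ladder* for $\mu\in\{\mu\}$ on $[T_0,\infty)$ is a function $\varphi:[T_0,\infty)\to[y_0,\infty)$ with $\varphi(T)\to\infty$ as $T\to\infty$ that solves $$\int_0^{\mu[\varphi(T)]}Z^2(t)\,e^{-\frac{2}{\varphi(T)}t}\,dt=\int_0^T Z^2(t)\,dt,\qquad T\ge T_0 .$$ **Theorem.** There are absolute constants $c_0\in\mathbb R$, $Y>1$, $A,B>0$, where $c_0$ is the constant of the Titchmarsh–Kober–Atkinson formula, $$c_0=\lim_{\delta\to0+}\Big(\int_0^\infty Z^2(t)e^{-2\delta t}\,dt-\frac{c-\ln(4\pi\delta)}{2\sin\delta}\Big),$$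 such that, with $$F(y)=\frac y2\ln\frac y2+(c-\ln 2\pi)\frac y2+c_0 ,$$ the following holds for every $y_0\ge Y$. * (Ladders.) For every $\mu\in\{\mu\}$ there are a number $T_0[\varphi]>1$ and a Jacob's ladder $\varphi$ for $\mu$ on $[T_0[\varphi],\infty)$ with $\varphi(T_0[\varphi])=y_0$; any Jacob's ladder $\psi$ for $\mu$ on an interval $[T_1,\infty)$ satisfies $T_1\ge T_0[\varphi]$ and $\psi=\varphi$ on $[T_1,\infty)$. For every $y\ge y_0$ there is exactly one real $M=M(y)$ with $\int_0^{\mu(y)}Z^2(t)e^{-\frac2y t}dt=\int_0^{M}Z^2(t)\,dt$; it is positive, and $$\Big|\int_0^{M(y)}Z^2(t)\,dt-F(y)\Big|\le A\,\frac{\ln y}{y}.$$ * (A) If $\varphi$ is a Jacob's ladder for some $\mu\in\{\mu\}$ on $[T_0,\infty)$, then $\int_0^TZ^2(t)\,dt=F[\varphi(T)]+r[\varphi(T)]$ for all $T\ge T_0$, where $$|r[\varphi(T)]|\le A\,\frac{\ln\varphi(T)}{\varphi(T)}\le B\,\frac{\ln T}{T}.$$ * (B) If $\varphi_1,\varphi_2$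 are Jacob's ladders for $\mu_1,\mu_2\in\{\mu\}$ on $[T_1,\infty)$ and $[T_2,\infty)$, then $|\varphi_1(T)-\varphi_2(T)|\le B/T$ for all $T\ge\max\{T_1,T_2\}$. * (C) Let $S$ be a non-empty subset of $\{\mu\}$ for which the set $\{\mu(y_0):\mu\in S\}$ is bounded above, and let $T_0=\sup_{\mu\in S}\mu(y_0)$. Then every $\mu\in S$ has a Jacob's ladder on the common interval $[T_0,\infty)$, and any Jacob's ladders $\varphi_0,\varphi$ on $[T_0,\infty)$ for elements $\mu_0,\mu\in S$ satisfy $$\varphi_0(T)-\frac BT<\varphi(T)<\varphi_0(T)+\frac BT,\qquad T\ge T_0 .$$ In particular the constants in all these estimates do not depend on the ladders. -/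

import Mathlib

open Filter Topology MeasureTheory Set
open scoped ContDiff

noncomputable section

/-- The Riemann-Siegel angle `ϑ(t) = -(t/2) ln π + Im ln Γ(1/4 + i t/2)`.  The choice of branch of
the logarithm changes `ϑ` by multiples of `2π` only, hence does not influence `Z`. -/
def rsTheta (t : ℝ) : ℝ :=
  -(1 / 2) * t * Real.log Real.pi
    + (Complex.log (Complex.Gamma (1 / 4 + Complex.I * ((t : ℂ) / 2)))).im

/-- Hardy's function `Z(t) = e^{iϑ(t)} ζ(1/2 + it)`.  The right-hand side is real
(see `hardyZ_eq`), so that taking the real part only changes the type. -/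
def hardyZ (t : ℝ) : ℝ :=
  (Complex.exp (Complex.I * (rsTheta t : ℂ)) * riemannZeta (1 / 2 + Complex.I * (t : ℂ))).re

/-- The value `∫_0^T Z²(t) dt` of the Hardy-Littlewood integral. -/
def hlIntegral (T : ℝ) : ℝ := ∫ t in (0 : ℝ)..T, hardyZ t ^ 2

/-- The left-hand side of the nonlinear integral equation as a function of the value `y` of the
unknown function: `∫_0^{μ(y)} Z²(t) e^{-(2/y) t} dt`. -/
def ladderLHS (μ : ℝ → ℝ) (y : ℝ) : ℝ :=
  ∫ t in (0 : ℝ)..(μ y), hardyZ t ^ 2 * Real.exp (-(2 / y) * t)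

/-- The class `{μ}`: smooth functions on `[y₀, ∞)` that increase (in the wide sense) to `+∞` and
satisfy `μ(y) ≥ 7 y ln y`. -/
structure IsRay (y₀ : ℝ) (μ : ℝ → ℝ) : Prop where
  smooth : ContDiffOn ℝ ∞ μ (Ici y₀)
  mono : MonotoneOn μ (Ici y₀)
  tendsto : Tendsto μ atTop atTop
  lower : ∀ y, y₀ ≤ y → 7 * y * Real.log y ≤ μ y

/-- `φ`, considered on `[T₀, ∞)`, is a solution with values in the domain `[y₀, ∞)` of `μ`
of the integral equation
`∫_0^{μ(φ(T))} Z²(t) e^{-(2/φ(T)) t} dt = ∫_0^T Z²(t) dt`, and `φ(T) → ∞`. -/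
structure IsJacobLadder (y₀ : ℝ) (μ : ℝ → ℝ) (T₀ : ℝ) (φ : ℝ → ℝ) : Prop where
  mem : ∀ T, T₀ ≤ T → y₀ ≤ φ T
  eqn : ∀ T, T₀ ≤ T → ladderLHS μ (φ T) = hlIntegral T
  tendsto : Tendsto φ atTop atTop

/-- `F(y) = (y/2) ln(y/2) + (c - ln 2π) (y/2) + c₀`, with `c` the Euler constant. -/
def ladderF (c₀ y : ℝ) : ℝ :=
  y / 2 * Real.log (y / 2)
    + (Real.eulerMascheroniConstant - Real.log (2 * Real.pi)) * (y / 2) + c₀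

/-- `e^{iϑ(t)} ζ(1/2 + it)` is a real number. -/
theorem hardyZ_eq (t : ℝ) :
    (hardyZ t : ℂ) = Complex.exp (Complex.I * (rsTheta t : ℂ))
      * riemannZeta (1 / 2 + Complex.I * (t : ℂ)) := by
  set s : ℂ := 1 / 2 + Complex.I * (t : ℂ) with hs
  have hre : s.re = 1 / 2 := by simp [hs]
  have hs0 : s ≠ 0 := by
    intro h; rw [h] at hre; norm_num at hre
  have hconj : (starRingEnd ℂ) s = 1 - s := by
    apply Complex.ext <;> simp [hs]
    norm_num
  have hGne : Complex.Gammaℝ s ≠ 0 := Complex.Gammaℝ_ne_zero_of_re_pos (by rw [hre]; norm_num)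
  have hGconj : Complex.Gammaℝ ((starRingEnd ℂ) s) = (starRingEnd ℂ) (Complex.Gammaℝ s) := by
    have htwo : (starRingEnd ℂ) (2 : ℂ) = 2 := Complex.conj_ofNat 2
    have h2 : (starRingEnd ℂ) (s / 2) = (starRingEnd ℂ) s / 2 := by rw [map_div₀, htwo]
    have hc : (Real.pi : ℂ) ^ (-(starRingEnd ℂ) s / 2)
        = (starRingEnd ℂ) ((Real.pi : ℂ) ^ (-s / 2)) := by
      have hpi : (Real.pi : ℂ) ≠ 0 := by exact_mod_cast Real.pi_pos.ne'
      rw [Complex.cpow_def_of_ne_zero hpi, Complex.cpow_def_of_ne_zero hpi, ← Complex.exp_conj,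
        map_mul, ← Complex.ofReal_log Real.pi_pos.le, Complex.conj_ofReal,
        map_div₀, map_neg, htwo]
    rw [Complex.Gammaℝ_def, Complex.Gammaℝ_def, map_mul, ← Complex.Gamma_conj, h2, hc]
  have hxi : (starRingEnd ℂ) (Complex.Gammaℝ s * riemannZeta s)
      = Complex.Gammaℝ s * riemannZeta s := by
    have h1 : Complex.Gammaℝ s * riemannZeta s = completedRiemannZeta s := by
      rw [riemannZeta_def_of_ne_zero hs0]; field_simp
    have hs1 : (starRingEnd ℂ) s ≠ 0 := by simpa using hs0
    have hG1 : Complex.Gammaℝ ((starRingEnd ℂ) s) ≠ 0 := by rw [hGconj]; simpa using hGne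
    have h2 : Complex.Gammaℝ ((starRingEnd ℂ) s) * riemannZeta ((starRingEnd ℂ) s)
        = completedRiemannZeta ((starRingEnd ℂ) s) := by
      rw [riemannZeta_def_of_ne_zero hs1]; field_simp
    rw [map_mul, ← hGconj, ← riemannZeta_conj, h2, h1, hconj, completedRiemannZeta_one_sub]
  have hG : ∃ r : ℝ, r ≠ 0 ∧
      Complex.Gammaℝ s = (r : ℂ) * Complex.exp (Complex.I * (rsTheta t : ℂ)) := by
    have hg : s / 2 = 1 / 4 + Complex.I * ((t : ℂ) / 2) := by rw [hs]; ring
    have hgne : Complex.Gamma (s / 2) ≠ 0 :=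
      Complex.Gamma_ne_zero_of_re_pos (by rw [hg]; simp)
    have hpi : (Real.pi : ℂ) ≠ 0 := by exact_mod_cast Real.pi_pos.ne'
    set L := Complex.log (Complex.Gamma (s / 2)) with hL
    refine ⟨Real.exp (-(1 / 4) * Real.log Real.pi + L.re), (Real.exp_pos _).ne', ?_⟩
    rw [Complex.Gammaℝ_def, Complex.cpow_def_of_ne_zero hpi, ← Complex.exp_log hgne, ← hL,
      ← Complex.exp_add, Complex.ofReal_exp, ← Complex.exp_add, ← Complex.ofReal_log Real.pi_pos.le]
    congr 1
    have hth : rsTheta t = -(1 / 2) * t * Real.log Real.pi + L.im := by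
      rw [rsTheta, hL, hg]
    rw [hth, hs]
    conv_lhs => rw [← Complex.re_add_im L]
    push_cast
    ring
  obtain ⟨r, hr, hrG⟩ := hG
  have hfin : (starRingEnd ℂ) (Complex.exp (Complex.I * (rsTheta t : ℂ)) * riemannZeta s)
      = Complex.exp (Complex.I * (rsTheta t : ℂ)) * riemannZeta s := by
    rw [hrG, mul_assoc, map_mul, Complex.conj_ofReal] at hxi
    exact mul_left_cancel₀ (by exact_mod_cast hr) hxi
  rw [hardyZ, ← hs]
  exact Complex.conj_eq_iff_re.mp hfin

/-- `Z²(t) = |ζ(1/2 + it)|²`. -/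
theorem hardyZ_sq (t : ℝ) :
    hardyZ t ^ 2 = ‖riemannZeta (1 / 2 + Complex.I * (t : ℂ))‖ ^ 2 := by
  have h := congrArg (fun z : ℂ => ‖z‖) (hardyZ_eq t)
  simp only [norm_mul, Complex.norm_real, Complex.norm_exp_I_mul_ofReal, one_mul] at h
  rw [← h, Real.norm_eq_abs, sq_abs]

end

/-!
The theorem rests on the Titchmarsh–Kober–Atkinson formula with an error term,
`∫_0^∞ Z²(t) e^{-2δt} dt = (c - ln 4πδ) / (2 sin δ) + π + O(δ)` (`kober`), so that `c₀ = π`.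

*The formula.*  The Lambert series `K(w) = ∑ d(n) e^{-nw}` has Mellin transform `Γ(s) ζ(s)²`.
Removing its singular part `(c - log w) / w` at `0` moves the strip of convergence to `0 < Re s < 1`
(`hasMellin_lambert_sub_pole`).  On the critical line the functional equation turns `Γ(s) ζ(s)²` into
a multiple of `|ζ(s)|² / (1 + e^{iπs})`.  Mellin inversion, continued analytically in `w`, therefore
identifies `∫ |ζ(1/2 + it)|² e^{-zt} / (1 + i e^{-πt}) dt` with the regularized Lambert series at
`w = 2πi e^{-iz}` (`meanTransform_eq`).  For `z = 2δ` the periodicity of `K` moves `w` to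
`4π sin δ e^{-iδ}`, where Wigert's expansion `K(w) = (c - log w) / w + 1/4 + O(|w|)` applies
(`wigert`).  The real part of the weight differs from the indicator of `t > 0` by a function that
costs only `O(δ)` (`abs_meanTransform_sub_laplace_le`).

Wigert's expansion is Euler–Maclaurin summation of `u ↦ planck (uw)` where
`planck z = 1 / (e^z - 1) - e^{-z} / z`; the product `w ∫_0^∞ planck (uw) du` does not depend on `w`
(`ray_integral_eq`), and equals `c` at `w = 1` (`integral_planck`), because `Γ(s) (ζ(s) - 1 / (s - 1))` tends to `c` at `s = 1`.

*The ladders.*  With `δ = 1/y` the main term is exactly `F(y)` up to `O(ln y / y)`, and the condition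
`μ(y) ≥ 7 y ln y` makes the part of the integral beyond `μ(y)` negligible.  Hence the left-hand side
of the integral equation is `F(y) + O(ln y / y)` uniformly in `μ` (`abs_ladderLHS_sub_ladderF_le`).  It
is continuous and strictly increasing in `y`, as the zeros of `ζ` are isolated; so is
`T ↦ ∫_0^T Z²`.  This gives existence and uniqueness of ladders by the intermediate value theorem.
Comparing `∫_0^{4y} Z²` with the same formula at `2y` and `4y` yields `M(y) < 4y`, that is
`φ(T) ≥ T/4` (`exists_ladder_bounds`).  So the error is `O(ln T / T)`, and since `F` expands by at
least a factor `(ln T)/4` on `[T/4, ∞)`, two ladders differ by `O(1/T)`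
(`sub_le_of_ladderF_sub_le`).
-/

namespace JacobLadder

open Complex

/-! ### Growth of the zeta function on the critical line -/

/-- The sawtooth function `{t}` on `(1, ∞)`, extended by zero so that `∫_1^∞ {t} t^{-s-1} dt` is a
Mellin transform. -/
noncomputable def sawtooth (t : ℝ) : ℂ :=
  (Ioi (1 : ℝ)).indicator (fun t => ((Int.fract t : ℝ) : ℂ)) t

lemma norm_sawtooth_le (t : ℝ) : ‖sawtooth t‖ ≤ 1 := by
  unfold sawtooth
  by_cases h : t ∈ Ioi (1 : ℝ)
  · rw [indicator_of_mem h, norm_real, Real.norm_eq_abs, abs_of_nonneg (Int.fract_nonneg t)]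
    exact (Int.fract_lt_one t).le
  · rw [indicator_of_notMem h]; simp

lemma measurable_sawtooth : Measurable sawtooth := by
  unfold sawtooth
  exact (Complex.measurable_ofReal.comp measurable_fract).indicator measurableSet_Ioi

lemma locallyIntegrableOn_sawtooth : LocallyIntegrableOn sawtooth (Ioi 0) := by
  have h : LocallyIntegrable (fun _ : ℝ => (1 : ℝ)) := locallyIntegrable_const 1
  refine (h.mono measurable_sawtooth.aestronglyMeasurable ?_).locallyIntegrableOn _
  exact Eventually.of_forall fun t => by simpa using norm_sawtooth_le t

lemma sawtooth_isBigO_top : sawtooth =O[atTop] (fun t : ℝ => t ^ (-(0 : ℝ))) := by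
  refine Asymptotics.IsBigO.of_bound 1 (Eventually.of_forall fun t => ?_)
  simpa using norm_sawtooth_le t

lemma sawtooth_isBigO_zero (b : ℝ) : sawtooth =O[𝓝[>] 0] (fun t : ℝ => t ^ (-b)) := by
  refine Asymptotics.IsBigO.of_bound 1 ?_
  filter_upwards [Ioo_mem_nhdsGT (zero_lt_one : (0 : ℝ) < 1)] with t ht
  have : sawtooth t = 0 := indicator_of_notMem (by simpa using ht.2.le) _
  rw [this]; simp

lemma mellinConvergent_sawtooth {s : ℂ} (hs : 0 < s.re) : MellinConvergent sawtooth (-s) :=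
  mellinConvergent_of_isBigO_rpow locallyIntegrableOn_sawtooth sawtooth_isBigO_top
    (by simpa using hs) (sawtooth_isBigO_zero (-s.re - 1)) (by simp)

lemma differentiableAt_mellin_sawtooth {s : ℂ} (hs : 0 < s.re) :
    DifferentiableAt ℂ (mellin sawtooth) (-s) :=
  mellin_differentiableAt_of_isBigO_rpow locallyIntegrableOn_sawtooth sawtooth_isBigO_top
    (by simpa using hs) (sawtooth_isBigO_zero (-s.re - 1)) (by simp)

lemma mellin_sawtooth (s : ℂ) :
    mellin sawtooth (-s) = ∫ t in Ioi (1 : ℝ), (t : ℂ) ^ (-s - 1) * ((Int.fract t : ℝ) : ℂ) := by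
  have h : (fun t : ℝ => (t : ℂ) ^ (-s - 1) • sawtooth t)
      = (Ioi (1 : ℝ)).indicator (fun t => (t : ℂ) ^ (-s - 1) * ((Int.fract t : ℝ) : ℂ)) := by
    ext t
    unfold sawtooth
    by_cases h : t ∈ Ioi (1 : ℝ)
    · simp [h]
    · simp [h]
  rw [mellin, h, setIntegral_indicator measurableSet_Ioi]
  congr 2
  ext t; simp only [mem_inter_iff, mem_Ioi]
  constructor
  · exact fun h => h.2
  · exact fun h => ⟨by linarith, h⟩

/-- Partial summation, `ζ(s) = s ∫_1^∞ ⌊t⌋ t^{-s-1} dt`, with `⌊t⌋ = t - {t}`. -/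
lemma riemannZeta_eq_of_one_lt_re {s : ℂ} (hs : 1 < s.re) :
    riemannZeta s = s / (s - 1) - s * mellin sawtooth (-s) := by
  have hs0 : s ≠ 0 := by intro h; simp [h] at hs; linarith
  have hs1 : s - 1 ≠ 0 := by
    intro h
    have : s = 1 := by linear_combination h
    simp [this] at hs
  have h1 : LSeries 1 s = s * ∫ t in Ioi (1 : ℝ), (∑ k ∈ Finset.Icc 1 ⌊t⌋₊, (1 : ℕ → ℂ) k)
      * (t : ℂ) ^ (-(s + 1)) := by
    refine LSeries_eq_mul_integral' 1 (r := 1) zero_le_one hs ?_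
    refine Asymptotics.IsBigO.of_bound 1 (Eventually.of_forall fun n => ?_)
    simp
  rw [← LSeries_one_eq_riemannZeta hs, h1, mellin_sawtooth]
  have hi1 : IntegrableOn (fun t : ℝ => (t : ℂ) ^ (-s)) (Ioi 1) :=
    integrableOn_Ioi_cpow_of_lt (by simpa using hs) one_pos
  have hi2 : IntegrableOn (fun t : ℝ => (t : ℂ) ^ (-s - 1) * ((Int.fract t : ℝ) : ℂ)) (Ioi 1) := by
    have := (mellinConvergent_sawtooth (s := s) (by linarith)).mono_set
      (Ioi_subset_Ioi (zero_le_one : (0 : ℝ) ≤ 1))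
    refine this.congr_fun (fun t ht => ?_) measurableSet_Ioi
    simp [sawtooth, mem_Ioi.mp ht]
  have h2 : ∫ t in Ioi (1 : ℝ), (∑ k ∈ Finset.Icc 1 ⌊t⌋₊, (1 : ℕ → ℂ) k) * (t : ℂ) ^ (-(s + 1))
      = (∫ t in Ioi (1 : ℝ), (t : ℂ) ^ (-s))
        - ∫ t in Ioi (1 : ℝ), (t : ℂ) ^ (-s - 1) * ((Int.fract t : ℝ) : ℂ) := by
    rw [← integral_sub hi1 hi2]
    refine setIntegral_congr_fun measurableSet_Ioi fun t ht => ?_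
    have ht0 : (0 : ℝ) < t := lt_trans one_pos ht
    have htc : (t : ℂ) ≠ 0 := by exact_mod_cast ht0.ne'
    have hfl : ((⌊t⌋₊ : ℝ) : ℂ) = t - ((Int.fract t : ℝ) : ℂ) := by
      rw [← Complex.ofReal_sub, Int.self_sub_fract, natCast_floor_eq_intCast_floor ht0.le]
    have e : (t : ℂ) ^ (-s) = (t : ℂ) ^ (-s - 1) * t := by
      rw [cpow_sub _ _ htc, cpow_one]; field_simp
    simp only [Pi.one_apply, Finset.sum_const, Nat.card_Icc, add_tsub_cancel_right, nsmul_eq_mul,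
      mul_one]
    rw [e, show -(s + 1) = -s - 1 by ring, ← Complex.ofReal_natCast, hfl]
    ring
  rw [h2, integral_Ioi_cpow_of_lt (by simpa using hs) one_pos]
  have : -s + 1 ≠ 0 := by intro h; apply hs1; linear_combination -h
  simp only [ofReal_one, one_cpow]
  field_simp
  ring

/-- Continuation of the sawtooth integral for `ζ` to the half-plane `0 < Re s`. -/
lemma riemannZeta_eq_of_pos_re {s : ℂ} (hs : 0 < s.re) (hs1 : s ≠ 1) :
    riemannZeta s = s / (s - 1) - s * mellin sawtooth (-s) := by
  have hU : IsOpen {s : ℂ | 0 < s.re} := isOpen_lt continuous_const continuous_re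
  have hf : AnalyticOnNhd ℂ riemannZeta₁ {s : ℂ | 0 < s.re} :=
    differentiable_riemannZeta₁.differentiableOn.analyticOnNhd hU
  have hg : AnalyticOnNhd ℂ (fun s => s - s * (s - 1) * mellin sawtooth (-s))
      {s : ℂ | 0 < s.re} := by
    refine DifferentiableOn.analyticOnNhd (fun s hs => ?_) hU
    have : DifferentiableAt ℂ (fun s => mellin sawtooth (-s)) s :=
      (differentiableAt_mellin_sawtooth hs).comp s (by fun_prop)
    exact (differentiableAt_id.sub ((differentiableAt_id.mul
      (differentiableAt_id.sub_const 1)).mul this)).differentiableWithinAt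
  have key : EqOn riemannZeta₁ (fun s => s - s * (s - 1) * mellin sawtooth (-s))
      {s : ℂ | 0 < s.re} := by
    refine hf.eqOn_of_preconnected_of_eventuallyEq hg
      (convex_halfSpace_re_gt 0).isPreconnected (z₀ := 2) (by simp) ?_
    have : {s : ℂ | 1 < s.re} ∈ 𝓝 (2 : ℂ) :=
      (isOpen_lt continuous_const continuous_re).mem_nhds (by simp)
    filter_upwards [this] with z hz
    have hz1 : z ≠ 1 := by rintro rfl; simp at hz
    have hz2 : z - 1 ≠ 0 := sub_ne_zero.mpr hz1
    have e := riemannZeta_eq_inv_sub_mul hz1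
    rw [riemannZeta_eq_of_one_lt_re hz] at e
    field_simp at e
    linear_combination -e
  rw [riemannZeta_eq_inv_sub_mul hs1, key hs]
  have hz2 : s - 1 ≠ 0 := sub_ne_zero.mpr hs1
  field_simp

lemma norm_mellin_sawtooth_le {s : ℂ} (hs : 0 < s.re) : ‖mellin sawtooth (-s)‖ ≤ 1 / s.re := by
  rw [mellin_sawtooth]
  have hi : IntegrableOn (fun t : ℝ => t ^ (-s.re - 1)) (Ioi 1) :=
    integrableOn_Ioi_rpow_of_lt (by linarith) one_pos
  have hv : ∫ t in Ioi (1 : ℝ), t ^ (-s.re - 1) = 1 / s.re := by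
    rw [integral_Ioi_rpow_of_lt (by linarith) one_pos]
    simp
  rw [← hv]
  refine norm_integral_le_of_norm_le hi ?_
  refine (ae_restrict_iff' measurableSet_Ioi).mpr (Eventually.of_forall fun t ht => ?_)
  have ht0 : (0 : ℝ) < t := lt_trans one_pos ht
  rw [norm_mul, norm_cpow_eq_rpow_re_of_pos ht0, norm_real, Real.norm_eq_abs,
    abs_of_nonneg (Int.fract_nonneg t)]
  have : 0 ≤ t ^ (-s.re - 1) := Real.rpow_nonneg ht0.le _
  simp only [sub_re, neg_re, one_re]
  nlinarith [Int.fract_lt_one t]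

/-- The point `1/2 + it` of the critical line. -/
noncomputable def critPt (t : ℝ) : ℂ := 1 / 2 + I * t

@[simp] lemma critPt_re (t : ℝ) : (critPt t).re = 1 / 2 := by simp [critPt]
@[simp] lemma critPt_im (t : ℝ) : (critPt t).im = t := by simp [critPt]

lemma critPt_ne_one (t : ℝ) : critPt t ≠ 1 := by
  intro h
  have := congrArg Complex.re h
  norm_num at this

lemma continuous_critPt : Continuous critPt := by unfold critPt; fun_prop

/-- `|ζ(1/2 + it)|²`, which is `Z²(t)`: the phase `ϑ` plays no role in the argument. -/
noncomputable def zetaSq (t : ℝ) : ℝ := ‖riemannZeta (critPt t)‖ ^ 2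

lemma hardyZ_sq_eq_zetaSq (t : ℝ) : hardyZ t ^ 2 = zetaSq t := hardyZ_sq t

lemma zetaSq_nonneg (t : ℝ) : 0 ≤ zetaSq t := by unfold zetaSq; positivity

lemma continuous_zetaSq : Continuous zetaSq := by
  unfold zetaSq
  refine (Continuous.norm ?_).pow 2
  refine continuous_iff_continuousAt.mpr fun t => ?_
  exact ContinuousAt.comp (f := critPt) (g := riemannZeta)
    (differentiableAt_riemannZeta (critPt_ne_one t)).continuousAt continuous_critPt.continuousAt

lemma critPt_neg (t : ℝ) : critPt (-t) = (starRingEnd ℂ) (critPt t) := by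
  apply Complex.ext <;> simp

lemma zetaSq_neg (t : ℝ) : zetaSq (-t) = zetaSq t := by
  unfold zetaSq
  rw [critPt_neg, riemannZeta_conj, RCLike.norm_conj]

/-- A crude polynomial bound, needed only for convergence.  The factor `s / (s - 1)` has modulus `1` on
the critical line. -/
lemma zetaSq_le (t : ℝ) : zetaSq t ≤ 16 * (1 + |t|) ^ 2 := by
  have h := riemannZeta_eq_of_pos_re (s := critPt t) (by simp) (critPt_ne_one t)
  have hn : ‖critPt t‖ ≤ 1 + |t| := by
    refine (Complex.norm_le_abs_re_add_abs_im _).trans ?_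
    simp only [critPt_re, critPt_im]
    rw [abs_of_pos (by norm_num : (0 : ℝ) < 1 / 2)]; linarith
  have hq : ‖critPt t / (critPt t - 1)‖ = 1 := by
    have e : critPt t - 1 = -(starRingEnd ℂ) (critPt t) := by
      apply Complex.ext <;> simp
      norm_num
    have : critPt t ≠ 0 := by
      intro h; have := congrArg Complex.re h; norm_num at this
    rw [norm_div, e, norm_neg, RCLike.norm_conj, div_self (norm_ne_zero_iff.mpr this)]
  have hm := norm_mellin_sawtooth_le (s := critPt t) (by simp)
  rw [critPt_re] at hm
  have hb : ‖riemannZeta (critPt t)‖ ≤ 4 * (1 + |t|) := by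
    rw [h]
    refine (norm_sub_le _ _).trans ?_
    rw [hq, norm_mul]
    have := abs_nonneg t
    have := norm_nonneg (critPt t)
    nlinarith [norm_nonneg (mellin sawtooth (-critPt t))]
  unfold zetaSq
  nlinarith [norm_nonneg (riemannZeta (critPt t))]

/-! ### The regularized Planck kernel -/

/-- The entire function `(e^z - 1) / z`; `dslope` supplies the value at `0`. -/
noncomputable def expQuot : ℂ → ℂ := dslope Complex.exp 0

/-- The entire function `(e^z - 1 - z) / z²`. -/
noncomputable def expQuot₂ : ℂ → ℂ := dslope expQuot 0

lemma differentiable_expQuot : Differentiable ℂ expQuot := by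
  rw [← differentiableOn_univ]
  exact (differentiableOn_dslope univ_mem).mpr differentiable_exp.differentiableOn

lemma differentiable_expQuot₂ : Differentiable ℂ expQuot₂ := by
  rw [← differentiableOn_univ]
  exact (differentiableOn_dslope univ_mem).mpr differentiable_expQuot.differentiableOn

@[simp] lemma expQuot_zero : expQuot 0 = 1 := by simp [expQuot, dslope_same]

lemma mul_expQuot (z : ℂ) : z * expQuot z = exp z - 1 := by
  have := sub_smul_dslope Complex.exp 0 z
  simpa [expQuot] using this

lemma mul_expQuot₂ (z : ℂ) : z * expQuot₂ z = expQuot z - 1 := by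
  have := sub_smul_dslope expQuot 0 z
  simpa [expQuot₂] using this

lemma norm_exp_quadratic_le {z : ℂ} (hz : ‖z‖ ≤ 1) :
    ‖exp z - 1 - z - z ^ 2 / 2‖ ≤ ‖z‖ ^ 3 := by
  have h := Complex.exp_bound hz (n := 3) (by norm_num)
  have e : exp z - ∑ m ∈ Finset.range 3, z ^ m / (m.factorial : ℂ)
      = exp z - 1 - z - z ^ 2 / 2 := by
    simp [Finset.sum_range_succ, Nat.factorial]; ring
  rw [e] at h
  refine h.trans ?_
  have : 0 ≤ ‖z‖ ^ 3 := by positivity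
  norm_num [Nat.factorial]
  nlinarith

lemma norm_expQuot_sub_le {z : ℂ} (hz : ‖z‖ ≤ 1) : ‖expQuot z - 1 - z / 2‖ ≤ ‖z‖ ^ 2 := by
  rcases eq_or_ne z 0 with rfl | h0
  · simp
  have h := norm_exp_quadratic_le hz
  have e : exp z - 1 - z - z ^ 2 / 2 = z * (expQuot z - 1 - z / 2) := by
    rw [← mul_expQuot]; ring
  rw [e, norm_mul, pow_succ, mul_comm (‖z‖ ^ 2)] at h
  exact le_of_mul_le_mul_left h (norm_pos_iff.mpr h0)

@[simp] lemma expQuot₂_zero : expQuot₂ 0 = 1 / 2 := by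
  have hc : Tendsto expQuot₂ (𝓝[≠] 0) (𝓝 (expQuot₂ 0)) :=
    (differentiable_expQuot₂.continuous.tendsto 0).mono_left nhdsWithin_le_nhds
  refine tendsto_nhds_unique hc ?_
  rw [tendsto_iff_norm_sub_tendsto_zero]
  have hn : Tendsto (fun z : ℂ => ‖z‖) (𝓝[≠] 0) (𝓝 0) := by
    simpa using (continuous_norm.tendsto (0 : ℂ)).mono_left nhdsWithin_le_nhds
  refine squeeze_zero' (Eventually.of_forall fun _ => norm_nonneg _) ?_ hn
  have hb : ∀ᶠ z : ℂ in 𝓝[≠] 0, ‖z‖ ≤ 1 := hn.eventually_le_const one_pos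
  filter_upwards [hb, self_mem_nhdsWithin] with z hz hz0
  have h := norm_expQuot_sub_le hz
  have e : expQuot z - 1 - z / 2 = z * (expQuot₂ z - 1 / 2) := by
    rw [mul_sub, mul_expQuot₂]; ring
  rw [e, norm_mul, pow_two] at h
  exact le_of_mul_le_mul_left h (norm_pos_iff.mpr hz0)

lemma exp_ne_one_of_pos_re {z : ℂ} (hz : 0 < z.re) : exp z ≠ 1 := by
  intro h
  have := congrArg norm h
  rw [norm_exp, norm_one, Real.exp_eq_one_iff] at this
  linarith

lemma expQuot_ne_zero {z : ℂ} (hz : |z.im| < 2 * Real.pi) : expQuot z ≠ 0 := by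
  rcases eq_or_ne z 0 with rfl | h0
  · simp
  intro h
  have he : exp z = 1 := by
    have := mul_expQuot z
    rw [h, mul_zero] at this
    linear_combination -this
  obtain ⟨n, hn⟩ := Complex.exp_eq_one_iff.mp he
  have him : z.im = n * (2 * Real.pi) := by rw [hn]; simp
  rw [him, abs_mul, abs_of_pos Real.two_pi_pos] at hz
  have hlt : |(n : ℝ)| < 1 := by
    by_contra hcon
    have := mul_le_mul_of_nonneg_right (not_lt.mp hcon) Real.two_pi_pos.le
    linarith
  have hn0 : n = 0 := Int.abs_lt_one_iff.mp (by exact_mod_cast hlt)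
  apply h0
  rw [hn, hn0]; simp

/-- The function `1 / (e^z - 1) - e^{-z} / z`, with the singularity at `0` removed.  Subtracting
`e^{-z} / z` rather than `1 / z` keeps the exponential decay, and `∑ e^{-nw} / (nw)` is still
elementary. -/
noncomputable def planck (z : ℂ) : ℂ := expQuot₂ (-z) / expQuot z

@[simp] lemma planck_zero : planck 0 = 1 / 2 := by simp [planck]

/-- Away from the removable singularity, `planck` is given by its defining formula. -/
lemma planck_eq {z : ℂ} (hz : exp z ≠ 1) : planck z = 1 / (exp z - 1) - exp (-z) / z := by
  have h0 : z ≠ 0 := by rintro rfl; simp at hz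
  have h1 : exp z - 1 ≠ 0 := sub_ne_zero.mpr hz
  have e1 := mul_expQuot z
  have e2 := mul_expQuot (-z)
  have e3 := mul_expQuot₂ (-z)
  have hE : expQuot z = (exp z - 1) / z := by rw [← e1]; field_simp
  have hE' : expQuot (-z) = (1 - exp (-z)) / z := by
    field_simp; linear_combination -e2
  have hE2 : expQuot₂ (-z) = (1 - (1 - exp (-z)) / z) / z := by
    rw [← hE']; field_simp; linear_combination -e3
  have e4 : exp (-z) * exp z = 1 := by rw [← Complex.exp_add]; simp
  rw [planck, hE, hE2]
  field_simp
  linear_combination e4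

lemma differentiableAt_planck {z : ℂ} (hz : expQuot z ≠ 0) : DifferentiableAt ℂ planck z :=
  ((differentiable_expQuot₂ (-z)).comp z (by fun_prop)).div (differentiable_expQuot z) hz

lemma expQuot_ne_zero_of_pos_re {z : ℂ} (hz : 0 < z.re) : expQuot z ≠ 0 := by
  intro h
  have := mul_expQuot z
  rw [h, mul_zero] at this
  exact exp_ne_one_of_pos_re hz (by linear_combination -this)

lemma expQuot_ne_zero_of_near_sector {z : ℂ} (h : |z.im| ≤ z.re + 2) : expQuot z ≠ 0 := by
  rcases lt_or_ge 0 z.re with h0 | h0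
  · exact expQuot_ne_zero_of_pos_re h0
  · exact expQuot_ne_zero (by linarith [Real.pi_gt_three])

/-- Exponential decay of `planck` in a neighbourhood of the sector `|Im z| ≤ Re z`. -/
lemma exists_norm_planck_le : ∃ C : ℝ, 0 < C ∧ ∀ z : ℂ, |z.im| ≤ z.re + 2 → -1 ≤ z.re →
    ‖planck z‖ ≤ C * Real.exp (-z.re) := by
  have hK : IsCompact (Icc (-1 : ℝ) 2 ×ℂ Icc (-4 : ℝ) 4) := isCompact_Icc.reProdIm isCompact_Icc
  have hc : ContinuousOn planck (Icc (-1 : ℝ) 2 ×ℂ Icc (-4 : ℝ) 4) := by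
    intro z hz
    rw [mem_reProdIm] at hz
    refine (differentiableAt_planck (expQuot_ne_zero ?_)).continuousAt.continuousWithinAt
    have : |z.im| ≤ 4 := abs_le.mpr ⟨by linarith [hz.2.1], hz.2.2⟩
    linarith [Real.pi_gt_three]
  obtain ⟨B, hB⟩ := hK.exists_bound_of_continuousOn hc
  refine ⟨max (|B| * Real.exp 2) 3, lt_max_of_lt_right (by norm_num), fun z hz1 hz2 => ?_⟩
  -- a compact rectangle avoiding the poles `2πi n`, `n ≠ 0`, and the explicit formula beyond it
  rcases le_or_gt z.re 2 with h2 | h2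
  · have him : |z.im| ≤ 4 := by linarith
    have h := hB z (by
      rw [mem_reProdIm]; exact ⟨⟨hz2, h2⟩, abs_le.mp him⟩)
    calc ‖planck z‖ ≤ |B| := h.trans (le_abs_self B)
      _ = |B| * Real.exp 2 * Real.exp (-2) := by rw [mul_assoc, ← Real.exp_add]; simp
      _ ≤ max (|B| * Real.exp 2) 3 * Real.exp (-z.re) := by
        gcongr
        · exact le_max_left _ _
  · have hre : 0 < z.re := by linarith
    rw [planck_eq (exp_ne_one_of_pos_re hre)]
    have hexp : 2 ≤ Real.exp z.re := by
      have := Real.add_one_le_exp z.re; linarith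
    have h1 : ‖1 / (exp z - 1)‖ ≤ 2 * Real.exp (-z.re) := by
      have : Real.exp z.re - 1 ≤ ‖exp z - 1‖ := by
        have := norm_sub_norm_le (exp z) 1
        rwa [norm_exp, norm_one] at this
      rw [norm_div, norm_one, Real.exp_neg]
      calc 1 / ‖exp z - 1‖ ≤ 1 / (Real.exp z.re / 2) :=
            one_div_le_one_div_of_le (by positivity) (by linarith)
        _ = 2 * (Real.exp z.re)⁻¹ := by field_simp
    have h3 : ‖exp (-z) / z‖ ≤ Real.exp (-z.re) := by
      rw [norm_div, norm_exp, neg_re]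
      have : 1 ≤ ‖z‖ := by linarith [Complex.re_le_norm z]
      exact div_le_self (Real.exp_pos _).le this
    calc ‖1 / (exp z - 1) - exp (-z) / z‖ ≤ 2 * Real.exp (-z.re) + Real.exp (-z.re) :=
          (norm_sub_le _ _).trans (add_le_add h1 h3)
      _ = 3 * Real.exp (-z.re) := by ring
      _ ≤ _ := by gcongr; exact le_max_right _ _

/-- Cauchy's estimates turn the decay of `planck` into decay of its derivatives. -/
lemma exists_norm_planck_derivs_le : ∃ C : ℝ, 0 < C ∧ ∀ z : ℂ, |z.im| ≤ z.re →
    ‖planck z‖ ≤ C * Real.exp (-z.re) ∧ ‖deriv planck z‖ ≤ C * Real.exp (-z.re) ∧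
    ‖deriv (deriv planck) z‖ ≤ C * Real.exp (-z.re) := by
  obtain ⟨C, hC, h⟩ := exists_norm_planck_le
  refine ⟨2 * C * Real.exp 1, by positivity, fun z hz => ?_⟩
  have hre : 0 ≤ z.re := (abs_nonneg _).trans hz
  have hnear : ∀ u ∈ Metric.closedBall z 1, |u.im| ≤ u.re + 2 ∧ -1 ≤ u.re ∧ z.re - 1 ≤ u.re := by
    intro u hu
    rw [mem_closedBall_iff_norm] at hu
    have h1 := (abs_le.mp ((Complex.abs_re_le_norm (u - z)).trans hu))
    have h2 := (abs_le.mp ((Complex.abs_im_le_norm (u - z)).trans hu))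
    simp only [sub_re, sub_im] at h1 h2
    have h3 := abs_le.mp hz
    refine ⟨abs_le.mpr ⟨?_, ?_⟩, ?_, ?_⟩ <;> linarith [h1.1, h2.1, h2.2, h3.1, h3.2]
  have hd : DiffContOnCl ℂ planck (Metric.ball z 1) := by
    refine DifferentiableOn.diffContOnCl fun u hu => ?_
    have hu' : u ∈ Metric.closedBall z 1 := Metric.closure_ball_subset_closedBall hu
    exact (differentiableAt_planck
      (expQuot_ne_zero_of_near_sector (hnear u hu').1)).differentiableWithinAt
  have hb : ∀ u ∈ Metric.closedBall z 1, ‖planck u‖ ≤ C * Real.exp 1 * Real.exp (-z.re) := by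
    intro u hu
    obtain ⟨a, b, c⟩ := hnear u hu
    refine (h u a b).trans ?_
    rw [mul_assoc, ← Real.exp_add]
    gcongr
    linarith
  have hs : ∀ u ∈ Metric.sphere z 1, ‖planck u‖ ≤ C * Real.exp 1 * Real.exp (-z.re) :=
    fun u hu => hb u (Metric.sphere_subset_closedBall hu)
  have hpos : 0 ≤ C * Real.exp 1 * Real.exp (-z.re) := by positivity
  have i1 := Complex.norm_iteratedDeriv_le_of_forall_mem_sphere_norm_le 1 one_pos hd hs
  have i2 := Complex.norm_iteratedDeriv_le_of_forall_mem_sphere_norm_le 2 one_pos hd hs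
  simp only [iteratedDeriv_succ, iteratedDeriv_zero, Nat.factorial] at i1 i2
  norm_num at i1 i2
  refine ⟨?_, ?_, ?_⟩
  · linarith [hb z (Metric.mem_closedBall_self zero_le_one)]
  · linarith
  · linarith

lemma hasDerivAt_planck {z : ℂ} (hz : |z.im| ≤ z.re) :
    HasDerivAt planck (deriv planck z) z :=
  (differentiableAt_planck (expQuot_ne_zero_of_near_sector (by linarith))).hasDerivAt

lemma hasDerivAt_deriv_planck {z : ℂ} (hz : |z.im| ≤ z.re) :
    HasDerivAt (deriv planck) (deriv (deriv planck) z) z := by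
  have hU : IsOpen {u : ℂ | |u.im| < u.re + 2} :=
    isOpen_lt (continuous_abs.comp continuous_im) (continuous_re.add continuous_const)
  have hd : DifferentiableOn ℂ planck {u : ℂ | |u.im| < u.re + 2} := fun u hu =>
    (differentiableAt_planck (expQuot_ne_zero_of_near_sector
      (le_of_lt hu))).differentiableWithinAt
  have hz' : z ∈ {u : ℂ | |u.im| < u.re + 2} := by show |z.im| < z.re + 2; linarith
  exact ((hd.deriv hU).differentiableAt (hU.mem_nhds hz')).hasDerivAt

/-! ### The trapezoidal rule on a half-line -/

/-- The trapezoidal rule on a unit interval: the error is the integral of `f'` against the centred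
linear function, whose mean vanishes, so that `f'` may be replaced by `f' - f'(a)`. -/
lemma norm_trapezoid_sub_integral_le {f f' f'' : ℝ → ℂ} {a M : ℝ}
    (hf : ∀ u ∈ Icc a (a + 1), HasDerivAt f (f' u) u)
    (hf' : ∀ u ∈ Icc a (a + 1), HasDerivAt f' (f'' u) u)
    (hM : ∀ u ∈ Icc a (a + 1), ‖f'' u‖ ≤ M) :
    ‖(f a + f (a + 1)) / 2 - ∫ u in a..(a + 1), f u‖ ≤ M / 2 := by
  have hab : a ≤ a + 1 := by linarith
  have hc' : ContinuousOn f' (uIcc a (a + 1)) := by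
    rw [uIcc_of_le hab]; exact fun u hu => (hf' u hu).continuousAt.continuousWithinAt
  have hi' : IntervalIntegrable f' volume a (a + 1) := hc'.intervalIntegrable
  have hv : ∀ u ∈ uIcc a (a + 1),
      HasDerivAt (fun u : ℝ => (u : ℂ) - a - 1 / 2) 1 u := fun u _ =>
    ((HasDerivAt.ofReal_comp (hasDerivAt_id u)).sub_const (a : ℂ)).sub_const (1 / 2)
  have hparts := intervalIntegral.integral_mul_deriv_eq_deriv_mul (a := a) (b := a + 1)
    (u := fun u : ℝ => (u : ℂ) - a - 1 / 2) (u' := fun _ => 1) (v := f) (v' := f') hv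
    (by rw [uIcc_of_le hab]; exact hf) (by simp) hi'
  have hconst : ∫ u in a..(a + 1), ((u : ℂ) - a - 1 / 2) * f' a = 0 := by
    rw [intervalIntegral.integral_mul_const]
    have : ∫ u in a..(a + 1), ((u : ℂ) - a - 1 / 2) = 0 := by
      have hd : ∀ u ∈ uIcc a (a + 1),
          HasDerivAt (fun u : ℝ => ((u : ℂ) - a - 1 / 2) ^ 2 / 2) ((u : ℂ) - a - 1 / 2) u := by
        intro u hu
        have := ((hv u hu).pow 2).div_const 2
        refine this.congr_deriv ?_
        push_cast; ring
      rw [intervalIntegral.integral_eq_sub_of_hasDerivAt hd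
        (Continuous.intervalIntegrable (by fun_prop) _ _)]
      push_cast; ring
    rw [this, zero_mul]
  have heq : (f a + f (a + 1)) / 2 - ∫ u in a..(a + 1), f u
      = ∫ u in a..(a + 1), ((u : ℂ) - a - 1 / 2) * (f' u - f' a) := by
    have hs : (fun u : ℝ => ((u : ℂ) - a - 1 / 2) * (f' u - f' a))
        = fun u : ℝ => ((u : ℂ) - a - 1 / 2) * f' u - ((u : ℂ) - a - 1 / 2) * f' a := by
      ext u; ring
    rw [hs, intervalIntegral.integral_sub _ _, hconst, hparts]
    · push_cast; simp only [one_mul]; ring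
    · exact hi'.continuousOn_mul (by fun_prop)
    · exact Continuous.intervalIntegrable (by fun_prop) _ _
  rw [heq]
  have hb : ∀ u ∈ uIoc a (a + 1), ‖((u : ℂ) - a - 1 / 2) * (f' u - f' a)‖ ≤ M / 2 := by
    intro u hu
    rw [uIoc_of_le hab] at hu
    have hu' : u ∈ Icc a (a + 1) := ⟨hu.1.le, hu.2⟩
    have h1 : ‖f' u - f' a‖ ≤ M * ‖u - a‖ :=
      (convex_Icc a (a + 1)).norm_image_sub_le_of_norm_hasDerivWithin_le
        (fun x hx => (hf' x hx).hasDerivWithinAt) hM (left_mem_Icc.mpr hab) hu'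
    have hM0 : 0 ≤ M := (norm_nonneg _).trans (hM a (left_mem_Icc.mpr hab))
    have h2 : ‖u - a‖ ≤ 1 := by
      rw [Real.norm_eq_abs, abs_of_nonneg] <;> linarith [hu.1, hu.2]
    have h3 : ‖(u : ℂ) - a - 1 / 2‖ ≤ 1 / 2 := by
      have : (u : ℂ) - a - 1 / 2 = ((u - a - 1 / 2 : ℝ) : ℂ) := by push_cast; ring
      rw [this, norm_real, Real.norm_eq_abs, abs_le]
      constructor <;> linarith [hu.1, hu.2]
    rw [norm_mul]
    calc ‖(u : ℂ) - a - 1 / 2‖ * ‖f' u - f' a‖ ≤ 1 / 2 * (M * 1) := by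
          gcongr; exact h1.trans (by gcongr)
      _ = M / 2 := by ring
  have := intervalIntegral.norm_integral_le_of_norm_le_const hb
  simpa using this

/-- Euler–Maclaurin summation of order one on `[0, ∞)` for a function whose second derivative decays
exponentially. -/
lemma norm_tsum_sub_integral_le {f f' f'' : ℝ → ℂ} {c M M' : ℝ} (hc : 0 < c)
    (hf : ∀ u, 0 ≤ u → HasDerivAt f (f' u) u) (hf' : ∀ u, 0 ≤ u → HasDerivAt f' (f'' u) u)
    (hM : ∀ u, 0 ≤ u → ‖f'' u‖ ≤ M * Real.exp (-(c * u)))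
    (hM' : ∀ u, 0 ≤ u → ‖f u‖ ≤ M' * Real.exp (-(c * u))) :
    Summable (fun n : ℕ => f (n + 1)) ∧
    ‖∑' n : ℕ, f (n + 1) - (∫ u in Ioi (0 : ℝ), f u) + f 0 / 2‖
      ≤ M / 2 * (1 - Real.exp (-c))⁻¹ := by
  have hM0 : 0 ≤ M := by
    have := (norm_nonneg _).trans (hM 0 le_rfl); simpa using this
  have hgeo : HasSum (fun n : ℕ => Real.exp (-c) ^ n) (1 - Real.exp (-c))⁻¹ :=
    hasSum_geometric_of_lt_one (Real.exp_pos _).le (by rw [Real.exp_lt_one_iff]; linarith)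
  have hpow : ∀ n : ℕ, Real.exp (-(c * n)) = Real.exp (-c) ^ n := fun n => by
    rw [← Real.exp_nat_mul]; congr 1; ring
  have hsum : Summable (fun n : ℕ => f (n + 1)) := by
    have h0 : Summable (fun n : ℕ => f n) := by
      refine Summable.of_norm_bounded (hgeo.summable.mul_left M') fun n => ?_
      rw [← hpow]; exact hM' n (Nat.cast_nonneg n)
    have := (summable_nat_add_iff 1).mpr h0
    simpa using this
  refine ⟨hsum, ?_⟩
  have hcont : ContinuousOn f (Ici 0) := fun u hu => (hf u hu).continuousAt.continuousWithinAt
  have hint : IntegrableOn f (Ioi 0) := by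
    have hg : IntegrableOn (fun u => M' * Real.exp (-c * u)) (Ioi 0) :=
      (exp_neg_integrableOn_Ioi 0 hc).const_mul M'
    refine Integrable.mono' hg ((hcont.mono Ioi_subset_Ici_self).aestronglyMeasurable
      measurableSet_Ioi) ?_
    refine (ae_restrict_iff' measurableSet_Ioi).mpr (Eventually.of_forall fun u hu => ?_)
    rw [neg_mul]; exact hM' u (le_of_lt hu)
  have hii : ∀ a b : ℝ, 0 ≤ a → 0 ≤ b → IntervalIntegrable f volume a b := fun a b ha hb =>
    (hcont.mono fun x hx => (le_inf ha hb).trans hx.1).intervalIntegrable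
  have hpart : ∀ N : ℕ, ∑ n ∈ Finset.range N, ((f n + f (n + 1)) / 2 - ∫ u in (n : ℝ)..(n + 1), f u)
      = ∑ n ∈ Finset.range N, f (n + 1) + f 0 / 2 - f N / 2 - ∫ u in (0 : ℝ)..N, f u := by
    intro N
    induction N with
    | zero => simp
    | succ N ih =>
      rw [Finset.sum_range_succ, ih, Finset.sum_range_succ,
        ← intervalIntegral.integral_add_adjacent_intervals (a := 0) (b := (N : ℝ))
          (c := ((N + 1 : ℕ) : ℝ))
          (hii _ _ le_rfl (Nat.cast_nonneg N)) (hii _ _ (Nat.cast_nonneg _) (Nat.cast_nonneg _))]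
      push_cast
      ring
  have hbound : ∀ N : ℕ, ‖∑ n ∈ Finset.range N, f (n + 1) + f 0 / 2 - f N / 2
      - ∫ u in (0 : ℝ)..N, f u‖ ≤ M / 2 * (1 - Real.exp (-c))⁻¹ := by
    intro N
    rw [← hpart]
    refine (norm_sum_le _ _).trans ?_
    have : ∀ n ∈ Finset.range N, ‖(f n + f (n + 1)) / 2 - ∫ u in (n : ℝ)..(n + 1), f u‖
        ≤ M / 2 * Real.exp (-c) ^ n := by
      intro n _
      have hn : (0 : ℝ) ≤ n := Nat.cast_nonneg n
      have := norm_trapezoid_sub_integral_le (a := n) (M := M * Real.exp (-c) ^ n)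
        (fun u hu => hf u (hn.trans hu.1)) (fun u hu => hf' u (hn.trans hu.1)) (fun u hu => by
          refine (hM u (hn.trans hu.1)).trans ?_
          rw [← hpow]
          have := hu.1
          gcongr)
      linarith
    refine (Finset.sum_le_sum this).trans ?_
    rw [← Finset.mul_sum]
    gcongr
    exact sum_le_hasSum _ (fun n _ => by positivity) hgeo
  have hfN : Tendsto (fun N : ℕ => f N) atTop (𝓝 0) := by
    rw [← tendsto_add_atTop_iff_nat (f := fun N : ℕ => f N) 1]
    simpa using hsum.tendsto_atTop_zero
  have hlim : Tendsto (fun N : ℕ => ∑ n ∈ Finset.range N, f (n + 1) + f 0 / 2 - f N / 2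
      - ∫ u in (0 : ℝ)..N, f u) atTop
      (𝓝 (∑' n : ℕ, f (n + 1) + f 0 / 2 - 0 / 2 - ∫ u in Ioi (0 : ℝ), f u)) :=
    ((hsum.hasSum.tendsto_sum_nat.add_const _).sub (hfN.div_const 2)).sub
      (intervalIntegral_tendsto_integral_Ioi 0 hint tendsto_natCast_atTop_atTop)
  have := le_of_tendsto hlim.norm (Eventually.of_forall hbound)
  refine le_of_eq_of_le ?_ this
  congr 1
  ring

/-! ### The integral of the Planck kernel along rays -/

/-- The open sector `|Im w| < Re w`. -/
def sector : Set ℂ := {w | |w.im| < w.re}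

lemma isOpen_sector : IsOpen sector :=
  isOpen_lt (continuous_abs.comp continuous_im) continuous_re

lemma convex_sector : Convex ℝ sector := by
  intro x hx y hy a b ha hb hab
  simp only [sector, mem_ofPred_eq] at hx hy ⊢
  have hx' := abs_lt.mp hx
  have hy' := abs_lt.mp hy
  simp only [add_im, add_re, real_smul, re_ofReal_mul, im_ofReal_mul]
  rw [abs_lt]
  rcases eq_or_lt_of_le ha with rfl | ha
  · have : b = 1 := by linarith
    subst this; constructor <;> linarith [hy'.1, hy'.2]
  · constructor <;> nlinarith [hx'.1, hx'.2, hy'.1, hy'.2]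

lemma re_pos_of_mem_sector {w : ℂ} (hw : w ∈ sector) : 0 < w.re :=
  lt_of_le_of_lt (abs_nonneg _) hw

lemma ray_mem {w : ℂ} (hw : w ∈ sector) {u : ℝ} (hu : 0 ≤ u) :
    |((u : ℂ) * w).im| ≤ ((u : ℂ) * w).re := by
  rw [re_ofReal_mul, im_ofReal_mul, abs_mul, abs_of_nonneg hu]
  exact mul_le_mul_of_nonneg_left (le_of_lt hw) hu

lemma hasDerivAt_planck_ray {w : ℂ} (hw : w ∈ sector) {u : ℝ} (hu : 0 ≤ u) :
    HasDerivAt (fun u : ℝ => planck (u * w)) (w * deriv planck (u * w)) u := by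
  have h1 : HasDerivAt (fun u : ℝ => (u : ℂ) * w) w u := by
    simpa using (HasDerivAt.ofReal_comp (hasDerivAt_id u)).mul_const w
  have := (hasDerivAt_planck (ray_mem hw hu)).scomp u h1
  simpa [Function.comp_def] using! this

lemma hasDerivAt_deriv_planck_ray {w : ℂ} (hw : w ∈ sector) {u : ℝ} (hu : 0 ≤ u) :
    HasDerivAt (fun u : ℝ => w * deriv planck (u * w))
      (w * (w * deriv (deriv planck) (u * w))) u := by
  have h1 : HasDerivAt (fun u : ℝ => (u : ℂ) * w) w u := by
    simpa using (HasDerivAt.ofReal_comp (hasDerivAt_id u)).mul_const w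
  have := ((hasDerivAt_deriv_planck (ray_mem hw hu)).scomp u h1).const_mul w
  simpa [Function.comp_def] using! this

lemma continuousOn_planck_ray {w : ℂ} (hw : w ∈ sector) :
    ContinuousOn (fun u : ℝ => planck (u * w)) (Ici 0) :=
  fun _ hu => (hasDerivAt_planck_ray hw hu).continuousAt.continuousWithinAt

lemma continuousOn_deriv_planck_ray {w : ℂ} (hw : w ∈ sector) :
    ContinuousOn (fun u : ℝ => deriv planck (u * w)) (Ici 0) := by
  intro u hu
  have h : ContinuousAt (fun u : ℝ => (u : ℂ) * w) u := by fun_prop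
  exact (ContinuousAt.comp (f := fun u : ℝ => (u : ℂ) * w)
    (hasDerivAt_deriv_planck (ray_mem hw hu)).continuousAt h).continuousWithinAt

lemma integrableOn_planck_ray {w : ℂ} (hw : w ∈ sector) :
    IntegrableOn (fun u : ℝ => planck (u * w)) (Ioi 0) := by
  obtain ⟨C, hC, h⟩ := exists_norm_planck_derivs_le
  refine Integrable.mono' ((exp_neg_integrableOn_Ioi 0 (re_pos_of_mem_sector hw)).const_mul C)
    (((continuousOn_planck_ray hw).mono Ioi_subset_Ici_self).aestronglyMeasurable
      measurableSet_Ioi) ?_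
  refine (ae_restrict_iff' measurableSet_Ioi).mpr (Eventually.of_forall fun u hu => ?_)
  refine (h _ (ray_mem hw (le_of_lt hu))).1.trans (le_of_eq ?_)
  rw [re_ofReal_mul]; ring_nf

lemma integrableOn_mul_exp_neg {c : ℝ} (hc : 0 < c) :
    IntegrableOn (fun u : ℝ => u * Real.exp (-c * u)) (Ioi 0) := by
  have := integrableOn_rpow_mul_exp_neg_mul_rpow (s := 1) (p := 1) (by norm_num) one_pos hc
  simpa using this

/-- Rotating the ray of integration does not change the integral of `planck`: the derivative
of the left-hand side with respect to `w` is the integral of a total derivative. -/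
lemma hasDerivAt_ray_integral {w₀ : ℂ} (hw₀ : w₀ ∈ sector) :
    HasDerivAt (fun w : ℂ => w * ∫ u in Ioi (0 : ℝ), planck (u * w)) 0 w₀ := by
  obtain ⟨C, hC, h⟩ := exists_norm_planck_derivs_le
  have hre := re_pos_of_mem_sector hw₀
  set c : ℝ := w₀.re / 2 with hc
  have hc0 : 0 < c := by positivity
  set s : Set ℂ := sector ∩ {w | c < w.re} with hs
  have hso : IsOpen s := isOpen_sector.inter (isOpen_lt continuous_const continuous_re)
  have hsm : s ∈ 𝓝 w₀ := hso.mem_nhds ⟨hw₀, by show c < w₀.re; linarith⟩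
  have hI := hasDerivAt_integral_of_dominated_loc_of_deriv_le (μ := volume.restrict (Ioi (0 : ℝ)))
    (F := fun (w : ℂ) (u : ℝ) => planck (u * w)) (F' := fun w u => u * deriv planck (u * w))
    (x₀ := w₀) (s := s) (bound := fun u => C * (u * Real.exp (-c * u))) hsm
    (by
      filter_upwards [hsm] with w hw
      exact (integrableOn_planck_ray hw.1).aestronglyMeasurable)
    (integrableOn_planck_ray hw₀)
    (by
      refine ContinuousOn.aestronglyMeasurable ?_ measurableSet_Ioi
      exact (Continuous.continuousOn (by fun_prop)).mul
        ((continuousOn_deriv_planck_ray hw₀).mono Ioi_subset_Ici_self))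
    (by
      refine (ae_restrict_iff' measurableSet_Ioi).mpr (Eventually.of_forall fun u hu w hw => ?_)
      have hu0 : (0 : ℝ) < u := hu
      have := (h _ (ray_mem hw.1 hu0.le)).2.1
      rw [norm_mul, norm_real, Real.norm_eq_abs, abs_of_pos hu0]
      calc u * ‖deriv planck (u * w)‖ ≤ u * (C * Real.exp (-((u : ℂ) * w).re)) := by gcongr
        _ ≤ u * (C * Real.exp (-c * u)) := by
          rw [re_ofReal_mul]
          have : c < w.re := hw.2
          gcongr
          nlinarith
        _ = C * (u * Real.exp (-c * u)) := by ring)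
    ((integrableOn_mul_exp_neg hc0).const_mul C)
    (by
      refine (ae_restrict_iff' measurableSet_Ioi).mpr (Eventually.of_forall fun u hu w hw => ?_)
      have h1 : HasDerivAt (fun w : ℂ => (u : ℂ) * w) u w := by
        simpa using (hasDerivAt_id w).const_mul (u : ℂ)
      have := (hasDerivAt_planck (ray_mem hw.1 (le_of_lt hu))).comp w h1
      simpa [Function.comp_def, mul_comm] using this)
  obtain ⟨hint, hder⟩ := hI
  have hprod := (hasDerivAt_id w₀).mul hder
  refine hprod.congr_deriv ?_
  have htot : ∫ u in Ioi (0 : ℝ), (planck (u * w₀) + u * (w₀ * deriv planck (u * w₀))) = 0 := by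
    have hd : ∀ u ∈ Ioi (0 : ℝ), HasDerivAt (fun u : ℝ => (u : ℂ) * planck (u * w₀))
        (planck (u * w₀) + u * (w₀ * deriv planck (u * w₀))) u := by
      intro u hu
      have := (HasDerivAt.ofReal_comp (hasDerivAt_id u)).fun_mul
        (hasDerivAt_planck_ray hw₀ (le_of_lt hu))
      simpa using! this
    have h0 : ContinuousWithinAt (fun u : ℝ => (u : ℂ) * planck (u * w₀)) (Ici 0) 0 :=
      (Continuous.continuousWithinAt (by fun_prop)).mul
        ((continuousOn_planck_ray hw₀) 0 (mem_Ici.mpr le_rfl))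
    have hlim : Tendsto (fun u : ℝ => (u : ℂ) * planck (u * w₀)) atTop (𝓝 0) := by
      have hz : Tendsto (fun u : ℝ => C * (u ^ (1 : ℝ) * Real.exp (-w₀.re * u))) atTop (𝓝 0) := by
        simpa using (tendsto_rpow_mul_exp_neg_mul_atTop_nhds_zero 1 w₀.re hre).const_mul C
      refine squeeze_zero_norm' ?_ hz
      filter_upwards [eventually_gt_atTop 0] with u hu
      have := (h _ (ray_mem hw₀ hu.le)).1
      rw [re_ofReal_mul] at this
      rw [norm_mul, norm_real, Real.norm_eq_abs, abs_of_pos hu, Real.rpow_one]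
      calc u * ‖planck (u * w₀)‖ ≤ u * (C * Real.exp (-(u * w₀.re))) := by gcongr
        _ = _ := by ring_nf
    have hi : IntegrableOn (fun u : ℝ => planck (u * w₀) + u * (w₀ * deriv planck (u * w₀)))
        (Ioi 0) := by
      refine (integrableOn_planck_ray hw₀).add ?_
      refine (hint.const_mul w₀).congr (Eventually.of_forall fun u => ?_)
      simp only; ring
    rw [integral_Ioi_of_hasDerivAt_of_tendsto h0 hd hi hlim]
    simp
  rw [integral_add (integrableOn_planck_ray hw₀) ((hint.const_mul w₀).congr
    (Eventually.of_forall fun u => by simp only; ring))] at htot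
  simp only [id, one_mul]
  rw [← htot, ← integral_const_mul]
  congr 2
  ext u; ring

lemma ray_integral_eq {w : ℂ} (hw : w ∈ sector) :
    w * ∫ u in Ioi (0 : ℝ), planck (u * w) = ∫ u in Ioi (0 : ℝ), planck u := by
  have h1 : (1 : ℂ) ∈ sector := by simp [sector]
  have := convex_sector.is_const_of_fderivWithin_eq_zero (𝕜 := ℂ)
    (f := fun w : ℂ => w * ∫ u in Ioi (0 : ℝ), planck (u * w))
    (fun w hw => (hasDerivAt_ray_integral hw).differentiableAt.differentiableWithinAt)
    (fun w hw => by
      rw [fderivWithin_of_isOpen isOpen_sector hw]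
      ext
      simpa using (hasDerivAt_ray_integral hw).deriv) hw h1
  simpa using this

/-! ### The Mellin transform of the Planck kernel -/

lemma one_mem_sector : (1 : ℂ) ∈ sector := by simp [sector]

lemma continuousOn_planck_real : ContinuousOn (fun u : ℝ => planck u) (Ici 0) := by
  simpa using continuousOn_planck_ray one_mem_sector

lemma planck_real_bounds :
    LocallyIntegrableOn (fun u : ℝ => planck u) (Ioi 0) ∧
    (fun u : ℝ => planck u) =O[atTop] (fun u : ℝ => Real.exp (-1 * u)) ∧
    (fun u : ℝ => planck u) =O[𝓝[>] 0] (fun u : ℝ => u ^ (-(0 : ℝ))) := by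
  obtain ⟨C, hC, h⟩ := exists_norm_planck_derivs_le
  have hb : ∀ u : ℝ, 0 ≤ u → ‖planck u‖ ≤ C * Real.exp (-u) := fun u hu => by
    simpa using (h u (by simpa using hu)).1
  refine ⟨(continuousOn_planck_real.mono Ioi_subset_Ici_self).locallyIntegrableOn
    measurableSet_Ioi, ?_, ?_⟩
  · refine Asymptotics.IsBigO.of_bound C ?_
    filter_upwards [eventually_ge_atTop 0] with u hu
    simpa using hb u hu
  · refine Asymptotics.IsBigO.of_bound C ?_
    filter_upwards [self_mem_nhdsWithin] with u hu
    have hu0 : (0 : ℝ) < u := hu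
    refine (hb u hu0.le).trans ?_
    have : Real.exp (-u) ≤ 1 := Real.exp_le_one_iff.mpr (by linarith)
    simpa using mul_le_of_le_one_right hC.le this

lemma mellinConvergent_planck {s : ℂ} (hs : 0 < s.re) :
    MellinConvergent (fun u : ℝ => planck u) s :=
  mellinConvergent_of_isBigO_rpow_exp one_pos planck_real_bounds.1 planck_real_bounds.2.1
    planck_real_bounds.2.2 hs

lemma differentiableAt_mellin_planck {s : ℂ} (hs : 0 < s.re) :
    DifferentiableAt ℂ (mellin (fun u : ℝ => planck u)) s :=
  mellin_differentiableAt_of_isBigO_rpow_exp one_pos planck_real_bounds.1 planck_real_bounds.2.1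
    planck_real_bounds.2.2 hs

lemma hasSum_exp_neg_nat_mul {w : ℂ} (hw : 0 < w.re) :
    HasSum (fun n : ℕ => exp (-((n : ℂ) + 1) * w)) (1 / (exp w - 1)) := by
  have hn : ‖exp (-w)‖ < 1 := by
    rw [norm_exp, Real.exp_lt_one_iff]; simpa using hw
  have h := (hasSum_geometric_of_norm_lt_one hn).mul_left (exp (-w))
  have h1 : exp w - 1 ≠ 0 := sub_ne_zero.mpr (exp_ne_one_of_pos_re hw)
  have e : exp (-w) * (1 - exp (-w))⁻¹ = 1 / (exp w - 1) := by
    rw [Complex.exp_neg]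
    have := Complex.exp_ne_zero w
    field_simp
  rw [e] at h
  refine h.congr_fun fun n => ?_
  rw [← Complex.exp_nat_mul, ← Complex.exp_add]
  congr 1; ring

/-- The Mellin transforms of `1 / (e^u - 1)` and `e^{-u} / u` are `Γ(s) ζ(s)` and `Γ(s - 1)`, and
`Γ(s - 1) = Γ(s) / (s - 1)`. -/
lemma mellin_planck {s : ℂ} (hs : 1 < s.re) :
    mellin (fun u : ℝ => planck u) s = Gamma s * riemannZeta₀ s := by
  have hs0 : 0 < s.re := by linarith
  have hs1 : s ≠ 1 := by rintro rfl; simp at hs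
  have hne : s ≠ 0 := by rintro rfl; simp at hs0
  -- the Bose integral
  have hF : HasSum (fun n : ℕ => Gamma s * 1 / (((n : ℝ) + 1 : ℝ) : ℂ) ^ s)
      (mellin (fun t : ℝ => 1 / (exp (t : ℂ) - 1)) s) := by
    refine hasSum_mellin (a := fun _ => 1) (fun n => Or.inr (by positivity)) hs0 (fun t ht => ?_) ?_
    · have := hasSum_exp_neg_nat_mul (w := (t : ℂ)) (by simpa using ht)
      convert this using 2 with n
      push_cast
      rw [one_mul]
    · have := (summable_nat_add_iff 1).mpr (Real.summable_one_div_nat_rpow.mpr hs)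
      simpa using this
  have hz : mellin (fun t : ℝ => 1 / (exp (t : ℂ) - 1)) s = Gamma s * riemannZeta s := by
    rw [zeta_eq_tsum_one_div_nat_add_one_cpow hs, ← tsum_mul_left, ← hF.tsum_eq]
    congr 1; ext n; push_cast; ring
  have hE : HasMellin (fun t : ℝ => exp (-(t : ℂ)) / t) s (Gamma (s - 1)) := by
    have hs' : 0 < (s - 1).re := by simpa using hs
    have hconv := Complex.GammaIntegral_convergent hs'
    have hcongr : EqOn (fun x : ℝ => ((-x).exp : ℂ) * (x : ℂ) ^ (s - 1 - 1))
        (fun t : ℝ => (t : ℂ) ^ (s - 1) • (exp (-(t : ℂ)) / t)) (Ioi 0) := by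
      intro t ht
      have htc : (t : ℂ) ≠ 0 := by exact_mod_cast (ne_of_gt ht)
      simp only [smul_eq_mul]
      rw [cpow_sub _ 1 htc, cpow_one]
      push_cast
      field_simp
    refine ⟨hconv.congr_fun hcongr measurableSet_Ioi, ?_⟩
    rw [mellin, Gamma_eq_integral hs', GammaIntegral, setIntegral_congr_fun measurableSet_Ioi hcongr]
  have hadd := hasMellin_add (mellinConvergent_planck hs0) hE.1
  have hsum : mellin (fun t : ℝ => 1 / (exp (t : ℂ) - 1)) s
      = mellin (fun t : ℝ => planck t + exp (-(t : ℂ)) / t) s := by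
    refine setIntegral_congr_fun measurableSet_Ioi fun t ht => ?_
    simp only
    rw [planck_eq (exp_ne_one_of_pos_re (by simpa using ht))]
    simp
  have hG : Gamma s = (s - 1) * Gamma (s - 1) := by
    have := Complex.Gamma_add_one (s - 1) (sub_ne_zero.mpr hs1)
    simpa using this
  have e : Gamma s * riemannZeta s = mellin (fun u : ℝ => planck u) s + Gamma (s - 1) := by
    rw [← hz, hsum, hadd.2, hE.2]
  rw [riemannZeta_eq_inv_sub_add hs1] at e
  have hs1' : s - 1 ≠ 0 := sub_ne_zero.mpr hs1
  have : Gamma s * (s - 1)⁻¹ = Gamma (s - 1) := by rw [hG]; field_simp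
  linear_combination -e + this

/-- The Planck kernel has integral `γ`, because its Mellin transform `Γ(s) (ζ(s) - 1/(s-1))`
takes the value `γ` at `s = 1`. -/
lemma integral_planck :
    ∫ u in Ioi (0 : ℝ), planck u = Real.eulerMascheroniConstant := by
  have h1 : mellin (fun u : ℝ => planck u) 1 = ∫ u in Ioi (0 : ℝ), planck u := by
    simp [mellin]
  have hlim : Tendsto (fun x : ℝ => (x : ℂ)) (𝓝[>] 1) (𝓝 1) := by
    have : Tendsto (fun x : ℝ => (x : ℂ)) (𝓝 1) (𝓝 ((1 : ℝ) : ℂ)) :=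
      Complex.continuous_ofReal.tendsto 1
    rw [ofReal_one] at this
    exact this.mono_left nhdsWithin_le_nhds
  have ha := (differentiableAt_mellin_planck (s := 1) (by simp)).continuousAt.tendsto.comp hlim
  have hb : Tendsto (fun x : ℝ => Gamma (x : ℂ) * riemannZeta₀ x) (𝓝[>] 1)
      (𝓝 (Gamma 1 * riemannZeta₀ 1)) := by
    refine Tendsto.mul ?_ ?_
    · refine (Complex.differentiableAt_Gamma 1 fun m h => ?_).continuousAt.tendsto.comp hlim
      have := congrArg Complex.re h
      simp at this
      linarith [Nat.cast_nonneg (α := ℝ) m]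
    · exact (differentiable_riemannZeta₀.continuous.tendsto 1).comp hlim
  rw [← h1]
  rw [Gamma_one, riemannZeta₀_one, one_mul] at hb
  refine tendsto_nhds_unique ha (hb.congr' ?_)
  filter_upwards [self_mem_nhdsWithin] with x hx
  exact (mellin_planck (by simpa using hx)).symm

/-! ### The Lambert series `∑ d(n) e^{-nw}` -/

/-- The Lambert series `∑ d(n) e^{-nw} = ∑_{m, n ≥ 1} e^{-mnw}`, both indices shifted by one. -/
noncomputable def lambert (w : ℂ) : ℂ :=
  ∑' p : ℕ × ℕ, exp (-(((p.1 : ℂ) + 1) * ((p.2 : ℂ) + 1)) * w)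

lemma lambert_term_norm (p : ℕ × ℕ) (w : ℂ) :
    ‖exp (-(((p.1 : ℂ) + 1) * ((p.2 : ℂ) + 1)) * w)‖
      = Real.exp (-(((p.1 : ℝ) + 1) * ((p.2 : ℝ) + 1)) * w.re) := by
  have : -(((p.1 : ℂ) + 1) * ((p.2 : ℂ) + 1)) * w
      = ((-(((p.1 : ℝ) + 1) * ((p.2 : ℝ) + 1)) : ℝ) : ℂ) * w := by push_cast; ring
  rw [norm_exp, this, re_ofReal_mul]

lemma lambert_term_le (p : ℕ × ℕ) {w : ℂ} {c : ℝ} (hc : 0 < c) (hw : c ≤ w.re) :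
    ‖exp (-(((p.1 : ℂ) + 1) * ((p.2 : ℂ) + 1)) * w)‖
      ≤ Real.exp (-w.re) * (Real.exp (-c) ^ p.1 * Real.exp (-c) ^ p.2) := by
  rw [lambert_term_norm, ← Real.exp_nat_mul, ← Real.exp_nat_mul, ← Real.exp_add, ← Real.exp_add]
  apply Real.exp_le_exp.mpr
  have h1 : (0 : ℝ) ≤ p.1 := Nat.cast_nonneg _
  have h2 : (0 : ℝ) ≤ p.2 := Nat.cast_nonneg _
  have h3 : 0 ≤ (p.1 : ℝ) * p.2 := by positivity
  nlinarith [mul_nonneg h1 (sub_nonneg.mpr hw), mul_nonneg h2 (sub_nonneg.mpr hw),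
    mul_nonneg h3 (hc.le.trans hw)]

lemma hasSum_lambert_bound {c : ℝ} (hc : 0 < c) :
    HasSum (fun p : ℕ × ℕ => Real.exp (-c) ^ p.1 * Real.exp (-c) ^ p.2)
      ((1 - Real.exp (-c))⁻¹ * (1 - Real.exp (-c))⁻¹) := by
  have h : HasSum (fun n : ℕ => Real.exp (-c) ^ n) (1 - Real.exp (-c))⁻¹ :=
    hasSum_geometric_of_lt_one (Real.exp_pos _).le (by rw [Real.exp_lt_one_iff]; linarith)
  exact h.mul h (h.summable.mul_of_nonneg h.summable (fun _ => by positivity)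
    (fun _ => by positivity))

lemma summable_lambert {w : ℂ} (hw : 0 < w.re) :
    Summable fun p : ℕ × ℕ => exp (-(((p.1 : ℂ) + 1) * ((p.2 : ℂ) + 1)) * w) :=
  Summable.of_norm_bounded ((hasSum_lambert_bound hw).summable.mul_left _)
    fun p => lambert_term_le p hw le_rfl

lemma differentiableAt_lambert {w : ℂ} (hw : 0 < w.re) : DifferentiableAt ℂ lambert w := by
  set c := w.re / 2 with hc
  have hc0 : 0 < c := by positivity
  have hU : IsOpen {z : ℂ | c < z.re} := isOpen_lt continuous_const continuous_re
  have : DifferentiableOn ℂ lambert {z : ℂ | c < z.re} := by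
    refine differentiableOn_tsum_of_summable_norm (hasSum_lambert_bound hc0).summable
      (fun p => Differentiable.differentiableOn (by fun_prop)) hU fun p z hz => ?_
    have hz' : c < z.re := hz
    refine (lambert_term_le p hc0 hz'.le).trans (mul_le_of_le_one_left (by positivity) ?_)
    exact Real.exp_le_one_iff.mpr (by linarith)
  exact this.differentiableAt (hU.mem_nhds (by show c < w.re; linarith))

lemma lambert_add_two_pi_I (w : ℂ) : lambert (w + 2 * Real.pi * I) = lambert w := by
  unfold lambert
  congr 1; ext p
  rw [mul_add, Complex.exp_add]
  have : exp (-(((p.1 : ℂ) + 1) * ((p.2 : ℂ) + 1)) * (2 * Real.pi * I)) = 1 := by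
    rw [Complex.exp_eq_one_iff]
    refine ⟨-((p.1 + 1) * (p.2 + 1)), ?_⟩
    push_cast; ring
  rw [this, mul_one]

lemma hasSum_lambert {w : ℂ} (hw : 0 < w.re) :
    HasSum (fun n : ℕ => 1 / (exp (((n : ℂ) + 1) * w) - 1)) (lambert w) := by
  refine (summable_lambert hw).hasSum.prod_fiberwise fun n => ?_
  have hre : 0 < (((n : ℂ) + 1) * w).re := by
    have : ((n : ℂ) + 1) * w = (((n : ℝ) + 1 : ℝ) : ℂ) * w := by push_cast; ring
    rw [this, re_ofReal_mul]; positivity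
  refine (hasSum_exp_neg_nat_mul hre).congr_fun fun m => ?_
  congr 1; ring

lemma norm_lambert_le {x : ℝ} (hx : 1 ≤ x) :
    ‖lambert x‖ ≤ ((1 - Real.exp (-1))⁻¹ * (1 - Real.exp (-1))⁻¹) * Real.exp (-1 * x) := by
  have h := (hasSum_lambert_bound one_pos).mul_left (Real.exp (-x))
  refine (tsum_of_norm_bounded h fun p => ?_).trans (le_of_eq ?_)
  · simpa using lambert_term_le p (w := (x : ℂ)) one_pos (by simpa using hx)
  · rw [mul_comm, neg_one_mul]

lemma continuousOn_lambert_real : ContinuousOn (fun x : ℝ => lambert x) (Ioi 0) := by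
  intro x hx
  have h : ContinuousAt (fun x : ℝ => (x : ℂ)) x := Complex.continuous_ofReal.continuousAt
  exact (ContinuousAt.comp (f := fun x : ℝ => (x : ℂ))
    (differentiableAt_lambert (by simpa using hx)).continuousAt h).continuousWithinAt

/-! ### Wigert's formula -/

/-- `log ((1 - e^{-w}) / w) = -w / 2 + O(w²)`; the bound on the imaginary part makes the logarithm
additive in the product `w · (1 - e^{-w}) / w`. -/
lemma norm_log_expQuot_neg_add_le {w : ℂ} (hw : ‖w‖ ≤ 1 / 2) :
    ‖log (expQuot (-w)) + w / 2‖ ≤ 2 * ‖w‖ ^ 2 ∧ |(log (expQuot (-w))).im| < Real.pi / 2 := by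
  have h1 := norm_expQuot_sub_le (z := -w) (by rw [norm_neg]; linarith)
  rw [norm_neg] at h1
  have hw0 := norm_nonneg w
  have h2 : ‖expQuot (-w) - 1‖ ≤ ‖w‖ := by
    have e : expQuot (-w) - 1 = (expQuot (-w) - 1 - -w / 2) + -w / 2 := by ring
    have e2 : ‖-w / 2‖ = ‖w‖ / 2 := by rw [norm_div, norm_neg]; norm_num
    rw [e]
    refine (norm_add_le _ _).trans ?_
    rw [e2]; nlinarith
  have h3 := Complex.norm_log_one_add_sub_self_le (z := expQuot (-w) - 1) (by linarith)
  rw [add_sub_cancel] at h3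
  have hinv : (1 - ‖expQuot (-w) - 1‖)⁻¹ ≤ 2 := by
    rw [show (2 : ℝ) = (1 / 2)⁻¹ by norm_num]
    exact inv_anti₀ (by norm_num) (by linarith)
  have h4 : ‖log (expQuot (-w)) - (expQuot (-w) - 1)‖ ≤ ‖w‖ ^ 2 := by
    refine h3.trans ?_
    have : ‖expQuot (-w) - 1‖ ^ 2 ≤ ‖w‖ ^ 2 := by gcongr
    have hp : 0 ≤ ‖expQuot (-w) - 1‖ ^ 2 := by positivity
    nlinarith
  constructor
  · have e : log (expQuot (-w)) + w / 2
        = (log (expQuot (-w)) - (expQuot (-w) - 1)) + (expQuot (-w) - 1 - -w / 2) := by ring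
    rw [e]
    refine (norm_add_le _ _).trans ?_
    linarith
  · have hre : 0 < (expQuot (-w)).re := by
      have := abs_le.mp ((Complex.abs_re_le_norm (expQuot (-w) - 1)).trans h2)
      simp only [sub_re, one_re] at this
      linarith [this.1]
    rw [log_im]
    exact (Complex.abs_arg_lt_pi_div_two_iff).mpr (Or.inl hre)

lemma hasSum_exp_neg_div {w : ℂ} (hw : 0 < w.re) :
    HasSum (fun n : ℕ => exp (-(((n : ℂ) + 1) * w)) / (((n : ℂ) + 1) * w))
      (-log (1 - exp (-w)) / w) := by
  have hn : ‖exp (-w)‖ < 1 := by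
    rw [norm_exp, Real.exp_lt_one_iff]; simpa using hw
  have h := Complex.hasSum_taylorSeries_neg_log hn
  have h1 := (hasSum_nat_add_iff (f := fun n : ℕ => exp (-w) ^ n / (n : ℂ)) 1).mpr
    (by simpa using h)
  refine (h1.div_const w).congr_fun fun n => ?_
  rw [← Complex.exp_nat_mul]
  have hw0 : w ≠ 0 := by rintro rfl; simp at hw
  have : (n : ℂ) + 1 ≠ 0 := by exact_mod_cast Nat.succ_ne_zero n
  push_cast
  rw [div_div]
  congr 2; ring

/-- **Wigert's formula**: `∑ d(n) e^{-nw} = (γ - log w) / w + 1/4 + O(|w|)` in the sector. -/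
lemma wigert : ∃ C r : ℝ, 0 < C ∧ 0 < r ∧ ∀ w ∈ sector, ‖w‖ ≤ r →
    ‖lambert w - (Real.eulerMascheroniConstant - log w) / w - 1 / 4‖ ≤ C * ‖w‖ := by
  obtain ⟨C, hC, h⟩ := exists_norm_planck_derivs_le
  refine ⟨2 * C + 2, 1 / 2, by positivity, by norm_num, fun w hw hwr => ?_⟩
  have hre := re_pos_of_mem_sector hw
  have hw0 : w ≠ 0 := by rintro rfl; simp at hre
  have hdecay : ∀ u : ℝ, 0 ≤ u → |((u : ℂ) * w).im| ≤ ((u : ℂ) * w).re := fun u hu =>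
    ray_mem hw hu
  have hexp : ∀ u : ℝ, Real.exp (-((u : ℂ) * w).re) = Real.exp (-(w.re * u)) := fun u => by
    rw [re_ofReal_mul, mul_comm]
  -- `∑ 1 / (e^{nw} - 1) = ∑ planck (nw) + ∑ e^{-nw} / (nw)`, the first sum by Euler–Maclaurin
  obtain ⟨hsum, hEM⟩ := norm_tsum_sub_integral_le (c := w.re) (M := ‖w‖ ^ 2 * C) (M' := C) hre
    (f := fun u : ℝ => planck (u * w))
    (fun u hu => hasDerivAt_planck_ray hw hu) (fun u hu => hasDerivAt_deriv_planck_ray hw hu)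
    (fun u hu => by
      have := (h _ (hdecay u hu)).2.2
      rw [hexp] at this
      rw [norm_mul, norm_mul, ← mul_assoc, ← pow_two, mul_assoc]
      gcongr)
    (fun u hu => by
      have := (h _ (hdecay u hu)).1
      rwa [hexp] at this)
  have hL := hasSum_exp_neg_div hre
  have hK : lambert w = ∑' n : ℕ, planck (((n + 1 : ℝ) : ℂ) * w) + -log (1 - exp (-w)) / w := by
    refine (hasSum_lambert hre).unique ?_
    refine (hsum.hasSum.add hL).congr_fun fun n => ?_
    have hre' : 0 < (((n + 1 : ℝ) : ℂ) * w).re := by rw [re_ofReal_mul]; positivity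
    rw [planck_eq (exp_ne_one_of_pos_re hre')]
    push_cast
    ring
  have hint : ∫ u in Ioi (0 : ℝ), planck (u * w) = Real.eulerMascheroniConstant / w := by
    rw [← integral_planck, ← ray_integral_eq hw, mul_div_cancel_left₀ _ hw0]
  -- the term `-w / 2` of the second logarithm contributes `1 / 2` to the constant
  -- `1 / 4`, the endpoint correction `-planck 0 / 2` the remaining `-1 / 4`
  have hlog : log (1 - exp (-w)) = log w + log (expQuot (-w)) := by
    have e : 1 - exp (-w) = w * expQuot (-w) := by
      linear_combination mul_expQuot (-w)
    have him := (norm_log_expQuot_neg_add_le hwr).2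
    rw [log_im] at him
    have hargw : |w.arg| < Real.pi / 2 := Complex.abs_arg_lt_pi_div_two_iff.mpr (Or.inl hre)
    rw [e, Complex.log_mul hw0]
    · exact expQuot_ne_zero (by
        have := Complex.abs_im_le_norm (-w)
        rw [norm_neg] at this
        linarith [Real.pi_gt_three])
    · have h1 := abs_lt.mp him
      have h2 := abs_lt.mp hargw
      constructor <;> linarith [h1.1, h1.2, h2.1, h2.2]
  have hlogb := (norm_log_expQuot_neg_add_le hwr).1
  have hnorm : ‖w‖ ≤ 2 * w.re := by
    have h1 : |w.im| < w.re := hw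
    have := Complex.norm_le_abs_re_add_abs_im w
    rw [abs_of_pos hre] at this
    linarith
  have hre1 : w.re ≤ 1 / 2 := (Complex.re_le_norm w).trans hwr
  have hc : (1 - Real.exp (-w.re))⁻¹ ≤ 4 / ‖w‖ := by
    have hnp : 0 < ‖w‖ := norm_pos_iff.mpr hw0
    rw [show 4 / ‖w‖ = (‖w‖ / 4)⁻¹ by rw [inv_div]]
    refine inv_anti₀ (by positivity) ?_
    have : Real.exp (-w.re) ≤ 1 - w.re / 2 := by
      rw [Real.exp_neg]
      have h2 := Real.add_one_le_exp w.re
      have h3 : (Real.exp w.re)⁻¹ ≤ (w.re + 1)⁻¹ := inv_anti₀ (by linarith) h2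
      refine h3.trans ?_
      rw [inv_le_iff_one_le_mul₀ (by linarith)]
      nlinarith
    linarith
  have hEM' : ‖∑' n : ℕ, planck (((n + 1 : ℝ) : ℂ) * w) - Real.eulerMascheroniConstant / w + 1 / 4‖
      ≤ 2 * C * ‖w‖ := by
    rw [← hint]
    have e0 : planck ((0 : ℝ) * w) / 2 = 1 / 4 := by
      rw [ofReal_zero, zero_mul, planck_zero]; norm_num
    rw [e0] at hEM
    refine hEM.trans ?_
    have hnp : 0 < ‖w‖ := norm_pos_iff.mpr hw0
    calc ‖w‖ ^ 2 * C / 2 * (1 - Real.exp (-w.re))⁻¹ ≤ ‖w‖ ^ 2 * C / 2 * (4 / ‖w‖) := by gcongr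
      _ = 2 * C * ‖w‖ := by field_simp; ring
  have hlog' : ‖(log (expQuot (-w)) + w / 2) / w‖ ≤ 2 * ‖w‖ := by
    rw [norm_div, div_le_iff₀ (norm_pos_iff.mpr hw0)]
    linarith
  have efin : lambert w - (Real.eulerMascheroniConstant - log w) / w - 1 / 4
      = (∑' n : ℕ, planck (((n + 1 : ℝ) : ℂ) * w) - Real.eulerMascheroniConstant / w + 1 / 4)
        - (log (expQuot (-w)) + w / 2) / w := by
    rw [hK, hlog]
    generalize ∑' n : ℕ, planck (((n + 1 : ℝ) : ℂ) * w) = S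
    field_simp
    ring
  rw [efin]
  refine (norm_sub_le _ _).trans ?_
  linarith

/-! ### The Mellin transform of the regularized Lambert series -/

lemma LocallyIntegrableOn.indicator_of_measurableSet {f : ℝ → ℂ} {s t : Set ℝ}
    (hf : LocallyIntegrableOn f t) (hs : MeasurableSet s) :
    LocallyIntegrableOn (s.indicator f) t := fun x hx => by
  obtain ⟨u, hu, hi⟩ := hf x hx
  exact ⟨u, hu, Integrable.indicator hi hs⟩

lemma hasMellin_congr {f g : ℝ → ℂ} {s m : ℂ} (hfg : EqOn f g (Ioi 0)) (h : HasMellin f s m) :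
    HasMellin g s m :=
  ⟨h.1.congr_fun (fun x hx => by simp only [hfg hx]) measurableSet_Ioi,
    (setIntegral_congr_fun measurableSet_Ioi fun x hx => by simp only [hfg hx]).symm.trans h.2⟩

/-- The singular part `(γ - log x) / x` of the Lambert series at `0`. -/
noncomputable def lambertPole (x : ℝ) : ℂ := (Real.eulerMascheroniConstant - Real.log x) / x

lemma locallyIntegrableOn_inv : LocallyIntegrableOn (fun x : ℝ => (x : ℂ) ^ (-1 : ℂ)) (Ioi 0) :=
  ContinuousOn.locallyIntegrableOn (fun x hx =>
    (continuousAt_ofReal_cpow_const x _ (Or.inr (ne_of_gt hx))).continuousWithinAt)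
    measurableSet_Ioi

/-- The Mellin transform of a piece of `lambertPole` follows from the one of the same piece of
`1 / x`, since the logarithm corresponds to differentiation in `s`. -/
lemma hasMellin_lambertPole_indicator {S : Set ℝ} (hS : MeasurableSet S) {a b ε : ℝ}
    (htop : S.indicator (fun x : ℝ => (x : ℂ) ^ (-1 : ℂ)) =O[atTop] (fun x : ℝ => x ^ (-a)))
    (hbot : S.indicator (fun x : ℝ => (x : ℂ) ^ (-1 : ℂ)) =O[𝓝[>] 0] (fun x : ℝ => x ^ (-b)))
    {U : Set ℂ} (hU : IsOpen U)
    (hmel : ∀ s ∈ U, mellin (S.indicator (fun x : ℝ => (x : ℂ) ^ (-1 : ℂ))) s = ε / (s - 1))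
    {s : ℂ} (hs : s ∈ U) (hs1 : s ≠ 1) (hsa : s.re < a) (hsb : b < s.re) :
    HasMellin (S.indicator lambertPole) s
      (ε * (Real.eulerMascheroniConstant / (s - 1) + 1 / (s - 1) ^ 2)) := by
  have hloc := LocallyIntegrableOn.indicator_of_measurableSet locallyIntegrableOn_inv hS
  have hconv := mellinConvergent_of_isBigO_rpow hloc htop hsa hbot hsb
  obtain ⟨hlogconv, hder⟩ := mellin_hasDerivAt_of_isBigO_rpow hloc htop hsa hbot hsb
  have hs1' : s - 1 ≠ 0 := sub_ne_zero.mpr hs1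
  have hlogval : mellin (fun t => Real.log t • S.indicator (fun x : ℝ => (x : ℂ) ^ (-1 : ℂ)) t) s
      = -ε / (s - 1) ^ 2 := by
    have h2 : HasDerivAt (fun s : ℂ => (ε : ℂ) / (s - 1)) (-ε / (s - 1) ^ 2) s := by
      have := (hasDerivAt_const s (ε : ℂ)).div ((hasDerivAt_id s).sub_const 1) hs1'
      simpa using! this
    refine hder.unique (h2.congr_of_eventuallyEq ?_)
    filter_upwards [hU.mem_nhds hs] with z hz using hmel z hz
  have hc := hasMellin_const_smul hconv (Real.eulerMascheroniConstant : ℂ)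
  have hfin := hasMellin_sub hc.1 hlogconv
  rw [hc.2, hlogval, hmel s hs] at hfin
  have hfun : ∀ x ∈ Ioi (0 : ℝ), (Real.eulerMascheroniConstant : ℂ) •
      S.indicator (fun x : ℝ => (x : ℂ) ^ (-1 : ℂ)) x -
      Real.log x • S.indicator (fun x : ℝ => (x : ℂ) ^ (-1 : ℂ)) x = S.indicator lambertPole x := by
    intro x _
    by_cases hx : x ∈ S
    · simp only [indicator_of_mem hx, smul_eq_mul, lambertPole, cpow_neg_one, real_smul]
      ring
    · simp [indicator_of_notMem hx]
  have hval := hasMellin_congr hfun hfin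
  refine ⟨hval.1, hval.2.trans ?_⟩
  simp only [smul_eq_mul]
  field_simp
  ring

lemma isBigO_inv_indicator (S : Set ℝ) (l : Filter ℝ) (hl : ∀ᶠ x in l, 0 < x) :
    S.indicator (fun x : ℝ => (x : ℂ) ^ (-1 : ℂ)) =O[l] (fun x : ℝ => x ^ (-(1 : ℝ))) := by
  refine Asymptotics.IsBigO.of_bound 1 ?_
  filter_upwards [hl] with x hx
  refine (norm_indicator_le_norm_self _ _).trans ?_
  rw [norm_cpow_eq_rpow_re_of_pos hx, one_mul, Real.norm_of_nonneg (Real.rpow_nonneg hx.le _)]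
  simp

lemma hasMellin_lambertPole_Ioc {s : ℂ} (hs : 1 < s.re) :
    HasMellin ((Ioc (0 : ℝ) 1).indicator lambertPole) s
      (Real.eulerMascheroniConstant / (s - 1) + 1 / (s - 1) ^ 2) := by
  have h := hasMellin_lambertPole_indicator (S := Ioc (0 : ℝ) 1) measurableSet_Ioc (ε := 1)
    (a := s.re + 1) (b := 1) (U := {s : ℂ | 1 < s.re}) (s := s) ?_
    (isBigO_inv_indicator _ _ self_mem_nhdsWithin)
    (isOpen_lt continuous_const continuous_re) (fun z hz => ?_) hs
    (by rintro rfl; simp at hs) (by linarith) hs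
  · simpa using h
  · refine Asymptotics.IsBigO.of_bound 1 ?_
    filter_upwards [eventually_gt_atTop 1] with x hx
    rw [indicator_of_notMem (by simp; intro; linarith)]
    simp
  · have hz' : 1 < z.re := hz
    have := (hasMellin_cpow_Ioc (-1) (s := z) (by simp; linarith)).2
    rw [this]; simp [sub_eq_add_neg]

lemma hasMellin_lambertPole_Ioi {s : ℂ} (hs : s.re < 1) :
    HasMellin ((Ioi (1 : ℝ)).indicator lambertPole) s
      (-(Real.eulerMascheroniConstant / (s - 1) + 1 / (s - 1) ^ 2)) := by
  have h := hasMellin_lambertPole_indicator (S := Ioi (1 : ℝ)) measurableSet_Ioi (ε := -1)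
    (a := 1) (b := s.re - 1) (U := {s : ℂ | s.re < 1}) (s := s)
    (isBigO_inv_indicator _ _ (eventually_gt_atTop 0)) ?_
    (isOpen_lt continuous_re continuous_const) (fun z hz => ?_) hs
    (by rintro rfl; simp at hs) hs (by linarith)
  · simpa using h
  · refine Asymptotics.IsBigO.of_bound 1 ?_
    filter_upwards [Ioo_mem_nhdsGT (zero_lt_one : (0 : ℝ) < 1)] with x hx
    rw [indicator_of_notMem (by simpa using hx.2.le)]
    simp
  · have hz' : z.re < 1 := hz
    have hfun : EqOn (fun t : ℝ => (t : ℂ) ^ (z - 1) •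
        (Ioi (1 : ℝ)).indicator (fun x : ℝ => (x : ℂ) ^ (-1 : ℂ)) t)
        ((Ioi (1 : ℝ)).indicator (fun t => (t : ℂ) ^ (z - 2))) (Ioi 0) := by
      intro t ht
      by_cases h1 : t ∈ Ioi (1 : ℝ)
      · have htc : (t : ℂ) ≠ 0 := by exact_mod_cast (ne_of_gt ht)
        simp only [indicator_of_mem h1, smul_eq_mul]
        rw [← cpow_add _ _ htc]; congr 1; ring
      · simp [indicator_of_notMem h1]
    rw [mellin, setIntegral_congr_fun measurableSet_Ioi hfun, setIntegral_indicator
      measurableSet_Ioi, inter_eq_self_of_subset_right (Ioi_subset_Ioi zero_le_one),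
      integral_Ioi_cpow_of_lt (by simp; linarith) one_pos]
    have e : z - 2 + 1 = z - 1 := by ring
    simp [e]

/-- The Lambert series with the part of its pole on `(0, 1]` removed. -/
noncomputable def lambertReg (x : ℝ) : ℂ := lambert x - (Ioc (0 : ℝ) 1).indicator lambertPole x

lemma continuousOn_lambertPole : ContinuousOn lambertPole (Ioi 0) := by
  intro x hx
  have hx0 : x ≠ 0 := ne_of_gt hx
  have h1 : ContinuousAt (fun x : ℝ => ((Real.log x : ℝ) : ℂ)) x :=
    Complex.continuous_ofReal.continuousAt.comp (Real.continuousAt_log hx0)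
  exact ((continuousAt_const.sub h1).div Complex.continuous_ofReal.continuousAt
    (by exact_mod_cast hx0)).continuousWithinAt

lemma locallyIntegrableOn_lambertReg : LocallyIntegrableOn lambertReg (Ioi 0) :=
  (continuousOn_lambert_real.locallyIntegrableOn measurableSet_Ioi).sub
    (LocallyIntegrableOn.indicator_of_measurableSet
      (continuousOn_lambertPole.locallyIntegrableOn measurableSet_Ioi) measurableSet_Ioc)

lemma lambertReg_isBigO_top : lambertReg =O[atTop] (fun x : ℝ => Real.exp (-1 * x)) := by
  refine Asymptotics.IsBigO.of_bound ((1 - Real.exp (-1))⁻¹ * (1 - Real.exp (-1))⁻¹) ?_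
  filter_upwards [eventually_gt_atTop 1] with x hx
  rw [lambertReg, indicator_of_notMem (by simp; intro; linarith), sub_zero,
    Real.norm_of_nonneg (Real.exp_pos _).le]
  exact norm_lambert_le hx.le

lemma lambertReg_isBigO_zero : lambertReg =O[𝓝[>] 0] (fun x : ℝ => x ^ (-(0 : ℝ))) := by
  obtain ⟨C, r, hC, hr, h⟩ := wigert
  refine Asymptotics.IsBigO.of_bound (C * r + 1 / 4) ?_
  filter_upwards [Ioo_mem_nhdsGT (lt_min hr one_pos)] with x hx
  have hx0 : 0 < x := hx.1
  have hxr : x < r := hx.2.trans_le (min_le_left _ _)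
  have hx1 : x < 1 := hx.2.trans_le (min_le_right _ _)
  have hn : ‖(x : ℂ)‖ = x := by rw [norm_real, Real.norm_of_nonneg hx0.le]
  have := h x (by simpa [sector] using hx0) (by rw [hn]; exact hxr.le)
  rw [hn, ← ofReal_log hx0.le] at this
  have e : lambertReg x = (lambert x - (Real.eulerMascheroniConstant - Real.log x) / x - 1 / 4)
      + 1 / 4 := by
    rw [lambertReg, indicator_of_mem (by exact ⟨hx0, hx1.le⟩), lambertPole]; ring
  rw [e]
  refine (norm_add_le _ _).trans ?_
  have h4 : ‖(1 / 4 : ℂ)‖ = 1 / 4 := by norm_num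
  rw [h4, neg_zero, Real.rpow_zero, norm_one, mul_one]
  have : C * x ≤ C * r := by gcongr
  linarith

lemma mellinConvergent_lambertReg {s : ℂ} (hs : 0 < s.re) : MellinConvergent lambertReg s :=
  mellinConvergent_of_isBigO_rpow_exp one_pos locallyIntegrableOn_lambertReg
    lambertReg_isBigO_top lambertReg_isBigO_zero hs

lemma differentiableAt_mellin_lambertReg {s : ℂ} (hs : 0 < s.re) :
    DifferentiableAt ℂ (mellin lambertReg) s :=
  mellin_differentiableAt_of_isBigO_rpow_exp one_pos locallyIntegrableOn_lambertReg
    lambertReg_isBigO_top lambertReg_isBigO_zero hs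

lemma hasSum_zeta {s : ℂ} (hs : 1 < s.re) :
    HasSum (fun n : ℕ => 1 / (((n : ℝ) + 1 : ℝ) : ℂ) ^ s) (riemannZeta s) ∧
      Summable fun n : ℕ => ‖1 / (((n : ℝ) + 1 : ℝ) : ℂ) ^ s‖ := by
  have hsr : Summable fun n : ℕ => 1 / ((n : ℝ) + 1) ^ s.re := by
    have := (summable_nat_add_iff 1).mpr (Real.summable_one_div_nat_rpow.mpr hs)
    simpa using this
  have hzn : Summable fun n : ℕ => ‖1 / (((n : ℝ) + 1 : ℝ) : ℂ) ^ s‖ := by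
    refine hsr.congr fun n => ?_
    rw [norm_div, norm_one, norm_cpow_eq_rpow_re_of_pos (by positivity)]
  refine ⟨?_, hzn⟩
  rw [zeta_eq_tsum_one_div_nat_add_one_cpow hs]
  have := hzn.of_norm.hasSum
  push_cast at this ⊢
  exact this

/-- Termwise integration: the double series becomes the square of `ζ`. -/
lemma mellin_lambert {s : ℂ} (hs : 1 < s.re) :
    mellin (fun x : ℝ => lambert x) s = Gamma s * riemannZeta s ^ 2 := by
  have hs0 : 0 < s.re := by linarith
  obtain ⟨hz, hzn⟩ := hasSum_zeta hs
  have hterm : ∀ p : ℕ × ℕ, 1 / ((((p.1 : ℝ) + 1) * ((p.2 : ℝ) + 1) : ℝ) : ℂ) ^ s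
      = 1 / (((p.1 : ℝ) + 1 : ℝ) : ℂ) ^ s * (1 / (((p.2 : ℝ) + 1 : ℝ) : ℂ) ^ s) := fun p => by
    rw [ofReal_mul, mul_cpow_ofReal_nonneg (by positivity) (by positivity), one_div_mul_one_div]
  have hpn := summable_mul_of_summable_norm hzn hzn
  have hsum : HasSum (fun p : ℕ × ℕ =>
      Gamma s * 1 / ((((p.1 : ℝ) + 1) * ((p.2 : ℝ) + 1) : ℝ) : ℂ) ^ s)
      (mellin (fun x : ℝ => lambert x) s) := by
    refine hasSum_mellin (a := fun _ => 1) (fun p => Or.inr (by positivity)) hs0 (fun t ht => ?_) ?_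
    · have h := (summable_lambert (w := (t : ℂ)) (by simpa using ht)).hasSum
      refine h.congr_fun fun p => ?_
      push_cast
      rw [one_mul]
    · refine hpn.norm.congr fun p => ?_
      rw [← hterm p, norm_div, norm_one, norm_cpow_eq_rpow_re_of_pos (by positivity)]
  have hz2 := (hz.mul hz hpn).mul_left (Gamma s)
  rw [pow_two]
  have hfun : (fun p : ℕ × ℕ => Gamma s * 1 / ((((p.1 : ℝ) + 1) * ((p.2 : ℝ) + 1) : ℝ) : ℂ) ^ s)
      = fun p : ℕ × ℕ => Gamma s * (1 / (((p.1 : ℝ) + 1 : ℝ) : ℂ) ^ s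
        * (1 / (((p.2 : ℝ) + 1 : ℝ) : ℂ) ^ s)) := by
    ext p; rw [mul_div_assoc, hterm p]
  rw [hfun] at hsum
  exact hsum.unique hz2

lemma differentiableAt_Gamma_of_pos_re {s : ℂ} (hs : 0 < s.re) : DifferentiableAt ℂ Gamma s := by
  refine Complex.differentiableAt_Gamma s fun m h => ?_
  have := congrArg Complex.re h
  simp at this
  linarith [Nat.cast_nonneg (α := ℝ) m]

/-- Continuation of `mellin_lambert` to `0 < Re s`, with the double pole at `1` cleared. -/
lemma mellin_lambertReg {s : ℂ} (hs : 0 < s.re) :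
    (s - 1) ^ 2 * mellin lambertReg s
      = Gamma s * riemannZeta₁ s ^ 2 - Real.eulerMascheroniConstant * (s - 1) - 1 := by
  have hU : IsOpen {s : ℂ | 0 < s.re} := isOpen_lt continuous_const continuous_re
  have hf : AnalyticOnNhd ℂ (fun s => (s - 1) ^ 2 * mellin lambertReg s) {s : ℂ | 0 < s.re} := by
    refine DifferentiableOn.analyticOnNhd (fun s hs => ?_) hU
    exact (DifferentiableAt.mul (by fun_prop)
      (differentiableAt_mellin_lambertReg hs)).differentiableWithinAt
  have hg : AnalyticOnNhd ℂ (fun s => Gamma s * riemannZeta₁ s ^ 2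
      - Real.eulerMascheroniConstant * (s - 1) - 1) {s : ℂ | 0 < s.re} := by
    refine DifferentiableOn.analyticOnNhd (fun s hs => ?_) hU
    have := differentiableAt_Gamma_of_pos_re hs
    exact DifferentiableAt.differentiableWithinAt (by fun_prop)
  refine hf.eqOn_of_preconnected_of_eventuallyEq hg
    (convex_halfSpace_re_gt 0).isPreconnected (z₀ := 2) (by simp) ?_ hs
  have : {s : ℂ | 1 < s.re} ∈ 𝓝 (2 : ℂ) :=
    (isOpen_lt continuous_const continuous_re).mem_nhds (by simp)
  filter_upwards [this] with z hz
  have hz' : 1 < z.re := hz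
  have hz1 : z ≠ 1 := by rintro rfl; simp at hz'
  have hz2 : z - 1 ≠ 0 := sub_ne_zero.mpr hz1
  have hpole := hasMellin_lambertPole_Ioc hz'
  have hadd := hasMellin_add (mellinConvergent_lambertReg (s := z) (by linarith)) hpole.1
  have hfun : (fun t : ℝ => lambertReg t + (Ioc (0 : ℝ) 1).indicator lambertPole t)
      = fun x : ℝ => lambert x := by
    ext t; rw [lambertReg]; ring
  have e := hadd.2
  rw [hfun, mellin_lambert hz', hpole.2, riemannZeta_eq_inv_sub_mul hz1] at e
  field_simp at e
  linear_combination -e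

/-- On the strip `0 < Re s < 1`, the Mellin transform of `∑ d(n) e^{-nx} - (γ - log x) / x`
is `Γ(s) ζ(s)²`: the Mellin transforms of the two pieces of the pole, on `(0, 1]` and on `(1, ∞)`,
are negatives of each other as rational functions. -/
lemma hasMellin_lambert_sub_pole {s : ℂ} (hs : 0 < s.re) (hs' : s.re < 1) :
    HasMellin (fun x : ℝ => lambert x - lambertPole x) s (Gamma s * riemannZeta s ^ 2) := by
  have hs1 : s ≠ 1 := by rintro rfl; simp at hs'
  have hs2 : s - 1 ≠ 0 := sub_ne_zero.mpr hs1
  have hpole := hasMellin_lambertPole_Ioi hs'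
  have hsub := hasMellin_sub (mellinConvergent_lambertReg hs) hpole.1
  have hfun : ∀ t ∈ Ioi (0 : ℝ), lambertReg t - (Ioi (1 : ℝ)).indicator lambertPole t
      = lambert t - lambertPole t := by
    intro t ht
    have ht0 : 0 < t := ht
    rcases le_or_gt t 1 with h | h
    · rw [lambertReg, indicator_of_mem (by exact ⟨ht, h⟩), indicator_of_notMem (by simpa using h),
        sub_zero]
    · rw [lambertReg, indicator_of_notMem (by simp [h]), indicator_of_mem (by exact h), sub_zero]
  have hval := hasMellin_congr hfun hsub
  refine ⟨hval.1, hval.2.trans ?_⟩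
  have e := mellin_lambertReg hs
  rw [hpole.2, riemannZeta_eq_inv_sub_mul hs1]
  field_simp
  linear_combination e

/-! ### The weighted mean square as a bilateral Laplace transform -/

lemma one_add_cube_le {c x : ℝ} (hc : 0 < c) (hx : 0 ≤ x) :
    (1 + x) ^ 3 ≤ 48 / c ^ 3 * Real.exp (c / 2) * Real.exp (c / 2 * x) := by
  have h := Real.pow_div_factorial_le_exp (c / 2 * (1 + x)) (by positivity) 3
  have e : Real.exp (c / 2 * (1 + x)) = Real.exp (c / 2) * Real.exp (c / 2 * x) := by
    rw [← Real.exp_add]; ring_nf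
  rw [e] at h
  rw [mul_assoc, div_mul_eq_mul_div, le_div_iff₀ (by positivity)]
  norm_num [Nat.factorial] at h
  rw [div_le_iff₀ (by norm_num)] at h
  nlinarith

lemma integrable_exp_neg_mul_abs {c : ℝ} (hc : 0 < c) :
    Integrable fun t : ℝ => Real.exp (-(c * |t|)) := by
  have h : IntegrableOn (fun t : ℝ => Real.exp (-c * t)) (Ioi 0) := exp_neg_integrableOn_Ioi 0 hc
  have h2 : IntegrableOn (fun t : ℝ => Real.exp (-(c * |t|))) (Ioi 0) :=
    h.congr_fun (fun t ht => by simp only [abs_of_pos (mem_Ioi.mp ht), neg_mul]) measurableSet_Ioi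
  have h3 : IntegrableOn (fun t : ℝ => Real.exp (-(c * |t|))) (Iic 0) :=
    (integrableOn_exp_mul_Iic hc 0).congr_fun
      (fun t ht => by simp only [abs_of_nonpos (mem_Iic.mp ht), mul_neg, neg_neg]) measurableSet_Iic
  rw [← integrableOn_univ, ← Iic_union_Ioi (a := (0 : ℝ))]
  exact h3.union h2

lemma integrable_zetaSq_mul_exp {c : ℝ} (hc : 0 < c) :
    Integrable fun t : ℝ => (1 + |t|) * zetaSq t * Real.exp (-(c * |t|)) := by
  have hg := (integrable_exp_neg_mul_abs (half_pos hc)).const_mul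
    (16 * (48 / c ^ 3 * Real.exp (c / 2)))
  have hcont : Continuous fun t : ℝ => (1 + |t|) * zetaSq t * Real.exp (-(c * |t|)) := by
    have := continuous_zetaSq
    fun_prop
  refine hg.mono' hcont.aestronglyMeasurable (Eventually.of_forall fun t => ?_)
  have h0 := abs_nonneg t
  have h1 := zetaSq_nonneg t
  have h2 := zetaSq_le t
  have h3 := one_add_cube_le hc h0
  rw [Real.norm_of_nonneg (by positivity)]
  calc (1 + |t|) * zetaSq t * Real.exp (-(c * |t|))
      ≤ (1 + |t|) * (16 * (1 + |t|) ^ 2) * Real.exp (-(c * |t|)) := by gcongr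
    _ = 16 * (1 + |t|) ^ 3 * Real.exp (-(c * |t|)) := by ring
    _ ≤ 16 * (48 / c ^ 3 * Real.exp (c / 2) * Real.exp (c / 2 * |t|)) * Real.exp (-(c * |t|)) := by
        gcongr
    _ = 16 * (48 / c ^ 3 * Real.exp (c / 2)) *
        (Real.exp (c / 2 * |t|) * Real.exp (-(c * |t|))) := by ring
    _ = _ := by rw [← Real.exp_add]; ring_nf

/-- The density `|ζ(1/2 + it)|² / (1 + i e^{-πt})`.  The denominator is `1 + e^{iπs}` at
`s = 1/2 + it`. -/
noncomputable def meanDensity (t : ℝ) : ℂ := zetaSq t / (1 + I * (Real.exp (-(Real.pi * t)) : ℝ))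

lemma meanDensity_denom_bounds (t : ℝ) :
    1 ≤ ‖1 + I * ((Real.exp (-(Real.pi * t)) : ℝ) : ℂ)‖ ∧
    Real.exp (-(Real.pi * t)) ≤ ‖1 + I * ((Real.exp (-(Real.pi * t)) : ℝ) : ℂ)‖ := by
  constructor
  · have := Complex.re_le_norm (1 + I * ((Real.exp (-(Real.pi * t)) : ℝ) : ℂ))
    simpa only [add_re, one_re, I_mul_re, ofReal_im, neg_zero, add_zero] using this
  · have := Complex.im_le_norm (1 + I * ((Real.exp (-(Real.pi * t)) : ℝ) : ℂ))
    simpa only [add_im, one_im, I_mul_im, ofReal_re, zero_add] using this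

lemma meanDensity_denom_ne_zero (t : ℝ) : 1 + I * ((Real.exp (-(Real.pi * t)) : ℝ) : ℂ) ≠ 0 :=
  norm_pos_iff.mp (one_pos.trans_le (meanDensity_denom_bounds t).1)

lemma continuous_meanDensity : Continuous meanDensity := by
  unfold meanDensity
  refine Continuous.div ?_ ?_ meanDensity_denom_ne_zero
  · exact Complex.continuous_ofReal.comp continuous_zetaSq
  · fun_prop

lemma norm_meanDensity_mul_exp_le {c : ℝ} {z : ℂ} (h1 : c ≤ z.re) (h2 : z.re ≤ Real.pi - c)
    (t : ℝ) : ‖meanDensity t * exp (-z * t)‖ ≤ zetaSq t * Real.exp (-(c * |t|)) := by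
  obtain ⟨hd1, hd2⟩ := meanDensity_denom_bounds t
  have hz := zetaSq_nonneg t
  have he : ‖exp (-z * t)‖ = Real.exp (-(z.re * t)) := by
    rw [norm_exp]; simp
  have hn : ‖(zetaSq t : ℂ)‖ = zetaSq t := by rw [norm_real, Real.norm_of_nonneg hz]
  rw [norm_mul, he, meanDensity, norm_div, hn, div_mul_eq_mul_div, div_le_iff₀ (by linarith)]
  rcases le_total 0 t with ht | ht
  · rw [abs_of_nonneg ht]
    have : Real.exp (-(z.re * t)) ≤ Real.exp (-(c * t)) := by
      apply Real.exp_le_exp.mpr; nlinarith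
    calc zetaSq t * Real.exp (-(z.re * t)) ≤ zetaSq t * Real.exp (-(c * t)) * 1 := by
          rw [mul_one]; gcongr
      _ ≤ _ := by gcongr
  · rw [abs_of_nonpos ht]
    have : Real.exp (-(z.re * t)) ≤ Real.exp (-(c * -t)) * Real.exp (-(Real.pi * t)) := by
      rw [← Real.exp_add]; apply Real.exp_le_exp.mpr; nlinarith
    calc zetaSq t * Real.exp (-(z.re * t))
        ≤ zetaSq t * (Real.exp (-(c * -t)) * Real.exp (-(Real.pi * t))) := by gcongr
      _ = zetaSq t * Real.exp (-(c * -t)) * Real.exp (-(Real.pi * t)) := by ring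
      _ ≤ _ := by gcongr

lemma integrable_zetaSq_exp_neg_abs {c : ℝ} (hc : 0 < c) :
    Integrable fun t : ℝ => zetaSq t * Real.exp (-(c * |t|)) := by
  have hcont : Continuous fun t : ℝ => zetaSq t * Real.exp (-(c * |t|)) := by
    have := continuous_zetaSq
    fun_prop
  refine (integrable_zetaSq_mul_exp hc).mono' hcont.aestronglyMeasurable
    (Eventually.of_forall fun t => ?_)
  have h1 := zetaSq_nonneg t
  rw [Real.norm_of_nonneg (by positivity)]
  have : 0 ≤ |t| * zetaSq t * Real.exp (-(c * |t|)) := by positivity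
  linarith

/-- The strip `0 < Re z < π`. -/
def meanStrip : Set ℂ := {z | 0 < z.re} ∩ {z | z.re < Real.pi}

lemma isOpen_meanStrip : IsOpen meanStrip :=
  (isOpen_lt continuous_const continuous_re).inter (isOpen_lt continuous_re continuous_const)

lemma convex_meanStrip : Convex ℝ meanStrip :=
  (convex_halfSpace_re_gt 0).inter (convex_halfSpace_re_lt _)

/-- The bilateral Laplace transform `∫ |ζ(1/2 + it)|² e^{-zt} / (1 + i e^{-πt}) dt`. -/
noncomputable def meanTransform (z : ℂ) : ℂ := ∫ t : ℝ, meanDensity t * exp (-z * t)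

lemma integrable_meanDensity_mul_exp {z : ℂ} (hz : z ∈ meanStrip) :
    Integrable fun t : ℝ => meanDensity t * exp (-z * t) := by
  have h1 : 0 < z.re := hz.1
  have h2 : z.re < Real.pi := hz.2
  have hcont : Continuous fun t : ℝ => meanDensity t * exp (-z * t) := by
    have := continuous_meanDensity
    fun_prop
  exact (integrable_zetaSq_exp_neg_abs (lt_min h1 (sub_pos.mpr h2))).mono'
    hcont.aestronglyMeasurable (Eventually.of_forall fun t =>
      norm_meanDensity_mul_exp_le (min_le_left _ _) (by linarith [min_le_right z.re (Real.pi - z.re)]) t)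

lemma differentiableAt_meanTransform {z₀ : ℂ} (hz₀ : z₀ ∈ meanStrip) :
    DifferentiableAt ℂ meanTransform z₀ := by
  have h1 : 0 < z₀.re := hz₀.1
  have h2 : z₀.re < Real.pi := hz₀.2
  set c : ℝ := min z₀.re (Real.pi - z₀.re) / 2 with hc
  have hm : 0 < min z₀.re (Real.pi - z₀.re) := lt_min h1 (sub_pos.mpr h2)
  have hc0 : 0 < c := by positivity
  have hc1 : c < z₀.re := by linarith [min_le_left z₀.re (Real.pi - z₀.re)]
  have hc2 : z₀.re < Real.pi - c := by linarith [min_le_right z₀.re (Real.pi - z₀.re)]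
  set s : Set ℂ := {z | c < z.re} ∩ {z | z.re < Real.pi - c} with hs
  have hso : IsOpen s :=
    (isOpen_lt continuous_const continuous_re).inter (isOpen_lt continuous_re continuous_const)
  have hcontF : ∀ z : ℂ, Continuous fun t : ℝ => meanDensity t * exp (-z * t) := fun z => by
    have := continuous_meanDensity
    fun_prop
  have := hasDerivAt_integral_of_dominated_loc_of_deriv_le (μ := (volume : Measure ℝ))
    (F := fun (z : ℂ) (t : ℝ) => meanDensity t * exp (-z * t))
    (F' := fun z t => meanDensity t * exp (-z * t) * (-t))
    (x₀ := z₀) (s := s) (bound := fun t => (1 + |t|) * zetaSq t * Real.exp (-(c * |t|)))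
    (hso.mem_nhds ⟨hc1, hc2⟩)
    (Eventually.of_forall fun z => (hcontF z).aestronglyMeasurable)
    (integrable_meanDensity_mul_exp hz₀)
    (((hcontF z₀).mul (by fun_prop)).aestronglyMeasurable)
    (Eventually.of_forall fun t z hz => by
      have h := norm_meanDensity_mul_exp_le (le_of_lt hz.1) (le_of_lt hz.2) t
      rw [norm_mul, norm_neg, norm_real, Real.norm_eq_abs]
      have h0 := abs_nonneg t
      have hz := zetaSq_nonneg t
      calc ‖meanDensity t * exp (-z * t)‖ * |t|
          ≤ zetaSq t * Real.exp (-(c * |t|)) * (1 + |t|) := by gcongr; linarith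
        _ = _ := by ring)
    (integrable_zetaSq_mul_exp hc0)
    (Eventually.of_forall fun t z _ => by
      have h1 : HasDerivAt (fun z : ℂ => -z * (t : ℂ)) (-(t : ℂ)) z := by
        simpa using ((hasDerivAt_id z).neg).mul_const (t : ℂ)
      have := (h1.cexp).const_mul (meanDensity t)
      refine this.congr_deriv ?_
      ring)
  exact this.2.differentiableAt

/-- The functional equation in the form `Γ(s) ζ(s)² = (2π)^s e^{iπs/2} |ζ(s)|² / (1 + e^{iπs})`
on the critical line. -/
lemma Gamma_mul_zeta_sq (t : ℝ) :
    Gamma (critPt t) * riemannZeta (critPt t) ^ 2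
      = (2 * Real.pi : ℂ) ^ critPt t * exp (I * Real.pi * critPt t / 2) * meanDensity t := by
  have hs : ∀ n : ℕ, critPt t ≠ -n := fun n h => by
    have := congrArg Complex.re h
    simp at this
    linarith [Nat.cast_nonneg (α := ℝ) n]
  have hfe := riemannZeta_one_sub hs (critPt_ne_one t)
  have hconj : 1 - critPt t = (starRingEnd ℂ) (critPt t) := by
    apply Complex.ext <;> simp
    norm_num
  rw [hconj, riemannZeta_conj] at hfe
  have hsq : (zetaSq t : ℂ) = riemannZeta (critPt t) * (starRingEnd ℂ) (riemannZeta (critPt t)) := by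
    rw [Complex.mul_conj, zetaSq, normSq_eq_norm_sq]
  have hpi : (2 * Real.pi : ℂ) ≠ 0 := by exact_mod_cast Real.two_pi_pos.ne'
  have hpow : (2 * Real.pi : ℂ) ^ critPt t * (2 * Real.pi : ℂ) ^ (-critPt t) = 1 := by
    rw [← cpow_add _ _ hpi]; simp
  have hexp : ((Real.exp (-(Real.pi * t)) : ℝ) : ℂ) * I = exp (I * Real.pi * critPt t) := by
    have : I * Real.pi * critPt t = Real.pi / 2 * I + ((-(Real.pi * t) : ℝ) : ℂ) := by
      unfold critPt; push_cast; linear_combination Real.pi * t * I_sq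
    rw [this, Complex.exp_add, exp_pi_div_two_mul_I, ofReal_exp, mul_comm]
  have hcos : 2 * cos (Real.pi * critPt t / 2) * exp (I * Real.pi * critPt t / 2)
      = 1 + exp (I * Real.pi * critPt t) := by
    rw [Complex.two_cos, add_mul, ← Complex.exp_add, ← Complex.exp_add]
    rw [add_comm]
    congr 1
    · rw [show (-(Real.pi * critPt t / 2) * I + I * Real.pi * critPt t / 2 : ℂ) = 0 by ring,
        Complex.exp_zero]
    · congr 1; ring
  have hd := meanDensity_denom_ne_zero t
  rw [mul_comm I, hexp] at hd
  rw [meanDensity, mul_comm I ((Real.exp (-(Real.pi * t)) : ℝ) : ℂ), hexp, hsq, hfe]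
  rw [mul_div_assoc', eq_div_iff hd, ← hcos]
  linear_combination (-(2 * cos (Real.pi * critPt t / 2) * exp (I * Real.pi * critPt t / 2)
    * Gamma (critPt t) * riemannZeta (critPt t) ^ 2)) * hpow

lemma cpow_two_pi_mul_exp (t τ : ℝ) :
    ((2 * Real.pi * Real.exp τ : ℝ) : ℂ) ^ (-critPt t) *
      ((2 * Real.pi : ℂ) ^ critPt t * exp (I * Real.pi * critPt t / 2))
      = exp (I * (Real.pi / 2 + τ * I) / 2) * exp (-(Real.pi / 2 + τ * I) * t) := by
  have h2 : (2 * Real.pi : ℂ) = ((2 * Real.pi : ℝ) : ℂ) := by push_cast; ring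
  have hp : (0 : ℝ) < 2 * Real.pi * Real.exp τ := mul_pos Real.two_pi_pos (Real.exp_pos _)
  rw [h2, cpow_def_of_ne_zero (by exact_mod_cast hp.ne'),
    cpow_def_of_ne_zero (by exact_mod_cast Real.two_pi_pos.ne'), ← ofReal_log hp.le,
    ← ofReal_log Real.two_pi_pos.le, Real.log_mul Real.two_pi_pos.ne' (Real.exp_pos _).ne',
    Real.log_exp, ← Complex.exp_add, ← Complex.exp_add, ← Complex.exp_add]
  congr 1
  unfold critPt
  push_cast
  linear_combination (Real.pi * t / 2 - τ / 2) * I_sq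

/-- Mellin inversion on the critical line, for a positive argument `2π e^τ`. -/
lemma meanTransform_of_re_eq (τ : ℝ) :
    lambert ((2 * Real.pi * Real.exp τ : ℝ) : ℂ) - lambertPole (2 * Real.pi * Real.exp τ)
      = 1 / (2 * Real.pi) * (exp (I * (Real.pi / 2 + τ * I) / 2)
        * meanTransform (Real.pi / 2 + τ * I)) := by
  set x : ℝ := 2 * Real.pi * Real.exp τ with hx
  have hx0 : 0 < x := mul_pos Real.two_pi_pos (Real.exp_pos _)
  have hcrit : ∀ y : ℝ, (((1 / 2 : ℝ) : ℂ) + y * I) = critPt y := fun y => by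
    unfold critPt; push_cast; ring
  have hmel : ∀ y : ℝ, mellin (fun x : ℝ => lambert x - lambertPole x) (critPt y)
      = (2 * Real.pi : ℂ) ^ critPt y * exp (I * Real.pi * critPt y / 2) * meanDensity y := fun y => by
    rw [(hasMellin_lambert_sub_pole (s := critPt y) (by simp) (by simp; norm_num)).2,
      Gamma_mul_zeta_sq]
  have hker : ∀ τ y : ℝ, ((2 * Real.pi * Real.exp τ : ℝ) : ℂ) ^ (-critPt y) *
      mellin (fun x : ℝ => lambert x - lambertPole x) (critPt y)
      = exp (I * (Real.pi / 2 + τ * I) / 2)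
        * (meanDensity y * exp (-(Real.pi / 2 + τ * I) * y)) := fun τ y => by
    rw [hmel, ← mul_assoc, cpow_two_pi_mul_exp]; ring
  have hmem : ∀ τ : ℝ, (Real.pi / 2 + τ * I : ℂ) ∈ meanStrip := fun τ => by
    have : (Real.pi / 2 + τ * I : ℂ).re = Real.pi / 2 := by
      simp
    constructor
    · show 0 < (Real.pi / 2 + τ * I : ℂ).re
      rw [this]; exact Real.pi_div_two_pos
    · show (Real.pi / 2 + τ * I : ℂ).re < Real.pi
      rw [this]; linarith [Real.pi_pos]
  have hvert : VerticalIntegrable (mellin fun x : ℝ => lambert x - lambertPole x) (1 / 2) := by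
    unfold VerticalIntegrable
    simp only [hcrit]
    have hcont : Continuous fun y : ℝ =>
        mellin (fun x : ℝ => lambert x - lambertPole x) (critPt y) := by
      simp only [hmel]
      have := continuous_meanDensity
      have h2 : Continuous fun y : ℝ => (2 * Real.pi : ℂ) ^ critPt y :=
        continuous_critPt.const_cpow (Or.inl (by exact_mod_cast Real.two_pi_pos.ne'))
      have := continuous_critPt
      fun_prop
    have hi := ((integrable_meanDensity_mul_exp (hmem 0)).const_mul
      (exp (I * (Real.pi / 2 + (0 : ℝ) * I) / 2))).norm.const_mul (Real.sqrt (2 * Real.pi))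
    refine hi.mono' hcont.aestronglyMeasurable (Eventually.of_forall fun y => ?_)
    rw [← hker 0 y, norm_mul, norm_cpow_eq_rpow_re_of_pos (by
      exact mul_pos Real.two_pi_pos (Real.exp_pos _))]
    simp only [neg_re, critPt_re, Real.exp_zero, mul_one]
    rw [← mul_assoc, Real.sqrt_eq_rpow, ← Real.rpow_add Real.two_pi_pos]
    norm_num
  have hcontAt : ContinuousAt (fun x : ℝ => lambert x - lambertPole x) x :=
    (continuousOn_lambert_real.continuousAt (Ioi_mem_nhds hx0)).sub
      (continuousOn_lambertPole.continuousAt (Ioi_mem_nhds hx0))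
  have hinv := mellinInv_mellin_eq (1 / 2) _ hx0
    (hasMellin_lambert_sub_pole (s := ((1 / 2 : ℝ) : ℂ)) (by simp) (by simp; norm_num)).1
    hvert hcontAt
  rw [← hinv, mellinInv]
  simp only [hcrit, smul_eq_mul, hx, hker]
  rw [integral_const_mul, meanTransform, real_smul]
  push_cast
  ring

/-- The argument `2πi e^{-iz}` at which the Lambert series is evaluated. -/
noncomputable def lambertArg (z : ℂ) : ℂ := 2 * Real.pi * I * exp (-I * z)

lemma lambertArg_re (z : ℂ) : (lambertArg z).re = 2 * Real.pi * Real.exp z.im * Real.sin z.re := by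
  have : lambertArg z = ((2 * Real.pi : ℝ) : ℂ) * (I * exp (-I * z)) := by
    unfold lambertArg; push_cast; ring
  rw [this, re_ofReal_mul, I_mul_re, exp_im]
  simp
  ring

lemma lambertArg_re_pos {z : ℂ} (hz : z ∈ meanStrip) : 0 < (lambertArg z).re := by
  rw [lambertArg_re]
  have := Real.sin_pos_of_pos_of_lt_pi hz.1 hz.2
  have := Real.exp_pos z.im
  have := Real.pi_pos
  positivity

/-- Analytic continuation of Mellin inversion to complex arguments of the Lambert series.  Here
`log (2π) + i (π/2 - z)` is the principal logarithm of `lambertArg z`. -/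
lemma meanTransform_eq {z : ℂ} (hz : z ∈ meanStrip) :
    1 / (2 * Real.pi) * (exp (I * z / 2) * meanTransform z)
      = lambert (lambertArg z) - (Real.eulerMascheroniConstant
        - (Real.log (2 * Real.pi) + I * (Real.pi / 2 - z))) / lambertArg z := by
  have hf : AnalyticOnNhd ℂ (fun z => 1 / (2 * Real.pi) * (exp (I * z / 2) * meanTransform z))
      meanStrip := by
    refine DifferentiableOn.analyticOnNhd (fun z hz => ?_) isOpen_meanStrip
    have := differentiableAt_meanTransform hz
    exact DifferentiableAt.differentiableWithinAt (by fun_prop)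
  have hg : AnalyticOnNhd ℂ (fun z => lambert (lambertArg z) - (Real.eulerMascheroniConstant
        - (Real.log (2 * Real.pi) + I * (Real.pi / 2 - z))) / lambertArg z) meanStrip := by
    refine DifferentiableOn.analyticOnNhd (fun z hz => ?_) isOpen_meanStrip
    have hre := lambertArg_re_pos hz
    have hne : lambertArg z ≠ 0 := by intro h; rw [h] at hre; simp at hre
    have hda : DifferentiableAt ℂ lambertArg z := by unfold lambertArg; fun_prop
    have h1 : DifferentiableAt ℂ (fun z => lambert (lambertArg z)) z :=
      DifferentiableAt.comp z (differentiableAt_lambert hre) hda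
    exact (h1.sub (DifferentiableAt.div (by fun_prop) hda hne)).differentiableWithinAt
  have hline : ∀ τ : ℝ, (fun z => 1 / (2 * Real.pi) * (exp (I * z / 2) * meanTransform z))
      (Real.pi / 2 + τ * I) = (fun z => lambert (lambertArg z) - (Real.eulerMascheroniConstant
        - (Real.log (2 * Real.pi) + I * (Real.pi / 2 - z))) / lambertArg z)
      (Real.pi / 2 + τ * I) := fun τ => by
    have harg : lambertArg (Real.pi / 2 + τ * I) = ((2 * Real.pi * Real.exp τ : ℝ) : ℂ) := by
      unfold lambertArg
      have : -I * (Real.pi / 2 + τ * I) = -(Real.pi / 2 * I) + (τ : ℂ) := by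
        linear_combination (-τ : ℂ) * I_sq
      rw [this, Complex.exp_add, Complex.exp_neg, exp_pi_div_two_mul_I, inv_I]
      push_cast
      linear_combination (-2 * Real.pi * exp τ : ℂ) * I_sq
    simp only
    rw [← meanTransform_of_re_eq, harg, lambertPole,
      Real.log_mul Real.two_pi_pos.ne' (Real.exp_pos _).ne', Real.log_exp]
    push_cast
    congr 3
    linear_combination (τ : ℂ) * I_sq
  have hmem : (Real.pi / 2 + (0 : ℝ) * I : ℂ) ∈ meanStrip := by
    constructor
    · show 0 < (Real.pi / 2 + (0 : ℝ) * I : ℂ).re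
      simpa using Real.pi_pos
    · show (Real.pi / 2 + (0 : ℝ) * I : ℂ).re < Real.pi
      simpa using Real.pi_pos
  refine hf.eqOn_of_preconnected_of_frequently_eq hg convex_meanStrip.isPreconnected hmem ?_ hz
  have htend : Tendsto (fun τ : ℝ => (Real.pi / 2 + τ * I : ℂ)) (𝓝[≠] 0)
      (𝓝[≠] (Real.pi / 2 + (0 : ℝ) * I : ℂ)) := by
    refine tendsto_nhdsWithin_iff.mpr ⟨?_, ?_⟩
    · exact ((by fun_prop : Continuous fun τ : ℝ => (Real.pi / 2 + τ * I : ℂ)).tendsto 0).mono_left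
        nhdsWithin_le_nhds
    · filter_upwards [self_mem_nhdsWithin] with τ hτ h
      have := congrArg Complex.im h
      simp at this
      exact hτ this
  exact htend.frequently (Eventually.frequently (Eventually.of_forall hline))

/-! ### The Titchmarsh–Kober–Atkinson formula -/

/-- The Laplace transform `∫_0^∞ |ζ(1/2 + it)|² e^{-2δt} dt`. -/
noncomputable def laplaceZetaSq (δ : ℝ) : ℝ := ∫ t in Ioi (0 : ℝ), zetaSq t * Real.exp (-2 * δ * t)

lemma integrableOn_laplace {δ : ℝ} (hδ : 0 < δ) :
    IntegrableOn (fun t : ℝ => zetaSq t * Real.exp (-2 * δ * t)) (Ioi 0) := by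
  refine ((integrable_zetaSq_exp_neg_abs (c := 2 * δ) (by positivity)).integrableOn
    (s := Ioi 0)).congr_fun (fun t ht => ?_) measurableSet_Ioi
  simp only [abs_of_pos (mem_Ioi.mp ht)]
  ring_nf

/-- For real `z`, taking real parts turns the weight `1 / (1 + i e^{-πt})` into `1 / (1 + e^{-2πt})`. -/
lemma meanTransform_re {z : ℝ} (hz : (z : ℂ) ∈ meanStrip) :
    (meanTransform z).re
      = ∫ t : ℝ, zetaSq t * Real.exp (-z * t) / (1 + Real.exp (-(Real.pi * t)) ^ 2) := by
  have h := integral_re (integrable_meanDensity_mul_exp hz)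
  have e : (meanTransform z).re = ∫ t : ℝ, RCLike.re (meanDensity t * exp (-z * t)) := by
    rw [h]; rfl
  rw [e]
  congr 1; ext t
  show (meanDensity t * exp (-z * t)).re = _
  have hd := meanDensity_denom_ne_zero t
  have e2 : meanDensity t * exp (-z * t) = ((zetaSq t * Real.exp (-z * t)
      / (1 + Real.exp (-(Real.pi * t)) ^ 2) : ℝ) : ℂ)
      * (1 - I * ((Real.exp (-(Real.pi * t)) : ℝ) : ℂ)) := by
    have hp : (0 : ℝ) < 1 + Real.exp (-(Real.pi * t)) ^ 2 := by positivity
    have hpc : ((1 + Real.exp (-(Real.pi * t)) ^ 2 : ℝ) : ℂ) ≠ 0 := by exact_mod_cast hp.ne'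
    have he : exp (-z * t) = ((Real.exp (-z * t) : ℝ) : ℂ) := by push_cast; rfl
    rw [meanDensity, he, ofReal_div, ofReal_mul, div_mul_eq_mul_div, div_mul_eq_mul_div,
      div_eq_div_iff hd hpc]
    push_cast
    linear_combination ((zetaSq t : ℂ) * cexp (-z * t) * cexp (-(Real.pi * t)) ^ 2) * I_sq
  rw [e2, re_ofReal_mul]
  simp only [sub_re, one_re, I_mul_re, ofReal_im, neg_zero, sub_zero, mul_one]

/-- Replacing the weight `1 / (1 + e^{-2πt})` on `ℝ` by the indicator of `t > 0` costs `O(δ)`. -/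
lemma abs_meanTransform_sub_laplace_le : ∃ C : ℝ, 0 < C ∧ ∀ δ : ℝ, 0 < δ → δ ≤ 1 →
    |(meanTransform ((2 * δ : ℝ) : ℂ)).re - laplaceZetaSq δ| ≤ C * δ := by
  have hint := (integrable_zetaSq_mul_exp (c := 2) two_pos).integrableOn (s := Ioi (0 : ℝ))
  have hnn : 0 ≤ ∫ t in Ioi (0 : ℝ), (1 + |t|) * zetaSq t * Real.exp (-(2 * |t|)) :=
    setIntegral_nonneg measurableSet_Ioi fun t _ => by
      have := zetaSq_nonneg t; positivity
  refine ⟨4 * (∫ t in Ioi (0 : ℝ), (1 + |t|) * zetaSq t * Real.exp (-(2 * |t|))) + 1, by positivity,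
    fun δ hδ hδ1 => ?_⟩
  have hmem : ((2 * δ : ℝ) : ℂ) ∈ meanStrip := by
    constructor
    · show 0 < ((2 * δ : ℝ) : ℂ).re
      rw [ofReal_re]; positivity
    · show ((2 * δ : ℝ) : ℂ).re < Real.pi
      rw [ofReal_re]; linarith [Real.pi_gt_three]
  set h : ℝ → ℝ := fun t =>
    zetaSq t * Real.exp (-(2 * δ) * t) / (1 + Real.exp (-(Real.pi * t)) ^ 2) with hh
  have hcont : Continuous h := by
    have := continuous_zetaSq
    refine Continuous.div (by fun_prop) (by fun_prop) fun t => by positivity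
  have hi : Integrable h := by
    refine (integrable_meanDensity_mul_exp hmem).norm.mono' hcont.aestronglyMeasurable
      (Eventually.of_forall fun t => ?_)
    have hz := zetaSq_nonneg t
    have he : ‖exp (-((2 * δ : ℝ) : ℂ) * t)‖ = Real.exp (-(2 * δ) * t) := by
      rw [norm_exp]; simp
    have hn : ‖(zetaSq t : ℂ)‖ = zetaSq t := by rw [norm_real, Real.norm_of_nonneg hz]
    have hd : ‖1 + I * ((Real.exp (-(Real.pi * t)) : ℝ) : ℂ)‖
        ≤ 1 + Real.exp (-(Real.pi * t)) ^ 2 := by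
      have hsq : ‖1 + I * ((Real.exp (-(Real.pi * t)) : ℝ) : ℂ)‖ ^ 2
          = 1 + Real.exp (-(Real.pi * t)) ^ 2 := by
        rw [← normSq_eq_norm_sq, mul_comm, ← ofReal_one, normSq_add_mul_I]; ring
      have := (meanDensity_denom_bounds t).1
      nlinarith
    have hd1 := (meanDensity_denom_bounds t).1
    rw [Real.norm_of_nonneg (by positivity), norm_mul, he, meanDensity, norm_div, hn,
      div_mul_eq_mul_div]
    exact div_le_div_of_nonneg_left (by positivity) (by linarith) hd
  -- fold the integral over `ℝ` onto `t > 0`, using that `|ζ(1/2 + it)|²` is even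
  have hsplit : (meanTransform ((2 * δ : ℝ) : ℂ)).re
      = (∫ t in Ioi (0 : ℝ), h (-t)) + ∫ t in Ioi (0 : ℝ), h t := by
    rw [meanTransform_re hmem, integral_comp_neg_Ioi, neg_zero,
      ← setIntegral_union (Iic_disjoint_Ioi le_rfl) measurableSet_Ioi hi.integrableOn
        hi.integrableOn, Iic_union_Ioi, Measure.restrict_univ]
  have hineg : IntegrableOn (fun t => h (-t)) (Ioi 0) := hi.comp_neg.integrableOn
  have hisum : IntegrableOn (fun t => h (-t) + h t) (Ioi 0) := hineg.add hi.integrableOn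
  rw [hsplit, laplaceZetaSq, ← integral_add hineg hi.integrableOn,
    ← integral_sub hisum (integrableOn_laplace hδ), ← Real.norm_eq_abs]
  -- the integrand is `|ζ|² (e^{2δt} - e^{-2δt}) / (1 + e^{2πt})`
  have hbound : ∀ᵐ t ∂(volume.restrict (Ioi (0 : ℝ))),
      ‖h (-t) + h t - zetaSq t * Real.exp (-2 * δ * t)‖
        ≤ 4 * δ * ((1 + |t|) * zetaSq t * Real.exp (-(2 * |t|))) := by
    refine (ae_restrict_iff' measurableSet_Ioi).mpr (Eventually.of_forall fun t ht => ?_)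
    have ht0 : 0 < t := ht
    have hz := zetaSq_nonneg t
    set E := Real.exp (-(Real.pi * t)) with hE
    set D := Real.exp (2 * δ * t) with hD
    have hE0 : 0 < E := Real.exp_pos _
    have hD0 : 0 < D := Real.exp_pos _
    have e1 : Real.exp (-(2 * δ) * t) = D⁻¹ := by rw [hD, ← Real.exp_neg]; ring_nf
    have e1' : Real.exp (-2 * δ * t) = D⁻¹ := by rw [hD, ← Real.exp_neg]; ring_nf
    have e2 : Real.exp (-(2 * δ) * -t) = D := by rw [hD]; ring_nf
    have e3 : Real.exp (-(Real.pi * -t)) = E⁻¹ := by rw [hE, ← Real.exp_neg]; ring_nf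
    have eq : h (-t) + h t - zetaSq t * Real.exp (-2 * δ * t)
        = zetaSq t * ((D - D⁻¹) * (E ^ 2 / (1 + E ^ 2))) := by
      simp only [hh, zetaSq_neg, e1, e1', e2, e3, ← hE]
      field_simp
      ring
    have hx : 0 ≤ 2 * δ * t := by positivity
    have hD1 : D - D⁻¹ ≤ 4 * δ * t * D := by
      have h1 : 1 - 2 * (2 * δ * t) ≤ (D ^ 2)⁻¹ := by
        have := Real.add_one_le_exp (-(2 * (2 * δ * t)))
        have e : Real.exp (-(2 * (2 * δ * t))) = (D ^ 2)⁻¹ := by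
          rw [hD, ← Real.exp_nat_mul, ← Real.exp_neg]; norm_num
        rw [e] at this; linarith
      have h2 : D⁻¹ = D * (D ^ 2)⁻¹ := by field_simp
      rw [h2]
      nlinarith
    have hD2 : 0 ≤ D - D⁻¹ := by
      have : 1 ≤ D := Real.one_le_exp hx
      have : D⁻¹ ≤ 1 := inv_le_one_of_one_le₀ this
      linarith
    have hE2 : E ^ 2 / (1 + E ^ 2) ≤ E ^ 2 := div_le_self (by positivity) (by nlinarith)
    have hDE : D * E ^ 2 ≤ Real.exp (-(2 * |t|)) := by
      rw [hD, hE, ← Real.exp_nat_mul, ← Real.exp_add, abs_of_pos ht0]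
      apply Real.exp_le_exp.mpr
      push_cast
      nlinarith [Real.pi_gt_three, mul_le_mul_of_nonneg_right hδ1 ht0.le]
    rw [eq, Real.norm_of_nonneg (by positivity), abs_of_pos ht0]
    rw [abs_of_pos ht0] at hDE
    calc zetaSq t * ((D - D⁻¹) * (E ^ 2 / (1 + E ^ 2)))
        ≤ zetaSq t * ((4 * δ * t * D) * E ^ 2) := by gcongr
      _ = 4 * δ * (t * zetaSq t * (D * E ^ 2)) := by ring
      _ ≤ 4 * δ * ((1 + t) * zetaSq t * Real.exp (-(2 * t))) := by gcongr; linarith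
  refine (norm_integral_le_of_norm_le (hint.const_mul (4 * δ)) hbound).trans ?_
  rw [integral_const_mul]
  nlinarith

/-- `2πi e^{-2iδ}` differs by the period `2πi` of the Lambert series from `4π sin δ e^{-iδ}`, a point
close to `0` inside the sector. -/
lemma lambertArg_two_mul (δ : ℝ) :
    lambertArg ((2 * δ : ℝ) : ℂ)
      = ((4 * Real.pi * Real.sin δ : ℝ) : ℂ) * exp (-(δ * I)) + 2 * Real.pi * I := by
  have h1 : -I * ((2 * δ : ℝ) : ℂ) = 2 * -(δ * I) := by push_cast; ring
  unfold lambertArg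
  rw [h1, two_mul (-(δ * I) : ℂ), Complex.exp_add]
  have hc : exp (-(δ * I)) = cos δ - sin δ * I := by
    rw [← neg_mul, exp_mul_I, cos_neg, sin_neg]; ring
  have hsc := sin_sq_add_cos_sq (δ : ℂ)
  rw [hc]
  push_cast
  linear_combination (2 * Real.pi * I) * hsc + (-4 * Real.pi * cos δ * sin δ
    + 2 * Real.pi * I * sin δ ^ 2) * I_sq

lemma norm_exp_neg_mul_I (δ : ℝ) : ‖exp (-(δ * I))‖ = 1 := by
  rw [norm_exp]; simp

/-- The real part of the transform at `2δ`, with the Lambert series shifted to `4π sin δ e^{-iδ}` and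
its expansion there split off. -/
lemma meanTransform_re_expansion {δ : ℝ} (hδ : 0 < δ) (hδ1 : δ ≤ 1) :
    (meanTransform ((2 * δ : ℝ) : ℂ)).re
      = (Real.eulerMascheroniConstant - Real.log (4 * Real.pi * Real.sin δ)) / (2 * Real.sin δ)
        + Real.pi / 2 * Real.cos δ + Real.cos δ * (Real.pi / 2 - 2 * δ)
        - Real.sin δ * (Real.eulerMascheroniConstant - Real.log (2 * Real.pi))
        + (2 * Real.pi * exp (-(δ * I)) *
          (lambert (((4 * Real.pi * Real.sin δ : ℝ) : ℂ) * exp (-(δ * I)))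
            - (Real.eulerMascheroniConstant
              - log (((4 * Real.pi * Real.sin δ : ℝ) : ℂ) * exp (-(δ * I))))
              / (((4 * Real.pi * Real.sin δ : ℝ) : ℂ) * exp (-(δ * I))) - 1 / 4)).re := by
  have hmem : ((2 * δ : ℝ) : ℂ) ∈ meanStrip := by
    constructor
    · show 0 < ((2 * δ : ℝ) : ℂ).re
      rw [ofReal_re]; positivity
    · show ((2 * δ : ℝ) : ℂ).re < Real.pi
      rw [ofReal_re]; linarith [Real.pi_gt_three]
  have hsin : 0 < Real.sin δ := Real.sin_pos_of_pos_of_lt_pi hδ (by linarith [Real.pi_gt_three])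
  have hr : 0 < 4 * Real.pi * Real.sin δ := by have := Real.pi_pos; positivity
  have hlog : log (((4 * Real.pi * Real.sin δ : ℝ) : ℂ) * exp (-(δ * I)))
      = Real.log (4 * Real.pi * Real.sin δ) - δ * I := by
    rw [Complex.log_ofReal_mul hr (Complex.exp_ne_zero _), Complex.log_exp]
    · ring
    · simp; linarith [Real.pi_gt_three]
    · simp; linarith [Real.pi_gt_three]
  have hmain := meanTransform_eq hmem
  have hL := lambertArg_two_mul δ
  have hL2 : lambertArg ((2 * δ : ℝ) : ℂ) = 2 * Real.pi * I * exp (-(δ * I)) ^ 2 := by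
    unfold lambertArg
    rw [← Complex.exp_nat_mul]
    congr 2; push_cast; ring
  have hlam : lambert (lambertArg ((2 * δ : ℝ) : ℂ))
      = lambert (((4 * Real.pi * Real.sin δ : ℝ) : ℂ) * exp (-(δ * I))) := by
    rw [hL, lambert_add_two_pi_I]
  have hexp : exp (I * ((2 * δ : ℝ) : ℂ) / 2) = (exp (-(δ * I)))⁻¹ := by
    rw [← Complex.exp_neg]; congr 1; push_cast; ring
  rw [hlam, hL2, hexp] at hmain
  set e := exp (-(δ * I)) with he
  have he0 : e ≠ 0 := Complex.exp_ne_zero _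
  have hpi : (Real.pi : ℂ) ≠ 0 := by exact_mod_cast Real.pi_pos.ne'
  have hsc : (Real.sin δ : ℂ) ≠ 0 := by exact_mod_cast hsin.ne'
  rw [hlog]
  set Lw := lambert (((4 * Real.pi * Real.sin δ : ℝ) : ℂ) * e) with hLw
  set g : ℂ := (Real.eulerMascheroniConstant : ℂ)
  set l : ℂ := (Real.log (4 * Real.pi * Real.sin δ) : ℂ)
  set l2 : ℂ := (Real.log (2 * Real.pi) : ℂ)
  have hJ : meanTransform ((2 * δ : ℝ) : ℂ)
      = (g - l) / (2 * Real.sin δ) + δ * I / (2 * Real.sin δ) + Real.pi / 2 * e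
        + I * e⁻¹ * (g - l2) + e⁻¹ * (Real.pi / 2 - 2 * δ)
        + 2 * Real.pi * e * (Lw - (g - (l - δ * I)) / (((4 * Real.pi * Real.sin δ : ℝ) : ℂ) * e)
          - 1 / 4) := by
    have h2 : meanTransform ((2 * δ : ℝ) : ℂ)
        = 2 * Real.pi * e * (1 / (2 * Real.pi) * (e⁻¹ * meanTransform ((2 * δ : ℝ) : ℂ))) := by
      field_simp
    have hA : 2 * Real.pi * e * ((g - (l2 + I * (Real.pi / 2 - ((2 * δ : ℝ) : ℂ))))
        / (2 * Real.pi * I * e ^ 2))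
        = -(I * e⁻¹ * (g - (l2 + I * (Real.pi / 2 - 2 * δ)))) := by
      have hI : (I : ℂ) ≠ 0 := I_ne_zero
      have hI2 := I_sq
      push_cast
      field_simp
      linear_combination (2 * (g - (l2 + I * (Real.pi / 2 - 2 * δ)))) * hI2
    have hB : 2 * Real.pi * e * ((g - (l - δ * I)) / (((4 * Real.pi * Real.sin δ : ℝ) : ℂ) * e))
        = (g - (l - δ * I)) / (2 * Real.sin δ) := by
      rw [ofReal_mul, ofReal_mul]
      simp only [ofReal_ofNat]
      field_simp
      ring
    rw [h2, hmain]
    linear_combination (-1 : ℂ) * hA + hB - (e⁻¹ * (Real.pi / 2 - 2 * δ)) * I_sq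
  have hcos : e = cos δ - sin δ * I := by
    rw [he, ← neg_mul, exp_mul_I, cos_neg, sin_neg]; ring
  have hcosinv : e⁻¹ = cos δ + sin δ * I := by
    rw [he, ← Complex.exp_neg, neg_neg, exp_mul_I]
  have hre : ((g - l) / (2 * Real.sin δ) + δ * I / (2 * Real.sin δ) + Real.pi / 2 * e
        + I * e⁻¹ * (g - l2) + e⁻¹ * (Real.pi / 2 - 2 * δ)).re
      = (Real.eulerMascheroniConstant - Real.log (4 * Real.pi * Real.sin δ)) / (2 * Real.sin δ)
        + Real.pi / 2 * Real.cos δ + Real.cos δ * (Real.pi / 2 - 2 * δ)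
        - Real.sin δ * (Real.eulerMascheroniConstant - Real.log (2 * Real.pi)) := by
    have : (g - l) / (2 * Real.sin δ) + δ * I / (2 * Real.sin δ) + Real.pi / 2 * e
        + I * e⁻¹ * (g - l2) + e⁻¹ * (Real.pi / 2 - 2 * δ)
        = (((Real.eulerMascheroniConstant - Real.log (4 * Real.pi * Real.sin δ)) / (2 * Real.sin δ)
        + Real.pi / 2 * Real.cos δ + Real.cos δ * (Real.pi / 2 - 2 * δ)
        - Real.sin δ * (Real.eulerMascheroniConstant - Real.log (2 * Real.pi)) : ℝ) : ℂ)
        + ((δ / (2 * Real.sin δ) - Real.pi / 2 * Real.sin δ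
        + Real.cos δ * (Real.eulerMascheroniConstant - Real.log (2 * Real.pi))
        + Real.sin δ * (Real.pi / 2 - 2 * δ) : ℝ) : ℂ) * I := by
      rw [hcosinv, hcos]
      simp only [ofReal_add, ofReal_sub, ofReal_mul, ofReal_div, ofReal_ofNat, ofReal_cos,
        ofReal_sin]
      linear_combination (sin δ * (g - l2)) * I_sq
    rw [this, add_re, ofReal_re, re_ofReal_mul, I_re, mul_zero, add_zero]
  rw [hJ, add_re, hre]

/-- Elementary estimates that turn `sin δ` into `δ` inside the logarithm. -/
lemma log_div_sin_bounds {δ : ℝ} (hδ : 0 < δ) (hδ1 : δ ≤ 1 / 2) :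
    3 / 4 * δ ≤ Real.sin δ ∧ |Real.log (δ / Real.sin δ) / (2 * Real.sin δ)| ≤ δ := by
  have hsge : δ - δ ^ 3 / 6 < Real.sin δ := Real.sin_gt_sub_cube hδ
  have hd2 : δ ^ 2 ≤ 1 / 4 := by nlinarith
  have hd3 : δ ^ 3 ≤ 1 / 4 * δ := by
    have : δ ^ 3 = δ ^ 2 * δ := by ring
    rw [this]; gcongr
  have hs34 : 3 / 4 * δ ≤ Real.sin δ := by linarith
  have hsin : 0 < Real.sin δ := by linarith
  have hq0 : 0 ≤ Real.log (δ / Real.sin δ) :=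
    Real.log_nonneg (by rw [one_le_div hsin]; exact Real.sin_le hδ.le)
  have hq1 : Real.log (δ / Real.sin δ) ≤ δ ^ 2 := by
    refine (Real.log_le_sub_one_of_pos (show 0 < δ / Real.sin δ by positivity)).trans ?_
    rw [sub_le_iff_le_add, div_le_iff₀ hsin]
    have h1 : δ ^ 2 * (3 / 4 * δ) ≤ δ ^ 2 * Real.sin δ := by gcongr
    have h2 : δ ^ 2 * (3 / 4 * δ) = 3 / 4 * δ ^ 3 := by ring
    have h3 : 0 < δ ^ 3 := by positivity
    linarith
  refine ⟨hs34, ?_⟩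
  rw [abs_of_nonneg (by positivity), div_le_iff₀ (by positivity)]
  have h1 : δ * (3 / 4 * δ) ≤ δ * Real.sin δ := by gcongr
  have h2 : 0 < δ ^ 2 := by positivity
  have h3 : δ * (3 / 4 * δ) = 3 / 4 * δ ^ 2 := by ring
  have h4 : δ * (2 * Real.sin δ) = 2 * (δ * Real.sin δ) := by ring
  linarith

/-- The error term of the expansion of the Lambert series is `O(δ)`. -/
lemma wigert_remainder : ∃ C δ₀ : ℝ, 0 < C ∧ 0 < δ₀ ∧ ∀ δ : ℝ, 0 < δ → δ ≤ δ₀ → δ ≤ 1 / 2 →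
    |(2 * Real.pi * exp (-(δ * I)) *
          (lambert (((4 * Real.pi * Real.sin δ : ℝ) : ℂ) * exp (-(δ * I)))
            - (Real.eulerMascheroniConstant
              - log (((4 * Real.pi * Real.sin δ : ℝ) : ℂ) * exp (-(δ * I))))
              / (((4 * Real.pi * Real.sin δ : ℝ) : ℂ) * exp (-(δ * I))) - 1 / 4)).re| ≤ C * δ := by
  obtain ⟨C₂, r, hC₂, hr, h₂⟩ := wigert
  have hpi := Real.pi_pos
  refine ⟨2 * Real.pi * (C₂ * (4 * Real.pi)), r / (4 * Real.pi), by positivity, by positivity,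
    fun δ hδ hδ' hδ2 => ?_⟩
  have hδr : 4 * Real.pi * δ ≤ r := by
    rw [le_div_iff₀ (by positivity)] at hδ'; linarith
  have hsle : Real.sin δ ≤ δ := Real.sin_le hδ.le
  have hsin : 0 < Real.sin δ := by linarith [(log_div_sin_bounds hδ hδ2).1]
  have hcos : 1 - δ ^ 2 / 2 ≤ Real.cos δ := Real.one_sub_sq_div_two_le_cos
  set w := ((4 * Real.pi * Real.sin δ : ℝ) : ℂ) * exp (-(δ * I)) with hw
  have hwn : ‖w‖ = 4 * Real.pi * Real.sin δ := by
    rw [hw, norm_mul, norm_exp_neg_mul_I, mul_one, norm_real, Real.norm_of_nonneg (by positivity)]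
  have hwle : ‖w‖ ≤ 4 * Real.pi * δ := by rw [hwn]; gcongr
  have hwsec : w ∈ sector := by
    have e1 : exp (-(δ * I)) = exp (((-δ : ℝ) : ℂ) * I) := by push_cast; ring_nf
    show |w.im| < w.re
    rw [hw, re_ofReal_mul, im_ofReal_mul, e1, exp_ofReal_mul_I_re, exp_ofReal_mul_I_im,
      Real.cos_neg, Real.sin_neg, abs_mul, abs_neg, abs_of_pos hsin, abs_of_pos (by positivity)]
    gcongr
    nlinarith
  refine (Complex.abs_re_le_norm _).trans ?_
  rw [norm_mul, norm_mul, norm_exp_neg_mul_I, mul_one]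
  have hn : ‖(2 * Real.pi : ℂ)‖ = 2 * Real.pi := by
    rw [show (2 * Real.pi : ℂ) = ((2 * Real.pi : ℝ) : ℂ) by push_cast; ring, norm_real,
      Real.norm_of_nonneg (by positivity)]
  rw [hn, mul_assoc (2 * Real.pi)]
  refine mul_le_mul_of_nonneg_left ?_ (by positivity)
  refine (h₂ w hwsec (hwle.trans hδr)).trans ?_
  rw [mul_assoc]
  exact mul_le_mul_of_nonneg_left hwle hC₂.le

/-- The **Titchmarsh–Kober–Atkinson formula** with error term `O(δ)`; the constant is `π`. -/
lemma kober : ∃ C δ₀ : ℝ, 0 < C ∧ 0 < δ₀ ∧ ∀ δ : ℝ, 0 < δ → δ ≤ δ₀ →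
    |laplaceZetaSq δ - (Real.eulerMascheroniConstant - Real.log (4 * Real.pi * δ))
      / (2 * Real.sin δ) - Real.pi| ≤ C * δ := by
  obtain ⟨C₁, hC₁, h₁⟩ := abs_meanTransform_sub_laplace_le
  obtain ⟨C₂, r, hC₂, hr, h₂⟩ := wigert_remainder
  have hpi := Real.pi_pos
  set K := |Real.eulerMascheroniConstant - Real.log (2 * Real.pi)| with hK
  refine ⟨C₁ + 1 + Real.pi + 2 + K + C₂, min (1 / 2) r, by positivity, by positivity,
    fun δ hδ hδ' => ?_⟩
  have hδ2 : δ ≤ 1 / 2 := hδ'.trans (min_le_left _ _)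
  obtain ⟨hs34, hq⟩ := log_div_sin_bounds hδ hδ2
  have hsin : 0 < Real.sin δ := by linarith
  have hsle : Real.sin δ ≤ δ := Real.sin_le hδ.le
  have hcos : 1 - δ ^ 2 / 2 ≤ Real.cos δ := Real.one_sub_sq_div_two_le_cos
  have hcos1 : Real.cos δ ≤ 1 := Real.cos_le_one δ
  have hRb := h₂ δ hδ (hδ'.trans (min_le_right _ _)) hδ2
  have hre := meanTransform_re_expansion hδ (by linarith)
  have hdiff := h₁ δ hδ (by linarith)
  set R := (2 * Real.pi * exp (-(δ * I)) *
          (lambert (((4 * Real.pi * Real.sin δ : ℝ) : ℂ) * exp (-(δ * I)))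
            - (Real.eulerMascheroniConstant
              - log (((4 * Real.pi * Real.sin δ : ℝ) : ℂ) * exp (-(δ * I))))
              / (((4 * Real.pi * Real.sin δ : ℝ) : ℂ) * exp (-(δ * I))) - 1 / 4)).re
  have hlog : Real.log (4 * Real.pi * δ) = Real.log (4 * Real.pi * Real.sin δ)
      + Real.log (δ / Real.sin δ) := by
    rw [← Real.log_mul (by positivity) (by positivity)]
    congr 1; field_simp
  have hKs : |Real.sin δ * (Real.eulerMascheroniConstant - Real.log (2 * Real.pi))| ≤ K * δ := by
    rw [abs_mul, abs_of_pos hsin, mul_comm]; gcongr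
  have hc1 : |Real.pi * (Real.cos δ - 1)| ≤ Real.pi * δ := by
    rw [abs_mul, abs_of_pos hpi]; gcongr
    rw [abs_le]; constructor <;> nlinarith
  have hc2 : |2 * δ * Real.cos δ| ≤ 2 * δ := by
    have hc0 : 0 ≤ Real.cos δ := by nlinarith
    rw [abs_of_nonneg (by positivity)]
    exact mul_le_of_le_one_right (by positivity) hcos1
  have efin : laplaceZetaSq δ - (Real.eulerMascheroniConstant - Real.log (4 * Real.pi * δ))
      / (2 * Real.sin δ) - Real.pi = -((meanTransform ((2 * δ : ℝ) : ℂ)).re - laplaceZetaSq δ)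
      + Real.log (δ / Real.sin δ) / (2 * Real.sin δ) + Real.pi * (Real.cos δ - 1)
      - 2 * δ * Real.cos δ
      - Real.sin δ * (Real.eulerMascheroniConstant - Real.log (2 * Real.pi)) + R := by
    rw [hre, hlog]; ring
  have hsum : (C₁ + 1 + Real.pi + 2 + K + C₂) * δ
      = C₁ * δ + δ + Real.pi * δ + 2 * δ + K * δ + C₂ * δ := by ring
  rw [efin, hsum]
  have b1 := abs_le.mp hdiff
  have b2 := abs_le.mp hRb
  have b3 := abs_le.mp hq
  have b4 := abs_le.mp hKs
  have b5 := abs_le.mp hc1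
  have b6 := abs_le.mp hc2
  rw [abs_le]
  constructor <;> linarith [b1.1, b1.2, b2.1, b2.2, b3.1, b3.2, b4.1, b4.2, b5.1, b5.2, b6.1, b6.2]

/-! ### Asymptotics of the truncated Laplace transform -/

/-- The constant `c - ln 2π` in the definition of `F`. -/
noncomputable def slopeConst : ℝ := Real.eulerMascheroniConstant - Real.log (2 * Real.pi)

lemma ladderF_eq (c₀ : ℝ) {y : ℝ} (hy : 0 < y) :
    ladderF c₀ y = y / 2 * (Real.log y - Real.log 2 + slopeConst) + c₀ := by
  rw [ladderF, Real.log_div hy.ne' two_ne_zero, slopeConst]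
  ring

lemma one_le_log {y : ℝ} (hy : 3 ≤ y) : 1 ≤ Real.log y := by
  rw [Real.le_log_iff_exp_le (by linarith)]
  linarith [Real.exp_one_lt_d9]

lemma log_div_le_one {y : ℝ} (hy : 3 ≤ y) : Real.log y / y ≤ 1 := by
  rw [div_le_one (by linarith)]
  linarith [Real.log_le_sub_one_of_pos (show 0 < y by linarith)]

lemma inv_le_log_div {y : ℝ} (hy : 3 ≤ y) : 1 / y ≤ Real.log y / y :=
  div_le_div_of_nonneg_right (one_le_log hy) (by linarith)

/-- In the variable `y = 1/δ`, the main term of the Titchmarsh–Kober–Atkinson formula is `F(y)`. -/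
lemma abs_laplace_sub_ladderF_le : ∃ C y₁ : ℝ, 0 < C ∧ 3 ≤ y₁ ∧ ∀ y : ℝ, y₁ ≤ y →
    |laplaceZetaSq (1 / y) - ladderF Real.pi y| ≤ C * (Real.log y / y) := by
  obtain ⟨C, δ₀, hC, hδ₀, h⟩ := kober
  refine ⟨C + (2 + |slopeConst|), max 3 (1 / δ₀), by positivity, le_max_left _ _, fun y hy => ?_⟩
  have hy3 : 3 ≤ y := (le_max_left _ _).trans hy
  have hy0 : 0 < y := by linarith
  have hδ : 0 < 1 / y := by positivity
  have hδ' : 1 / y ≤ δ₀ := by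
    rw [div_le_iff₀ hy0, ← div_le_iff₀' hδ₀]; exact (le_max_right _ _).trans hy
  have hδ2 : 1 / y ≤ 1 / 2 := one_div_le_one_div_of_le two_pos (by linarith)
  have hk := h _ hδ hδ'
  obtain ⟨hs34, -⟩ := log_div_sin_bounds hδ hδ2
  have hsle := Real.sin_le hδ.le
  have hsge : 1 / y - (1 / y) ^ 3 / 6 < Real.sin (1 / y) := Real.sin_gt_sub_cube hδ
  have hsin : 0 < Real.sin (1 / y) := by linarith
  set N := Real.log y - Real.log 2 + slopeConst with hN
  have hlog : Real.eulerMascheroniConstant - Real.log (4 * Real.pi * (1 / y)) = N := by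
    rw [Real.log_mul (by positivity) (by positivity), one_div, Real.log_inv, hN, slopeConst,
      show 4 * Real.pi = 2 * (2 * Real.pi) by ring, Real.log_mul (by norm_num) (by positivity)]
    ring
  have hL := one_le_log hy3
  have hNb : |N| ≤ (2 + |slopeConst|) * Real.log y := by
    have h1 := abs_add_le (Real.log y - Real.log 2) slopeConst
    have h2 : |Real.log y - Real.log 2| ≤ Real.log y := by
      rw [abs_le]
      have := Real.log_two_lt_d9
      have := Real.log_two_gt_d9
      constructor <;> linarith
    have h3 : |slopeConst| ≤ |slopeConst| * Real.log y :=
      le_mul_of_one_le_right (abs_nonneg _) hL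
    rw [add_mul]
    linarith
  have hdiff : |N / (2 * Real.sin (1 / y)) - y / 2 * N| ≤ |N| * (1 / y) := by
    have e : N / (2 * Real.sin (1 / y)) - y / 2 * N
        = N * ((1 / y - Real.sin (1 / y)) / (2 * (1 / y) * Real.sin (1 / y))) := by
      field_simp
    rw [e, abs_mul]
    refine mul_le_mul_of_nonneg_left ?_ (abs_nonneg _)
    rw [abs_of_nonneg (div_nonneg (by linarith) (by positivity)), div_le_iff₀ (by positivity)]
    have h1 : (1 / y) ^ 2 * (3 / 4 * (1 / y)) ≤ (1 / y) ^ 2 * Real.sin (1 / y) := by gcongr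
    have h2 : (1 / y) * (2 * (1 / y) * Real.sin (1 / y))
      = 2 * ((1 / y) ^ 2 * Real.sin (1 / y)) := by ring
    have h3 : (1 / y) ^ 2 * (3 / 4 * (1 / y)) = 3 / 4 * (1 / y) ^ 3 := by ring
    have h4 : 0 < (1 / y) ^ 3 := by positivity
    linarith
  rw [hlog] at hk
  rw [ladderF_eq _ hy0, ← hN]
  have e : laplaceZetaSq (1 / y) - (y / 2 * N + Real.pi)
      = (laplaceZetaSq (1 / y) - N / (2 * Real.sin (1 / y)) - Real.pi)
        + (N / (2 * Real.sin (1 / y)) - y / 2 * N) := by ring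
  rw [e, add_mul]
  refine (abs_add_le _ _).trans (add_le_add (hk.trans ?_) (hdiff.trans ?_))
  · exact mul_le_mul_of_nonneg_left (inv_le_log_div hy3) hC.le
  · calc |N| * (1 / y) ≤ (2 + |slopeConst|) * Real.log y * (1 / y) := by gcongr
      _ = _ := by ring

lemma ladderF_pi_le {y : ℝ} (hy : 3 ≤ y) : ladderF Real.pi y ≤ (2 + |slopeConst|) * y ^ 2 := by
  have hy0 : 0 < y := by linarith
  rw [ladderF_eq _ hy0]
  have h1 := Real.log_le_sub_one_of_pos hy0
  have h2 := Real.log_two_gt_d9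
  have h3 := le_abs_self slopeConst
  have h4 := abs_nonneg slopeConst
  have h5 := Real.pi_lt_four
  have h6 : y / 2 * (Real.log y - Real.log 2 + slopeConst) ≤ y / 2 * (y + |slopeConst|) := by
    gcongr; linarith
  have h7 : y * |slopeConst| ≤ y ^ 2 * |slopeConst| := by
    gcongr; nlinarith
  nlinarith [mul_nonneg hy0.le h4]

lemma laplaceZetaSq_nonneg (δ : ℝ) : 0 ≤ laplaceZetaSq δ :=
  setIntegral_nonneg measurableSet_Ioi fun t _ => mul_nonneg (zetaSq_nonneg t) (Real.exp_pos _).le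

lemma integral_zetaSq_mul_exp_add {δ X : ℝ} (hδ : 0 < δ) (hX : 0 ≤ X) :
    (∫ t in (0 : ℝ)..X, zetaSq t * Real.exp (-2 * δ * t))
      + ∫ t in Ioi X, zetaSq t * Real.exp (-2 * δ * t) = laplaceZetaSq δ := by
  have h := integrableOn_laplace hδ
  rw [laplaceZetaSq, ← Ioc_union_Ioi_eq_Ioi hX, setIntegral_union (Ioc_disjoint_Ioi le_rfl)
    measurableSet_Ioi (h.mono_set Ioc_subset_Ioi_self) (h.mono_set (Ioi_subset_Ioi hX)),
    intervalIntegral.integral_of_le hX]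

/-- Half of the exponential decay gives smallness of the tail, the other half convergence. -/
lemma tail_laplace_le {δ X : ℝ} (hδ : 0 < δ) (hX : 0 ≤ X) :
    ∫ t in Ioi X, zetaSq t * Real.exp (-2 * δ * t)
      ≤ Real.exp (-(δ * X)) * laplaceZetaSq (δ / 2) := by
  have h1 := integrableOn_laplace hδ
  have h2 := integrableOn_laplace (half_pos hδ)
  calc ∫ t in Ioi X, zetaSq t * Real.exp (-2 * δ * t)
      ≤ ∫ t in Ioi X, Real.exp (-(δ * X)) * (zetaSq t * Real.exp (-2 * (δ / 2) * t)) := by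
        refine setIntegral_mono_on (h1.mono_set (Ioi_subset_Ioi hX))
          ((h2.mono_set (Ioi_subset_Ioi hX)).const_mul _) measurableSet_Ioi fun t ht => ?_
        have hz := zetaSq_nonneg t
        rw [mul_left_comm, ← Real.exp_add]
        gcongr
        have : δ * X ≤ δ * t := by gcongr; exact (mem_Ioi.mp ht).le
        linarith
    _ = Real.exp (-(δ * X)) * ∫ t in Ioi X, zetaSq t * Real.exp (-2 * (δ / 2) * t) := by
        rw [integral_const_mul]
    _ ≤ _ := by
        refine mul_le_mul_of_nonneg_left ?_ (Real.exp_pos _).le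
        refine setIntegral_mono_set h2 (Eventually.of_forall fun t =>
          mul_nonneg (zetaSq_nonneg t) (Real.exp_pos _).le) ?_
        exact (Ioi_subset_Ioi hX).eventuallyLE

lemma ladderLHS_eq (μ : ℝ → ℝ) (y : ℝ) :
    ladderLHS μ y = ∫ t in (0 : ℝ)..(μ y), zetaSq t * Real.exp (-2 * (1 / y) * t) := by
  unfold ladderLHS
  congr 1; ext t
  rw [hardyZ_sq_eq_zetaSq]
  ring_nf

/-- The condition `μ(y) ≥ 7 y ln y` makes the tail negligible. -/
lemma abs_ladderLHS_sub_ladderF_le : ∃ A y₁ : ℝ, 0 < A ∧ 3 ≤ y₁ ∧ ∀ (μ : ℝ → ℝ) (y : ℝ), y₁ ≤ y →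
    7 * y * Real.log y ≤ μ y → |ladderLHS μ y - ladderF Real.pi y| ≤ A * (Real.log y / y) := by
  obtain ⟨C, y₁, hC, hy₁, h⟩ := abs_laplace_sub_ladderF_le
  -- the tail is at most `e^{-μ(y)/y}` times the transform at `1/(2y)`, which is `O(y²)`; of the bound
  -- `y^{-7}` for the exponential, `y^{-3}` is enough
  refine ⟨C + (4 * (2 + |slopeConst|) + C), y₁, by positivity, hy₁, fun μ y hy hμ => ?_⟩
  have hy3 : 3 ≤ y := hy₁.trans hy
  have hy0 : 0 < y := by linarith
  have hL := one_le_log hy3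
  have hX : 0 ≤ μ y := le_trans (by positivity) hμ
  have hδ : 0 < 1 / y := by positivity
  have hsplit := integral_zetaSq_mul_exp_add hδ hX
  have htail := tail_laplace_le hδ hX
  have htail0 : 0 ≤ ∫ t in Ioi (μ y), zetaSq t * Real.exp (-2 * (1 / y) * t) :=
    setIntegral_nonneg measurableSet_Ioi fun t _ => mul_nonneg (zetaSq_nonneg t) (Real.exp_pos _).le
  rw [← ladderLHS_eq] at hsplit
  set tail := ∫ t in Ioi (μ y), zetaSq t * Real.exp (-2 * (1 / y) * t)
  have hG : laplaceZetaSq (1 / y / 2) ≤ (4 * (2 + |slopeConst|) + C) * y ^ 2 := by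
    have e : 1 / y / 2 = 1 / (2 * y) := by field_simp
    have h1 := (abs_le.mp (h (2 * y) (by linarith))).2
    have h2 := ladderF_pi_le (y := 2 * y) (by linarith)
    have h3 := mul_le_of_le_one_right hC.le (log_div_le_one (y := 2 * y) (by linarith))
    have h4 : C ≤ C * y ^ 2 := le_mul_of_one_le_right hC.le (by nlinarith)
    rw [e]
    linarith
  have hexp : Real.exp (-(1 / y * μ y)) ≤ 1 / y ^ 3 := by
    have h1 : Real.exp (-(1 / y * μ y)) ≤ Real.exp (-(3 * Real.log y)) := by
      apply Real.exp_le_exp.mpr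
      have : 1 / y * (7 * y * Real.log y) ≤ 1 / y * μ y := by gcongr
      have e : 1 / y * (7 * y * Real.log y) = 7 * Real.log y := by field_simp
      linarith
    refine h1.trans (le_of_eq ?_)
    rw [Real.exp_neg, show (3 : ℝ) * Real.log y = ((3 : ℕ) : ℝ) * Real.log y by norm_num,
      Real.exp_nat_mul, Real.exp_log hy0, one_div]
  have htb : tail ≤ (4 * (2 + |slopeConst|) + C) * (Real.log y / y) := by
    calc tail ≤ 1 / y ^ 3 * ((4 * (2 + |slopeConst|) + C) * y ^ 2) :=
          htail.trans (mul_le_mul hexp hG (laplaceZetaSq_nonneg _) (by positivity))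
      _ = (4 * (2 + |slopeConst|) + C) * (1 / y) := by field_simp
      _ ≤ _ := mul_le_mul_of_nonneg_left (inv_le_log_div hy3) (by positivity)
  have hmain := abs_le.mp (h y hy)
  rw [add_mul, abs_le]
  have hn : 0 ≤ (4 * (2 + |slopeConst|) + C) * (Real.log y / y) := by positivity
  constructor <;> linarith [hmain.1, hmain.2]

/-! ### Monotonicity of both sides of the integral equation -/

/-- The zeros of `ζ` are isolated, so `|ζ(1/2 + it)|²` vanishes on no interval. -/
lemma exists_zetaSq_pos {a b : ℝ} (hab : a < b) : ∃ c ∈ Icc a b, 0 < zetaSq c := by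
  by_contra! hcon
  have hz : ∀ t ∈ Icc a b, riemannZeta (critPt t) = 0 := fun t ht => by
    have h := le_antisymm (hcon t ht) (zetaSq_nonneg t)
    unfold zetaSq at h
    simpa using h
  have hf : AnalyticOnNhd ℂ riemannZeta {1}ᶜ := by
    refine DifferentiableOn.analyticOnNhd (fun s hs => ?_) isOpen_compl_singleton
    exact (differentiableAt_riemannZeta hs).differentiableWithinAt
  have hpre : IsPreconnected ({1}ᶜ : Set ℂ) :=
    (isConnected_compl_singleton_of_one_lt_rank (by simp [Complex.rank_real_complex]) 1).isPreconnected
  set m := (a + b) / 2 with hm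
  have htend : Tendsto critPt (𝓝[≠] m) (𝓝[≠] (critPt m)) := by
    refine tendsto_nhdsWithin_iff.mpr ⟨(continuous_critPt.tendsto m).mono_left
      nhdsWithin_le_nhds, ?_⟩
    filter_upwards [self_mem_nhdsWithin] with t ht h
    have := congrArg Complex.im h
    simp at this
    exact ht this
  have hev : ∀ᶠ t in 𝓝[≠] m, riemannZeta (critPt t) = (0 : ℂ → ℂ) (critPt t) := by
    have : Icc a b ∈ 𝓝 m := Icc_mem_nhds (by linarith) (by linarith)
    filter_upwards [mem_nhdsWithin_of_mem_nhds this] with t ht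
    exact hz t ht
  have := hf.eqOn_of_preconnected_of_frequently_eq (analyticOnNhd_const (v := (0 : ℂ))) hpre
    (critPt_ne_one m) (htend.frequently hev.frequently) (x := 2) (by norm_num)
  exact riemannZeta_ne_zero_of_one_le_re (s := 2) (by norm_num) this

lemma hlIntegral_eq (T : ℝ) : hlIntegral T = ∫ t in (0 : ℝ)..T, zetaSq t := by
  simp only [hlIntegral, hardyZ_sq_eq_zetaSq]

lemma hlIntegral_strictMono : StrictMono hlIntegral := fun a b hab => by
  have hi : ∀ c d, IntervalIntegrable zetaSq volume c d := fun c d =>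
    continuous_zetaSq.intervalIntegrable c d
  rw [← sub_pos, hlIntegral_eq, hlIntegral_eq,
    intervalIntegral.integral_interval_sub_left (hi _ _) (hi _ _)]
  exact intervalIntegral.integral_pos hab continuous_zetaSq.continuousOn
    (fun t _ => zetaSq_nonneg t) (exists_zetaSq_pos hab)

lemma continuous_hlIntegral : Continuous hlIntegral := by
  have : hlIntegral = fun T => ∫ t in (0 : ℝ)..T, zetaSq t := funext hlIntegral_eq
  rw [this]
  exact intervalIntegral.continuous_primitive (fun a b => continuous_zetaSq.intervalIntegrable a b) 0

lemma hlIntegral_zero : hlIntegral 0 = 0 := by simp [hlIntegral]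

/-- Dropping the exponential gives `M(y) ≤ μ(y)`. -/
lemma ladderLHS_le_hlIntegral {μ : ℝ → ℝ} {y : ℝ} (hy : 0 < y) (hμ : 0 ≤ μ y) :
    ladderLHS μ y ≤ hlIntegral (μ y) := by
  rw [ladderLHS_eq, hlIntegral_eq]
  have hc := continuous_zetaSq
  refine intervalIntegral.integral_mono_on hμ (Continuous.intervalIntegrable (by fun_prop) _ _)
    (hc.intervalIntegrable _ _) fun t ht => ?_
  refine mul_le_of_le_one_right (zetaSq_nonneg t) (Real.exp_le_one_iff.mpr ?_)
  have : 0 ≤ 1 / y * t := mul_nonneg (by positivity) ht.1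
  linarith

lemma ladderLHS_strictMonoOn {μ : ℝ → ℝ} {y₀ : ℝ} (hy₀ : 0 < y₀) (hmono : MonotoneOn μ (Ici y₀))
    (hpos : ∀ y, y₀ ≤ y → 0 < μ y) : StrictMonoOn (ladderLHS μ) (Ici y₀) := by
  intro y hy y' hy' hlt
  have hy1 : y₀ ≤ y := hy
  have hyp : 0 < y := hy₀.trans_le hy1
  have hX := hpos y hy1
  have hc := continuous_zetaSq
  rw [ladderLHS_eq, ladderLHS_eq]
  have hi : ∀ y c d : ℝ, IntervalIntegrable (fun t => zetaSq t * Real.exp (-2 * (1 / y) * t))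
      volume c d := fun y c d => Continuous.intervalIntegrable (by fun_prop) _ _
  have hinv : 1 / y' < 1 / y := one_div_lt_one_div_of_lt hyp hlt
  have h1 : ∫ t in (0 : ℝ)..(μ y), zetaSq t * Real.exp (-2 * (1 / y) * t)
      < ∫ t in (0 : ℝ)..(μ y), zetaSq t * Real.exp (-2 * (1 / y') * t) := by
    obtain ⟨c, hcm, hcp⟩ := exists_zetaSq_pos (show μ y / 2 < μ y by linarith)
    have hc0 : 0 < c := by linarith [hcm.1]
    refine intervalIntegral.integral_lt_integral_of_continuousOn_of_le_of_exists_lt hX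
      (by fun_prop) (by fun_prop) (fun t ht => ?_) ⟨c, ⟨hc0.le, hcm.2⟩, ?_⟩
    · refine mul_le_mul_of_nonneg_left (Real.exp_le_exp.mpr ?_) (zetaSq_nonneg t)
      have := mul_le_mul_of_nonneg_right hinv.le ht.1.le
      linarith
    · refine mul_lt_mul_of_pos_left (Real.exp_lt_exp.mpr ?_) hcp
      have := mul_lt_mul_of_pos_right hinv hc0
      linarith
  refine h1.trans_le ?_
  refine intervalIntegral.integral_mono_interval le_rfl hX.le (hmono hy hy' hlt.le)
    (Eventually.of_forall fun t => mul_nonneg (zetaSq_nonneg t) (Real.exp_pos _).le) (hi _ _ _)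

lemma continuousOn_ladderLHS {μ : ℝ → ℝ} {y₀ : ℝ} (hy₀ : 0 < y₀) (hμ : ContinuousOn μ (Ici y₀)) :
    ContinuousOn (ladderLHS μ) (Ici y₀) := by
  rw [continuousOn_iff_continuous_domRestrict] at hμ ⊢
  have hc := continuous_zetaSq
  have e : (Ici y₀).domRestrict (ladderLHS μ) = fun y : Ici y₀ =>
      ∫ t in (0 : ℝ)..((Ici y₀).domRestrict μ y), zetaSq t * Real.exp (-2 * (1 / (y : ℝ)) * t) :=
    funext fun y => ladderLHS_eq μ y
  rw [e]
  refine intervalIntegral.continuous_parametric_intervalIntegral_of_continuous ?_ hμ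
  have hinv : Continuous fun p : Ici y₀ × ℝ => 1 / (p.1 : ℝ) :=
    continuous_const.div (continuous_subtype_val.comp continuous_fst)
      fun p => (hy₀.trans_le p.1.2).ne'
  show Continuous fun p : Ici y₀ × ℝ => zetaSq p.2 * Real.exp (-2 * (1 / (p.1 : ℝ)) * p.2)
  fun_prop

/-! ### Comparison of `M(y)` with `y` -/

/-- The part of `∫_0^{4y}` seen through the weight `e^{-t/y}` already carries more than the fraction
`1 - 2/7` of the leading term. -/
lemma le_hlIntegral_four_mul : ∃ C y₁ : ℝ, 3 ≤ y₁ ∧ ∀ y : ℝ, y₁ ≤ y →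
    ladderF Real.pi (2 * y) - C - (ladderF Real.pi (4 * y) + C) / 7 ≤ hlIntegral (4 * y) := by
  obtain ⟨C, y₁, hC, hy₁, h⟩ := abs_laplace_sub_ladderF_le
  refine ⟨C, y₁, hy₁, fun y hy => ?_⟩
  have hy0 : 0 < y := by linarith
  have hle := ladderLHS_le_hlIntegral (μ := fun _ => 4 * y) (y := 2 * y) (by positivity)
    (by positivity)
  have hδ : 0 < 1 / (2 * y) := by positivity
  have hsplit := integral_zetaSq_mul_exp_add hδ (show 0 ≤ 4 * y by positivity)
  have htail := tail_laplace_le hδ (show 0 ≤ 4 * y by positivity)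
  rw [ladderLHS_eq] at hle
  have e1 : 1 / (2 * y) * (4 * y) = 2 := by field_simp; norm_num
  have e2 : 1 / (2 * y) / 2 = 1 / (4 * y) := by field_simp; norm_num
  rw [e1, e2] at htail
  have hexp : Real.exp (-2) ≤ 1 / 7 := by
    rw [Real.exp_neg, ← one_div, show (2 : ℝ) = 1 + 1 by norm_num, Real.exp_add]
    exact one_div_le_one_div_of_le (by norm_num) (by nlinarith [Real.exp_one_gt_d9])
  have h2 := (abs_le.mp (h (2 * y) (by linarith))).1
  have h4 := (abs_le.mp (h (4 * y) (by linarith))).2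
  have l2 := mul_le_of_le_one_right hC.le (log_div_le_one (y := 2 * y) (by linarith))
  have l4 := mul_le_of_le_one_right hC.le (log_div_le_one (y := 4 * y) (by linarith))
  have hG : Real.exp (-2) * laplaceZetaSq (1 / (4 * y)) ≤ 1 / 7 * laplaceZetaSq (1 / (4 * y)) :=
    mul_le_mul_of_nonneg_right hexp (laplaceZetaSq_nonneg _)
  linarith

lemma le_ladderF_pi {y : ℝ} (hy : 0 < y) (hL : 3 + |slopeConst| ≤ Real.log y) :
    y ≤ ladderF Real.pi y := by
  rw [ladderF_eq _ hy]
  have : y / 2 * 2 ≤ y / 2 * (Real.log y - Real.log 2 + slopeConst) := by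
    gcongr
    linarith [neg_abs_le slopeConst, Real.log_two_lt_d9]
  linarith [Real.pi_pos]

/-- The quantitative information on the integral equation from which all properties of ladders
follow.  The last two bounds say `X₀ < M(y) < 4 y`. -/
lemma exists_ladder_bounds : ∃ A Y X₀ : ℝ, 0 < A ∧ 3 ≤ Y ∧ 12 ≤ X₀ ∧
    (∀ T : ℝ, X₀ ≤ T → Real.log T / 2 ≤ Real.log (T / 8) + slopeConst) ∧
    ∀ (μ : ℝ → ℝ) (y : ℝ), Y ≤ y → 7 * y * Real.log y ≤ μ y →
      |ladderLHS μ y - ladderF Real.pi y| ≤ A * (Real.log y / y) ∧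
      hlIntegral X₀ < ladderLHS μ y ∧ ladderLHS μ y < hlIntegral (4 * y) := by
  obtain ⟨A, y₁, hA, hy₁, hLHS⟩ := abs_ladderLHS_sub_ladderF_le
  obtain ⟨C, y₂, hy₂, hhl⟩ := le_hlIntegral_four_mul
  -- `12 ≥ 4e` is used where `ln y / y` has to be decreasing from `T/4` on; the exponential is chosen
  -- by `ln 8 ≤ 3`
  set X₀ := max 12 (Real.exp (2 * (3 + |slopeConst|))) with hX₀
  have hK1 := neg_abs_le slopeConst
  have hl2 := Real.log_two_lt_d9
  have hl2' := Real.log_two_gt_d9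
  have hpi := Real.pi_pos
  have hev : ∀ᶠ y : ℝ in atTop, y₁ ≤ y ∧ y₂ ≤ y ∧ 5 + |slopeConst| ≤ Real.log y ∧
      Real.pi / 7 + C + C / 7 + A < y ∧ hlIntegral X₀ + A < y := by
    filter_upwards [eventually_ge_atTop y₁, eventually_ge_atTop y₂,
      Real.tendsto_log_atTop.eventually_ge_atTop (5 + |slopeConst|),
      eventually_gt_atTop (Real.pi / 7 + C + C / 7 + A),
      eventually_gt_atTop (hlIntegral X₀ + A)] with y h1 h2 h3 h4 h5
    exact ⟨h1, h2, h3, h4, h5⟩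
  obtain ⟨Y, hY⟩ := eventually_atTop.mp hev
  refine ⟨A, Y, X₀, hA, hy₁.trans (hY Y le_rfl).1, le_max_left _ _, fun T hT => ?_,
    fun μ y hy hμ => ?_⟩
  · have hT12 : 12 ≤ T := (le_max_left _ _).trans hT
    have hlog : 2 * (3 + |slopeConst|) ≤ Real.log T := by
      rw [Real.le_log_iff_exp_le (by linarith)]; exact (le_max_right _ _).trans hT
    rw [Real.log_div (by positivity) (by norm_num), show (8 : ℝ) = 2 ^ 3 by norm_num, Real.log_pow]
    push_cast
    linarith
  · obtain ⟨h1, h2, h3, h4, h5⟩ := hY y hy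
    have hy3 : 3 ≤ y := hy₁.trans h1
    have hy0 : 0 < y := by linarith
    have hb := hLHS μ y h1 hμ
    have hb' := abs_le.mp hb
    have hA1 := mul_le_of_le_one_right hA.le (log_div_le_one hy3)
    refine ⟨hb, ?_, ?_⟩
    · have hF := le_ladderF_pi hy0 (by linarith)
      linarith [hb'.1]
    · have hlow := hhl y h2
      have e2 := ladderF_eq Real.pi (show 0 < 2 * y by positivity)
      have e4 := ladderF_eq Real.pi (show 0 < 4 * y by positivity)
      have e1 := ladderF_eq Real.pi hy0
      rw [Real.log_mul (by norm_num) hy0.ne'] at e2 e4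
      rw [show (4 : ℝ) = 2 ^ 2 by norm_num, Real.log_pow] at e4
      norm_num at e4
      have hmain : y * 1 ≤ y * (3 / 14 * (Real.log y + slopeConst + Real.log 2)) := by
        gcongr; linarith
      have key : ladderF Real.pi (2 * y) - C - (ladderF Real.pi (4 * y) + C) / 7
          - (ladderF Real.pi y + A)
          = y * (3 / 14 * (Real.log y + slopeConst + Real.log 2))
            - (Real.pi / 7 + C + C / 7 + A) := by
        rw [e1, e2, e4]; ring
      linarith [hb'.2]

/-- Expansiveness of `F`, from the monotonicity of the logarithm. -/
lemma ladderF_sub_ge (c₀ : ℝ) {a b : ℝ} (ha : 0 < a) (hab : a ≤ b) :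
    (b - a) / 2 * (Real.log (a / 2) + slopeConst) ≤ ladderF c₀ b - ladderF c₀ a := by
  have hlog : Real.log (a / 2) ≤ Real.log (b / 2) := Real.log_le_log (by positivity) (by linarith)
  have := mul_le_mul_of_nonneg_left hlog (show 0 ≤ b / 2 by linarith)
  rw [ladderF, ladderF, slopeConst]
  linarith

/-- Two arguments `≥ T/4` at which `F` differs by little are close to each other. -/
lemma sub_le_of_ladderF_sub_le {c₀ E T a b : ℝ} (hT : 1 < T)
    (hlog : Real.log T / 2 ≤ Real.log (T / 8) + slopeConst) (ha : T / 4 ≤ a) (hab : a ≤ b)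
    (h : ladderF c₀ b - ladderF c₀ a ≤ E * (Real.log T / T)) : b - a ≤ 4 * E * (1 / T) := by
  have hT0 : 0 < T := by linarith
  have hL : 0 < Real.log T := Real.log_pos hT
  have h1 := ladderF_sub_ge c₀ (show 0 < a by linarith) hab
  have h2 : Real.log (T / 8) ≤ Real.log (a / 2) := Real.log_le_log (by positivity) (by linarith)
  have h3 : (b - a) / 2 * (Real.log T / 2) ≤ (b - a) / 2 * (Real.log (a / 2) + slopeConst) := by
    have : 0 ≤ (b - a) / 2 := by linarith
    gcongr; linarith
  have h4 : (b - a) * Real.log T ≤ 4 * E * (1 / T) * Real.log T := by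
    have : 4 * E * (1 / T) * Real.log T = 4 * (E * (Real.log T / T)) := by ring
    linarith
  exact le_of_mul_le_mul_right h4 hL

lemma log_div_le_four_mul {T y : ℝ} (hT : 12 ≤ T) (hy : T / 4 ≤ y) :
    Real.log y / y ≤ 4 * (Real.log T / T) := by
  have he := Real.exp_one_lt_d9
  have h := Real.log_div_self_antitoneOn (show Real.exp 1 ≤ T / 4 by linarith)
    (show Real.exp 1 ≤ y by linarith) hy
  refine h.trans ?_
  have hl : Real.log (T / 4) ≤ Real.log T := Real.log_le_log (by linarith) (by linarith)
  have e : 4 * (Real.log T / T) = Real.log T / (T / 4) := by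
    field_simp
  show Real.log (T / 4) / (T / 4) ≤ _
  rw [e]
  exact div_le_div_of_nonneg_right hl (by linarith)

/-! ### Jacob's ladders -/

lemma _root_.IsRay.pos {y₀ : ℝ} {μ : ℝ → ℝ} (hμ : IsRay y₀ μ) (hy₀ : 3 ≤ y₀) {y : ℝ} (hy : y₀ ≤ y) :
    0 < μ y := by
  have := one_le_log (hy₀.trans hy)
  have : 0 < y := by linarith
  exact lt_of_lt_of_le (by positivity) (hμ.lower y hy)

lemma _root_.IsRay.strictMonoOn {y₀ : ℝ} {μ : ℝ → ℝ} (hμ : IsRay y₀ μ) (hy₀ : 3 ≤ y₀) :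
    StrictMonoOn (ladderLHS μ) (Ici y₀) :=
  ladderLHS_strictMonoOn (by linarith) hμ.mono fun _ hy => hμ.pos hy₀ hy

/-- The number `M(y)`. -/
lemma _root_.IsRay.exists_eq_hlIntegral {y₀ : ℝ} {μ : ℝ → ℝ} (hμ : IsRay y₀ μ) (hy₀ : 3 ≤ y₀) {y : ℝ}
    (hy : y₀ ≤ y) (hpos : 0 < ladderLHS μ y) :
    ∃ M : ℝ, 0 < M ∧ M ≤ μ y ∧ ladderLHS μ y = hlIntegral M := by
  have hm := hμ.pos hy₀ hy
  have hle := ladderLHS_le_hlIntegral (show 0 < y by linarith) hm.le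
  obtain ⟨M, hM, hMe⟩ := intermediate_value_Icc hm.le continuous_hlIntegral.continuousOn
    (show ladderLHS μ y ∈ Icc (hlIntegral 0) (hlIntegral (μ y)) from
      ⟨hlIntegral_zero.trans_le hpos.le, hle⟩)
  refine ⟨M, ?_, hM.2, hMe.symm⟩
  rw [← hlIntegral_strictMono.lt_iff_lt, hlIntegral_zero, hMe]
  exact hpos

/-- The left-hand side of the equation is unbounded, like `F`. -/
lemma exists_ladderLHS_ge {y₀ A : ℝ} {μ : ℝ → ℝ} (hA : 0 ≤ A)
    (hμ : ∀ y, y₀ ≤ y → |ladderLHS μ y - ladderF Real.pi y| ≤ A * (Real.log y / y)) (T : ℝ) :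
    ∃ y, y₀ ≤ y ∧ hlIntegral T ≤ ladderLHS μ y := by
  obtain ⟨y, hy, h3, hL, hT⟩ := ((eventually_ge_atTop y₀).and ((eventually_ge_atTop 3).and
    ((Real.tendsto_log_atTop.eventually_ge_atTop (3 + |slopeConst|)).and
    (eventually_ge_atTop (hlIntegral T + A))))).exists
  refine ⟨y, hy, ?_⟩
  have h1 := (abs_le.mp (hμ y hy)).1
  have h2 := mul_le_of_le_one_right hA (log_div_le_one h3)
  have h4 := le_ladderF_pi (by linarith) hL
  linarith

/-- The left-hand side of the equation takes every value from its value at `y₀` on. -/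
lemma _root_.IsRay.exists_ladder {y₀ : ℝ} {μ : ℝ → ℝ} (hμ : IsRay y₀ μ) (hy₀ : 3 ≤ y₀)
    (hlt : ∀ y, y₀ ≤ y → ladderLHS μ y < hlIntegral (4 * y))
    (hunb : ∀ T : ℝ, ∃ y, y₀ ≤ y ∧ hlIntegral T ≤ ladderLHS μ y)
    {T₀ : ℝ} (hT₀ : ladderLHS μ y₀ ≤ hlIntegral T₀) : ∃ φ : ℝ → ℝ, IsJacobLadder y₀ μ T₀ φ := by
  have hcont : ContinuousOn (ladderLHS μ) (Ici y₀) :=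
    continuousOn_ladderLHS (by linarith) hμ.smooth.continuousOn
  have hex : ∀ T : ℝ, ∃ y, T₀ ≤ T → y₀ ≤ y ∧ ladderLHS μ y = hlIntegral T := fun T => by
    by_cases hT : T₀ ≤ T
    · obtain ⟨b, hb, hbT⟩ := hunb T
      obtain ⟨y, hy, hye⟩ := intermediate_value_Icc hb (hcont.mono Icc_subset_Ici_self)
        (show hlIntegral T ∈ Icc (ladderLHS μ y₀) (ladderLHS μ b) from
          ⟨hT₀.trans (hlIntegral_strictMono.monotone hT), hbT⟩)
      exact ⟨y, fun _ => ⟨hy.1, hye⟩⟩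
    · exact ⟨0, fun h => absurd h hT⟩
  choose φ hφ using hex
  refine ⟨φ, fun T hT => (hφ T hT).1, fun T hT => (hφ T hT).2, ?_⟩
  refine tendsto_atTop_mono' _ ?_ (tendsto_id.atTop_div_const (show (0 : ℝ) < 4 by norm_num))
  filter_upwards [eventually_ge_atTop T₀] with T hT
  have h := hlt (φ T) (hφ T hT).1
  rw [(hφ T hT).2, hlIntegral_strictMono.lt_iff_lt] at h
  simp only [id]
  linarith

/-- Limit form of the Titchmarsh–Kober–Atkinson formula. -/
lemma tendsto_kober :
    Tendsto (fun δ : ℝ => (∫ t in Ioi (0 : ℝ), hardyZ t ^ 2 * Real.exp (-2 * δ * t))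
        - (Real.eulerMascheroniConstant - Real.log (4 * Real.pi * δ)) / (2 * Real.sin δ))
      (𝓝[>] 0) (𝓝 Real.pi) := by
  obtain ⟨C, δ₀, hC, hδ₀, h⟩ := kober
  rw [tendsto_iff_dist_tendsto_zero]
  have h0 : Tendsto (fun δ : ℝ => C * δ) (𝓝[>] 0) (𝓝 0) := by
    have : Tendsto (fun δ : ℝ => C * δ) (𝓝 0) (𝓝 (C * 0)) :=
      (continuous_const.mul continuous_id).tendsto 0
    rw [mul_zero] at this
    exact this.mono_left nhdsWithin_le_nhds
  refine squeeze_zero' (Eventually.of_forall fun _ => dist_nonneg) ?_ h0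
  filter_upwards [Ioc_mem_nhdsGT hδ₀] with δ hδ
  rw [Real.dist_eq]
  simp only [hardyZ_sq_eq_zetaSq]
  exact h δ hδ.1 hδ.2

end JacobLadder

theorem mainTheorem1 :
    -- absolute constants
    ∃ c₀ Y A B : ℝ, 1 < Y ∧ 0 < A ∧ 0 < B ∧
      -- `c₀` is the constant of the Titchmarsh-Kober-Atkinson formula
      Tendsto (fun δ : ℝ => (∫ t in Ioi (0 : ℝ), hardyZ t ^ 2 * Real.exp (-2 * δ * t))
          - (Real.eulerMascheroniConstant - Real.log (4 * Real.pi * δ)) / (2 * Real.sin δ))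
        (𝓝[>] 0) (𝓝 c₀) ∧
      ∀ y₀ : ℝ, Y ≤ y₀ →
        -- every `μ` has exactly one ladder `φ`, whose maximal interval is `[T₀[φ], ∞)`
        (∀ μ : ℝ → ℝ, IsRay y₀ μ →
          ∃ T₀ : ℝ, 1 < T₀ ∧ ∃ φ : ℝ → ℝ, IsJacobLadder y₀ μ T₀ φ ∧ φ T₀ = y₀ ∧
            ∀ (T₁ : ℝ) (ψ : ℝ → ℝ), IsJacobLadder y₀ μ T₁ ψ →
              T₀ ≤ T₁ ∧ EqOn ψ φ (Ici T₁)) ∧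
        -- the expansion at `M(y)`
        (∀ μ : ℝ → ℝ, IsRay y₀ μ → ∀ y : ℝ, y₀ ≤ y →
          ∃ M : ℝ, 0 < M ∧ ladderLHS μ y = hlIntegral M ∧
            (∀ M' : ℝ, ladderLHS μ y = hlIntegral M' → M' = M) ∧
            |hlIntegral M - ladderF c₀ y| ≤ A * (Real.log y / y)) ∧
        -- (A)
        (∀ (μ : ℝ → ℝ) (T₀ : ℝ) (φ : ℝ → ℝ), IsRay y₀ μ → IsJacobLadder y₀ μ T₀ φ →
          ∀ T : ℝ, T₀ ≤ T →
            |hlIntegral T - ladderF c₀ (φ T)| ≤ A * (Real.log (φ T) / φ T) ∧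
            A * (Real.log (φ T) / φ T) ≤ B * (Real.log T / T)) ∧
        -- (B)
        (∀ (μ₁ μ₂ : ℝ → ℝ) (T₁ T₂ : ℝ) (φ₁ φ₂ : ℝ → ℝ), IsRay y₀ μ₁ → IsRay y₀ μ₂ →
          IsJacobLadder y₀ μ₁ T₁ φ₁ → IsJacobLadder y₀ μ₂ T₂ φ₂ →
          ∀ T : ℝ, max T₁ T₂ ≤ T → |φ₁ T - φ₂ T| ≤ B * (1 / T)) ∧
        -- (C)
        (∀ S : Set (ℝ → ℝ), S.Nonempty → (∀ μ ∈ S, IsRay y₀ μ) →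
          BddAbove ((fun μ : ℝ → ℝ => μ y₀) '' S) →
          ∀ T₀ : ℝ, T₀ = sSup ((fun μ : ℝ → ℝ => μ y₀) '' S) →
            (∀ μ ∈ S, ∃ φ : ℝ → ℝ, IsJacobLadder y₀ μ T₀ φ) ∧
            ∀ μ₀ ∈ S, ∀ μ ∈ S, ∀ φ₀ φ : ℝ → ℝ,
              IsJacobLadder y₀ μ₀ T₀ φ₀ → IsJacobLadder y₀ μ T₀ φ →
              ∀ T : ℝ, T₀ ≤ T → φ₀ T - B / T < φ T ∧ φ T < φ₀ T + B / T) := by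
  obtain ⟨A, Y, X₀, hA, hY, hX₀, hlogX₀, hb⟩ := JacobLadder.exists_ladder_bounds
  have hB : (0 : ℝ) < 40 * A := by positivity
  refine ⟨Real.pi, Y, A, 40 * A, by linarith, hA, hB, JacobLadder.tendsto_kober, fun y₀ hy₀ => ?_⟩
  have hy3 : 3 ≤ y₀ := hY.trans hy₀
  have hhl := JacobLadder.hlIntegral_strictMono
  have hbd : ∀ μ : ℝ → ℝ, IsRay y₀ μ → ∀ y, y₀ ≤ y →
      |ladderLHS μ y - ladderF Real.pi y| ≤ A * (Real.log y / y) ∧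
      hlIntegral X₀ < ladderLHS μ y ∧ ladderLHS μ y < hlIntegral (4 * y) := fun μ hμ y hy =>
    hb μ y (hy₀.trans hy) (hμ.lower y hy)
  have hpos : ∀ μ : ℝ → ℝ, IsRay y₀ μ → ∀ y, y₀ ≤ y → 0 < ladderLHS μ y := fun μ hμ y hy => by
    have h := hhl (show (0 : ℝ) < X₀ by linarith)
    rw [JacobLadder.hlIntegral_zero] at h
    exact h.trans (hbd μ hμ y hy).2.1
  have hex : ∀ μ : ℝ → ℝ, IsRay y₀ μ → ∀ T₀, ladderLHS μ y₀ ≤ hlIntegral T₀ →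
      ∃ φ : ℝ → ℝ, IsJacobLadder y₀ μ T₀ φ := fun μ hμ T₀ hT₀ =>
    hμ.exists_ladder hy3 (fun y hy => (hbd μ hμ y hy).2.2)
      (JacobLadder.exists_ladderLHS_ge hA.le fun y hy => (hbd μ hμ y hy).1) hT₀
  -- `X₀ < T < 4 φ(T)` for every ladder `φ`
  have hrange : ∀ (μ : ℝ → ℝ) (T₀ : ℝ) (φ : ℝ → ℝ), IsRay y₀ μ → IsJacobLadder y₀ μ T₀ φ →
      ∀ T, T₀ ≤ T → X₀ < T ∧ T / 4 ≤ φ T := fun μ T₀ φ hμ hφ T hT => by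
    obtain ⟨-, h1, h2⟩ := hbd μ hμ (φ T) (hφ.mem T hT)
    rw [hφ.eqn T hT, hhl.lt_iff_lt] at h1 h2
    exact ⟨h1, by linarith⟩
  have hAest : ∀ (μ : ℝ → ℝ) (T₀ : ℝ) (φ : ℝ → ℝ), IsRay y₀ μ → IsJacobLadder y₀ μ T₀ φ →
      ∀ T, T₀ ≤ T → |hlIntegral T - ladderF Real.pi (φ T)| ≤ A * (Real.log (φ T) / φ T) ∧
        A * (Real.log (φ T) / φ T) ≤ 4 * A * (Real.log T / T) := fun μ T₀ φ hμ hφ T hT => by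
    obtain ⟨h1, h2⟩ := hrange μ T₀ φ hμ hφ T hT
    refine ⟨?_, ?_⟩
    · rw [← hφ.eqn T hT]
      exact (hbd μ hμ (φ T) (hφ.mem T hT)).1
    · have := mul_le_mul_of_nonneg_left
        (JacobLadder.log_div_le_four_mul (hX₀.trans h1.le) h2) hA.le
      linarith
  -- one half of (B), with a constant smaller than `40 A`, as (C) asks for strict inequalities
  have hBest : ∀ (μ₁ μ₂ : ℝ → ℝ) (T₁ T₂ : ℝ) (φ₁ φ₂ : ℝ → ℝ), IsRay y₀ μ₁ → IsRay y₀ μ₂ →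
      IsJacobLadder y₀ μ₁ T₁ φ₁ → IsJacobLadder y₀ μ₂ T₂ φ₂ →
      ∀ T : ℝ, T₁ ≤ T → T₂ ≤ T → φ₁ T - φ₂ T < 40 * A * (1 / T) :=
    fun μ₁ μ₂ T₁ T₂ φ₁ φ₂ hμ₁ hμ₂ hφ₁ hφ₂ T hT₁ hT₂ => by
    obtain ⟨hXT, -⟩ := hrange μ₁ T₁ φ₁ hμ₁ hφ₁ T hT₁
    obtain ⟨-, h2⟩ := hrange μ₂ T₂ φ₂ hμ₂ hφ₂ T hT₂
    have hT0 : 0 < 1 / T := one_div_pos.mpr (by linarith)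
    rcases le_total (φ₁ T) (φ₂ T) with hle | hle
    · exact lt_of_le_of_lt (sub_nonpos.mpr hle) (by positivity)
    obtain ⟨e1, e1'⟩ := hAest μ₁ T₁ φ₁ hμ₁ hφ₁ T hT₁
    obtain ⟨e2, e2'⟩ := hAest μ₂ T₂ φ₂ hμ₂ hφ₂ T hT₂
    have h := JacobLadder.sub_le_of_ladderF_sub_le (c₀ := Real.pi) (E := 8 * A) (by linarith)
      (hlogX₀ T hXT.le) h2 hle (by linarith [(abs_le.mp e1).1, (abs_le.mp e2).2])
    refine h.trans_lt (mul_lt_mul_of_pos_right (by linarith) hT0)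
  refine ⟨fun μ hμ => ?_, fun μ hμ y hy => ?_, fun μ T₀ φ hμ hφ T hT => ?_,
    fun μ₁ μ₂ T₁ T₂ φ₁ φ₂ hμ₁ hμ₂ hφ₁ hφ₂ T hT => ?_, fun S hS hSμ hbdd T₀ hT₀ => ⟨fun μ hμ => ?_,
    fun μ₀ hμ₀ μ hμ φ₀ φ hφ₀ hφ T hT => ?_⟩⟩
  · obtain ⟨T₀, hT₀, -, hT₀e⟩ := hμ.exists_eq_hlIntegral hy3 le_rfl (hpos μ hμ y₀ le_rfl)
    obtain ⟨φ, hφ⟩ := hex μ hμ T₀ hT₀e.le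
    have hinj := (hμ.strictMonoOn hy3).injOn
    refine ⟨T₀, by linarith [(hrange μ T₀ φ hμ hφ T₀ le_rfl).1], φ, hφ,
      hinj (hφ.mem T₀ le_rfl) self_mem_Ici ((hφ.eqn T₀ le_rfl).trans hT₀e.symm),
      fun T₁ ψ hψ => ?_⟩
    have hT : T₀ ≤ T₁ := by
      rw [← hhl.le_iff_le, ← hT₀e, ← hψ.eqn T₁ le_rfl]
      exact (hμ.strictMonoOn hy3).monotoneOn self_mem_Ici (hψ.mem T₁ le_rfl) (hψ.mem T₁ le_rfl)
    exact ⟨hT, fun T hT₁ => hinj (hψ.mem T hT₁) (hφ.mem T (hT.trans hT₁))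
      ((hψ.eqn T hT₁).trans (hφ.eqn T (hT.trans hT₁)).symm)⟩
  · obtain ⟨M, hM, -, hMe⟩ := hμ.exists_eq_hlIntegral hy3 hy (hpos μ hμ y hy)
    refine ⟨M, hM, hMe, fun M' hM' => hhl.injective (hM'.symm.trans hMe), ?_⟩
    rw [← hMe]
    exact (hbd μ hμ y hy).1
  · obtain ⟨h1, h2⟩ := hAest μ T₀ φ hμ hφ T hT
    refine ⟨h1, h2.trans ?_⟩
    have hT1 := (hrange μ T₀ φ hμ hφ T hT).1
    have : 0 ≤ Real.log T / T := div_nonneg (Real.log_nonneg (by linarith)) (by linarith)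
    exact mul_le_mul_of_nonneg_right (by linarith) this
  · have hT1 := (le_max_left _ _).trans hT
    have hT2 := (le_max_right _ _).trans hT
    have h1 := hBest μ₁ μ₂ T₁ T₂ φ₁ φ₂ hμ₁ hμ₂ hφ₁ hφ₂ T hT1 hT2
    have h2 := hBest μ₂ μ₁ T₂ T₁ φ₂ φ₁ hμ₂ hμ₁ hφ₂ hφ₁ T hT2 hT1
    exact abs_le.mpr ⟨by linarith, h1.le⟩
  · have hr := hSμ μ hμ
    refine hex μ hr T₀ ?_
    refine (JacobLadder.ladderLHS_le_hlIntegral (by linarith) (hr.pos hy3 le_rfl).le).trans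
      (hhl.monotone ?_)
    rw [hT₀]
    exact le_csSup hbdd ⟨μ, hμ, rfl⟩
  · have h1 := hBest μ₀ μ T₀ T₀ φ₀ φ (hSμ μ₀ hμ₀) (hSμ μ hμ) hφ₀ hφ T hT hT
    have h2 := hBest μ μ₀ T₀ T₀ φ φ₀ (hSμ μ hμ) (hSμ μ₀ hμ₀) hφ hφ₀ T hT hT
    rw [mul_one_div] at h1 h2
    exact ⟨by linarith, by linarith⟩
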